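/- Conventions. For permutations $h,v$ of a finite set of labels, the square-tiled surface $X=(h,v)$ is obtained from unit squares, one for each label, by gluing by translations the right side of square $i$ to the left side of square $h(i)$ and the top side of square $i$ to the bottom side of square $v(i)$; permutations are composed from right to left. Put $T(h,v)=(h,vh^{-1})$ and $S(h,v)=(hv^{-1},v)$. Let $p\colon X\to\mathbb R^2/\mathbb Z^2$ be the induced covering of the square torus, branched over $0$, and $\omega=p^*dz$. Let $\mathrm{Aff}(X)$ be the group of homeomorphisms of $X$ that preserve the set of vertices of the squares (in the surface $C$ below these are exactly the zeros of $\omega$) and that are, off the vertices and in the coordinates of the squares, of the form $z\mapsto Az+b$ with a constant derivative $A\in\mathrm{SL}(2,\mathbb R)$. The Veech group $\mathrm{SL}(X)$ is the group of these derivatives, and $\mathrm{Aut}(X)$ is the group of homeomorphisms $f$ of $X$ with $p\circ f=p$. Let $H_1^{(0)}(X)=\{\gamma\in H_1(X;\mathbb R):\int_\gamma\omega=0\}$ be the zero-holonomy subspace, and let $\alpha(f)$ be the restriction of $f_*$ to $H_1^{(0)}(X)$ for $f\in\mathrm{Aff}(X)$. The Kontsevich--Zorich monodromy group of $X$ is $\alpha(\mathrm{Aff}(X))$.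 The surface. Let $C_1=(h_1,v_1)$ be the 4-cover of the cube, with squares $1,\dots,24$ and $$h_1=(1,2,3,4)(5,6,7,8)(9,10,11,12)(13,14,15,16)(17,18,19,20)(21,22,23,24),$$ $$v_1=(1,9,14,22)(2,20,13,7)(3,24,16,11)(4,5,15,18)(6,10,17,21)(8,23,19,12),$$ and let $C=TS^2C_1=(h,v)$. In $H_1(C;\mathbb R)$ let $\sigma_i$ be the class of the horizontal closed curve (directed to the right) through the middle of square $i$, $\zeta_i$ the class of the vertical closed curve (directed upwards) through the middle of square $i$, and $\eta_i$ the class of the closed curve of slope $1$ (directed up and to the right) that starts at the midpoint of the bottom side of square $i$ (so that it runs through the squares $i$, $h(i)$, $vh(i)$, $hvh(i)$, and so on). Put $\Sigma_i=\sigma_i-\sigma_9$ for $i=1,2,3,5,8$, $Z_j=\zeta_j-\zeta_8$ for $j=1,\dots,5$, and $H_k=\eta_k-2\sigma_9-\tfrac43\zeta_8$ for $k=1,2,3,4,6,8$. Theorem. (1) The Veech group of $C$ is the subgroup of $\mathrm{SL}(2,\mathbb R)$ generated by $g_1=\begin{pmatrix}1&2\\0&1\end{pmatrix}$, $g_2=\begin{pmatrix}5&-2\\3&-1\end{pmatrix}$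 and $g_3=\begin{pmatrix}3&-2\\5&-3\end{pmatrix}$. (2) $\Sigma_1,\Sigma_2,\Sigma_3,\Sigma_5,\Sigma_8,Z_1,Z_2,Z_3,Z_4,Z_5,H_1,H_2,H_3,H_4,H_6,H_8$ is a basis of $H_1^{(0)}(C)$, and $f_*$ maps $H_1^{(0)}(C)$ isomorphically onto itself for every $f\in\mathrm{Aff}(C)$. (3) There are $f_1,f_2,f_3\in\mathrm{Aff}(C)$ with derivatives $g_1,g_2,g_3$ such that $\alpha(f_1),\alpha(f_2),\alpha(f_3)$ have, in the ordered basis (2), the matrices (whose columns are the coordinates of the images of the basis vectors) $\alpha(g_1)$, $\alpha(g_2)$, $\alpha(g_3)$ below, and, up to the action of the automorphism group, these matrices generate the Kontsevich--Zorich monodromy group of $C$: the group $\alpha(\mathrm{Aff}(C))$ is generated by $\alpha(f_1),\alpha(f_2),\alpha(f_3)$ together with $\alpha(\mathrm{Aut}(C))$. $$\alpha(g_1)=\left(\begin{array}{cccccccccccccccc} 1 & 0 & 0 & 0 & 0 & 0 & -1 & -7 & -8 & -1 & -\tfrac{1}{3} & -\tfrac{19}{3} & -\tfrac{13}{3} &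 -\tfrac{19}{3} & -\tfrac{16}{3} & -\tfrac{4}{3} \\ 0 & 1 & 0 & 0 & 0 & 0 & 1 & 1 & 2 & 1 & \tfrac{4}{3} & \tfrac{7}{3} & \tfrac{4}{3} & \tfrac{7}{3} & \tfrac{1}{3} & \tfrac{1}{3} \\ 0 & 0 & 1 & 0 & 0 & 0 & 0 & 8 & 8 & 0 & \tfrac{1}{3} & \tfrac{22}{3} & \tfrac{13}{3} & \tfrac{22}{3} & \tfrac{13}{3} & \tfrac{1}{3} \\ 0 & 0 & 0 & 1 & 0 & 0 & 1 & 2 & 1 & 1 & \tfrac{1}{3} & \tfrac{7}{3} & \tfrac{1}{3} & \tfrac{7}{3} & \tfrac{4}{3} & \tfrac{4}{3} \\ 0 & 0 & 0 & 0 & 1 & 0 & -1 & 0 & 1 & -1 & -1 & 1 & -1 & 1 & 0 & 0 \\ 0 & 0 & 0 & 0 & 0 & -1 & -1 & -\tfrac{11}{2} & -\tfrac{15}{2} & -1 & -\tfrac{5}{3} & -\tfrac{31}{6} & -\tfrac{11}{3} & -\tfrac{43}{6} & -\tfrac{31}{6} & -\tfrac{7}{6} \\ 0 & 0 & 0 &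 0 & 0 & 0 & 0 & \tfrac{3}{2} & \tfrac{7}{2} & 1 & 0 & \tfrac{3}{2} & 2 & \tfrac{7}{2} & \tfrac{1}{2} & \tfrac{1}{2} \\ 0 & 0 & 0 & 0 & 0 & 0 & 0 & 2 & 1 & 0 & \tfrac{1}{3} & \tfrac{4}{3} & \tfrac{1}{3} & \tfrac{4}{3} & \tfrac{1}{3} & \tfrac{1}{3} \\ 0 & 0 & 0 & 0 & 0 & 0 & 0 & 1 & 2 & 0 & \tfrac{1}{3} & \tfrac{4}{3} & \tfrac{1}{3} & \tfrac{4}{3} & \tfrac{1}{3} & \tfrac{1}{3} \\ 0 & 0 & 0 & 0 & 0 & 0 & 1 & -\tfrac{1}{2} & -\tfrac{5}{2} & 0 & \tfrac{1}{3} & -\tfrac{1}{6} & -\tfrac{5}{3} & -\tfrac{13}{6} & -\tfrac{1}{6} & -\tfrac{1}{6} \\ 0 & 0 & 0 & 0 & 0 & 1 & 1 & \tfrac{5}{2} & \tfrac{5}{2} & 0 & 2 & \tfrac{5}{2} & 1 & \tfrac{5}{2} & \tfrac{5}{2} & \tfrac{1}{2} \\ 0 & 0 & 0 & 0 & 0 &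 -1 & 0 & -4 & -6 & -1 & -1 & -3 & -3 & -6 & -3 & -1 \\ 0 & 0 & 0 & 0 & 0 & -1 & -1 & -\tfrac{7}{2} & -\tfrac{7}{2} & 0 & -\tfrac{4}{3} & -\tfrac{23}{6} & -\tfrac{1}{3} & -\tfrac{23}{6} & -\tfrac{17}{6} & -\tfrac{5}{6} \\ 0 & 0 & 0 & 0 & 0 & 1 & 0 & 3 & 5 & 1 & \tfrac{2}{3} & \tfrac{8}{3} & \tfrac{8}{3} & \tfrac{17}{3} & \tfrac{8}{3} & \tfrac{2}{3} \\ 0 & 0 & 0 & 0 & 0 & 1 & 1 & \tfrac{3}{2} & \tfrac{3}{2} & 0 & \tfrac{2}{3} & \tfrac{7}{6} & \tfrac{2}{3} & \tfrac{7}{6} & \tfrac{19}{6} & \tfrac{1}{6} \\ 0 & 0 & 0 & 0 & 0 & -1 & -1 & -\tfrac{5}{2} & -\tfrac{5}{2} & 0 & -1 & -\tfrac{5}{2} & -1 & -\tfrac{5}{2} & -\tfrac{5}{2} & \tfrac{1}{2} \end{array}\right),$$ $$\alpha(g_2)=\left(\begin{array}{cccccccccccccccc} 0 & -2 & -1 &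 -5 & 1 & 0 & 8 & 7 & 1 & 6 & \tfrac{13}{3} & \tfrac{1}{3} & \tfrac{13}{3} & \tfrac{1}{3} & \tfrac{4}{3} & \tfrac{4}{3} \\ -1 & 0 & -1 & 1 & 0 & 0 & -2 & -1 & -1 & -2 & -\tfrac{7}{3} & -\tfrac{4}{3} & -\tfrac{7}{3} & -\tfrac{4}{3} & -\tfrac{1}{3} & -\tfrac{1}{3} \\ 0 & 1 & 1 & 6 & -1 & 0 & -8 & -8 & 0 & -6 & -\tfrac{16}{3} & -\tfrac{1}{3} & -\tfrac{16}{3} & -\tfrac{1}{3} & -\tfrac{1}{3} & -\tfrac{1}{3} \\ 0 & 0 & 0 & 1 & 0 & 0 & -1 & -2 & -1 & -1 & -\tfrac{7}{3} & -\tfrac{1}{3} & -\tfrac{7}{3} & -\tfrac{1}{3} & -\tfrac{4}{3} & -\tfrac{4}{3} \\ 1 & 1 & 1 & 2 & 1 & 0 & -1 & 0 & 1 & -1 & 1 & 3 & 1 & 3 & 2 & 2 \\ 0 & -2 & 0 & -\tfrac{9}{2} & 1 & 1 & \tfrac{15}{2} & \tfrac{11}{2} & 1 & \tfrac{11}{2}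 & \tfrac{25}{6} & \tfrac{2}{3} & \tfrac{25}{6} & \tfrac{2}{3} & \tfrac{7}{6} & \tfrac{7}{6} \\ -1 & 1 & -1 & \tfrac{3}{2} & 0 & 0 & -\tfrac{7}{2} & -\tfrac{3}{2} & 0 & -\tfrac{5}{2} & -\tfrac{5}{2} & -1 & -\tfrac{5}{2} & -1 & -\tfrac{1}{2} & -\tfrac{1}{2} \\ 0 & -1 & 0 & 1 & -1 & 0 & -1 & -2 & 0 & -1 & -\tfrac{7}{3} & -\tfrac{4}{3} & -\tfrac{7}{3} & -\tfrac{4}{3} & -\tfrac{4}{3} & -\tfrac{4}{3} \\ 0 & 1 & 0 & 2 & 0 & 0 & -2 & -1 & 0 & -2 & -\tfrac{1}{3} & \tfrac{2}{3} & -\tfrac{1}{3} & \tfrac{2}{3} & \tfrac{2}{3} & \tfrac{2}{3} \\ 0 & -1 & 0 & -\tfrac{3}{2} & 0 & 0 & \tfrac{5}{2} & \tfrac{1}{2} & -1 & \tfrac{3}{2} & \tfrac{1}{6} & -\tfrac{1}{3} & \tfrac{1}{6} & -\tfrac{1}{3} & -\tfrac{5}{6} & -\tfrac{5}{6} \\ 1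 & 0 & 0 & \tfrac{5}{2} & -1 & -1 & -\tfrac{5}{2} & -\tfrac{5}{2} & -1 & -\tfrac{5}{2} & -\tfrac{3}{2} & -1 & -\tfrac{3}{2} & 0 & -\tfrac{1}{2} & -\tfrac{1}{2} \\ 0 & -1 & 1 & -3 & 1 & 1 & 6 & 4 & 0 & 4 & 4 & 2 & 5 & 2 & 2 & 2 \\ -1 & 0 & 0 & -\tfrac{7}{2} & 1 & 1 & \tfrac{7}{2} & \tfrac{7}{2} & 1 & \tfrac{7}{2} & \tfrac{17}{6} & \tfrac{1}{3} & \tfrac{17}{6} & -\tfrac{2}{3} & \tfrac{5}{6} & \tfrac{5}{6} \\ 0 & 1 & -1 & 2 & -1 & -1 & -5 & -3 & 0 & -3 & -\tfrac{11}{3} & -\tfrac{5}{3} & -\tfrac{14}{3} & -\tfrac{5}{3} & -\tfrac{5}{3} & -\tfrac{5}{3} \\ 1 & 1 & 1 & \tfrac{1}{2} & 0 & -1 & -\tfrac{3}{2} & -\tfrac{3}{2} & -1 & -\tfrac{1}{2} & \tfrac{5}{6} & \tfrac{4}{3} & \tfrac{5}{6} & \tfrac{4}{3} & \tfrac{5}{6}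 & -\tfrac{1}{6} \\ -1 & -1 & -1 & -\tfrac{3}{2} & 0 & 1 & \tfrac{5}{2} & \tfrac{5}{2} & 1 & \tfrac{3}{2} & \tfrac{1}{2} & -1 & \tfrac{1}{2} & -1 & -\tfrac{3}{2} & -\tfrac{1}{2} \end{array}\right),$$ $$\alpha(g_3)=\left(\begin{array}{cccccccccccccccc} -1 & 5 & -1 & 1 & 1 & 0 & -4 & 1 & -7 & -6 & 0 & 1 & 0 & 1 & -3 & -3 \\ 0 & -1 & 0 & 1 & 0 & 0 & 0 & -1 & 1 & 0 & -1 & 0 & -1 & 0 & 1 & 1 \\ 1 & -6 & 1 & -1 & 0 & 0 & 6 & 0 & 8 & 8 & \tfrac{1}{3} & \tfrac{1}{3} & \tfrac{1}{3} & \tfrac{1}{3} & \tfrac{16}{3} & \tfrac{16}{3} \\ -1 & -2 & -1 & -1 & -1 & 0 & 1 & -1 & 0 & 1 & -2 & -3 & -2 & -3 & -1 & -1 \\ 0 & -1 & 0 & 0 & 0 & 0 & 1 & 1 & 2 & 1 & \tfrac{4}{3} & \tfrac{1}{3} & \tfrac{4}{3} & \tfrac{1}{3} & \tfrac{7}{3}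 & \tfrac{7}{3} \\ -1 & \tfrac{9}{2} & -\tfrac{1}{2} & 0 & 1 & 0 & -\tfrac{7}{2} & 0 & -\tfrac{13}{2} & -\tfrac{9}{2} & \tfrac{1}{6} & \tfrac{2}{3} & \tfrac{1}{6} & \tfrac{2}{3} & -\tfrac{17}{6} & -\tfrac{17}{6} \\ 0 & -\tfrac{3}{2} & \tfrac{1}{2} & 1 & 0 & 1 & \tfrac{3}{2} & 0 & \tfrac{7}{2} & \tfrac{3}{2} & \tfrac{1}{2} & 1 & \tfrac{1}{2} & 1 & \tfrac{5}{2} & \tfrac{5}{2} \\ 0 & -2 & 0 & -1 & 0 & 0 & 2 & 0 & 1 & 2 & -\tfrac{2}{3} & -\tfrac{2}{3} & -\tfrac{2}{3} & -\tfrac{2}{3} & \tfrac{1}{3} & \tfrac{1}{3} \\ 1 & -1 & 1 & 1 & 0 & 0 & 1 & 0 & 2 & 1 & \tfrac{4}{3} & \tfrac{4}{3} & \tfrac{4}{3} & \tfrac{4}{3} & \tfrac{7}{3} & \tfrac{7}{3} \\ -1 & \tfrac{1}{2} & -\tfrac{3}{2} & -1 & -1 & -1 & -\tfrac{3}{2}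 & -1 & -\tfrac{7}{2} & -\tfrac{3}{2} & -\tfrac{5}{2} & -3 & -\tfrac{5}{2} & -3 & -\tfrac{7}{2} & -\tfrac{7}{2} \\ 0 & -\tfrac{5}{2} & -\tfrac{1}{2} & -1 & -1 & 0 & \tfrac{3}{2} & 0 & \tfrac{5}{2} & \tfrac{5}{2} & -\tfrac{1}{2} & -2 & -\tfrac{1}{2} & -1 & \tfrac{1}{2} & \tfrac{1}{2} \\ 0 & 4 & 0 & 0 & 0 & 0 & -3 & 0 & -5 & -4 & \tfrac{1}{3} & \tfrac{1}{3} & \tfrac{1}{3} & \tfrac{1}{3} & -\tfrac{8}{3} & -\tfrac{11}{3} \\ -1 & \tfrac{5}{2} & -\tfrac{1}{2} & 0 & 0 & 0 & -\tfrac{5}{2} & 0 & -\tfrac{7}{2} & -\tfrac{7}{2} & -\tfrac{1}{2} & 0 & -\tfrac{1}{2} & -1 & -\tfrac{5}{2} & -\tfrac{5}{2} \\ 1 & -2 & 1 & 0 & 0 & 0 & 2 & 0 & 4 & 3 & \tfrac{2}{3} & \tfrac{2}{3} & \tfrac{2}{3} & \tfrac{2}{3} & \tfrac{5}{3} & \tfrac{8}{3}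 \\ 0 & -\tfrac{1}{2} & -\tfrac{1}{2} & 0 & 0 & 0 & \tfrac{1}{2} & 0 & \tfrac{1}{2} & \tfrac{1}{2} & \tfrac{1}{6} & -\tfrac{1}{3} & -\tfrac{5}{6} & -\tfrac{1}{3} & \tfrac{1}{6} & \tfrac{1}{6} \\ 0 & \tfrac{3}{2} & \tfrac{1}{2} & 1 & 1 & 0 & -\tfrac{3}{2} & 0 & -\tfrac{3}{2} & -\tfrac{3}{2} & -\tfrac{1}{6} & \tfrac{4}{3} & \tfrac{5}{6} & \tfrac{4}{3} & -\tfrac{1}{6} & -\tfrac{1}{6} \end{array}\right).$$ -/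

import Mathlib

open Topology unitInterval

/-! ### Singular homology in degree one, with real coefficients -/

namespace SingularHomology

/-- Singular `n`-simplices of `X`. -/
abbrev Simplex (n : ℕ) (X : Type) [TopologicalSpace X] : Type :=
  C(stdSimplex ℝ (Fin (n + 1)), X)

/-- Real singular `n`-chains of `X`: the real vector space with basis the singular `n`-simplices. -/
def Chain (n : ℕ) (X : Type) [TopologicalSpace X] : Type :=
  Simplex n X →₀ ℝ

noncomputable instance (n : ℕ) (X : Type) [TopologicalSpace X] : AddCommGroup (Chain n X) :=
  inferInstanceAs (AddCommGroup (Simplex n X →₀ ℝ))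

noncomputable instance (n : ℕ) (X : Type) [TopologicalSpace X] : Module ℝ (Chain n X) :=
  inferInstanceAs (Module ℝ (Simplex n X →₀ ℝ))

variable {X Y Z : Type} [TopologicalSpace X] [TopologicalSpace Y] [TopologicalSpace Z]

/-- A simplex as a chain. -/
noncomputable def simplexChain {n : ℕ} (s : Simplex n X) : Chain n X :=
  Finsupp.single s 1

/-- The linear extension of a map on simplices to chains. -/
noncomputable def pushforward {m n : ℕ} (g : Simplex m X → Simplex n Y) :
    Chain m X →ₗ[ℝ] Chain n Y :=
  Finsupp.lmapDomain ℝ ℝ g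

theorem pushforward_simplexChain {m n : ℕ} (g : Simplex m X → Simplex n Y) (s : Simplex m X) :
    pushforward g (simplexChain s) = simplexChain (g s) :=
  Finsupp.mapDomain_single

theorem pushforward_pushforward {l m n : ℕ} (g : Simplex l X → Simplex m Y)
    (g' : Simplex m Y → Simplex n Z) (c : Chain l X) :
    pushforward g' (pushforward g c) = pushforward (g' ∘ g) c :=
  Finsupp.mapDomain_comp.symm

/-- The inclusion of the face opposite to the vertex `k`. -/
noncomputable def faceMap (n : ℕ) (k : Fin (n + 2)) :
    C(stdSimplex ℝ (Fin (n + 1)), stdSimplex ℝ (Fin (n + 2))) :=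
  ⟨stdSimplex.map k.succAbove, stdSimplex.continuous_map _⟩

/-- The singular boundary operator. -/
noncomputable def boundary (n : ℕ) (X : Type) [TopologicalSpace X] :
    Chain (n + 1) X →ₗ[ℝ] Chain n X :=
  ∑ k : Fin (n + 2), (-1 : ℝ) ^ (k : ℕ) • pushforward fun s => s.comp (faceMap n k)

/-- The map on chains induced by a continuous map. -/
noncomputable def chainMap (n : ℕ) (f : C(X, Y)) : Chain n X →ₗ[ℝ] Chain n Y :=
  pushforward fun s => f.comp s

theorem boundary_chainMap (n : ℕ) (f : C(X, Y)) (c : Chain (n + 1) X) :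
    boundary n Y (chainMap (n + 1) f c) = chainMap n f (boundary n X c) := by
  simp only [boundary, chainMap, LinearMap.sum_apply, LinearMap.smul_apply, map_sum, map_smul,
    pushforward_pushforward]
  rfl

/-- Singular 1-cycles. -/
noncomputable abbrev cycles (X : Type) [TopologicalSpace X] : Submodule ℝ (Chain 1 X) :=
  LinearMap.ker (boundary 0 X)

/-- Singular 1-boundaries, as a subspace of the space of 1-cycles. -/
noncomputable abbrev boundaries (X : Type) [TopologicalSpace X] : Submodule ℝ (cycles X) :=
  (LinearMap.range (boundary 1 X)).comap (cycles X).subtype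

/-- The first singular homology `H₁(X; ℝ)`. -/
abbrev H1 (X : Type) [TopologicalSpace X] : Type :=
  cycles X ⧸ boundaries X

/-- The map on 1-cycles induced by a continuous map. -/
noncomputable def cyclesMap (f : C(X, Y)) : cycles X →ₗ[ℝ] cycles Y :=
  (chainMap 1 f).restrict fun c hc => by
    rw [LinearMap.mem_ker] at hc ⊢
    rw [boundary_chainMap, hc, map_zero]

/-- The map `f_* : H₁(X; ℝ) → H₁(Y; ℝ)` induced by a continuous map. -/
noncomputable def H1map (f : C(X, Y)) : H1 X →ₗ[ℝ] H1 Y :=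
  (boundaries X).mapQ (boundaries Y) (cyclesMap f) (by
    rintro c ⟨b, hb⟩
    exact ⟨chainMap 2 f b, by rw [boundary_chainMap, hb]; rfl⟩)

end SingularHomology

/-! ### Square-tiled surfaces -/

open SingularHomology

/-- Gluing data of a square-tiled surface with `n` unit squares: the right side of square `i` is
glued to the left side of square `h i`, and its top side to the bottom side of square `v i`. -/
structure Origami (n : ℕ) where
  h : Equiv.Perm (Fin n)
  v : Equiv.Perm (Fin n)

namespace Origami

variable {n : ℕ}

/-- The action of `T = (1 1; 0 1)` on square-tiled surfaces. -/
def T (O : Origami n) : Origami n := ⟨O.h, O.v * O.h⁻¹⟩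

/-- The action of `S = (1 0; 1 1)` on square-tiled surfaces. -/
def S (O : Origami n) : Origami n := ⟨O.h * O.v⁻¹, O.v⟩

/-- The identifications between the sides of the squares. -/
inductive Glue (O : Origami n) : Fin n × (I × I) → Fin n × (I × I) → Prop
  | side (i : Fin n) (y : I) : Glue O (i, (1, y)) (O.h i, (0, y))
  | top (i : Fin n) (x : I) : Glue O (i, (x, 1)) (O.v i, (x, 0))

/-- The surface: the disjoint union of `n` closed unit squares, with sides identified. -/
def Surface (O : Origami n) : Type := Quot O.Glue

instance (O : Origami n) : TopologicalSpace O.Surface :=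
  inferInstanceAs (TopologicalSpace (Quot O.Glue))

/-- The point of the surface with coordinates `z` in the square `i`. -/
def pt (O : Origami n) (i : Fin n) (z : I × I) : O.Surface := Quot.mk _ (i, z)

theorem continuous_pt (O : Origami n) (i : Fin n) : Continuous (O.pt i) :=
  continuous_quot_mk.comp (Continuous.prodMk_right i)

/-- The vertices of the tiling. -/
def vertices (O : Origami n) : Set O.Surface :=
  {p | ∃ i x y, (x = 0 ∨ x = 1) ∧ (y = 0 ∨ y = 1) ∧ p = O.pt i (x, y)}

/-- The covering of the square torus `(ℝ/ℤ)²`, branched over `0` only. -/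
noncomputable def toTorus (O : Origami n) : O.Surface → UnitAddCircle × UnitAddCircle :=
  Quot.lift (fun q => (((q.2.1 : ℝ) : UnitAddCircle), ((q.2.2 : ℝ) : UnitAddCircle))) (by
    rintro _ _ (⟨i, y⟩ | ⟨i, x⟩) <;> simp [AddCircle.coe_period])

/-- The plane vector of a point of the unit square. -/
def vec (z : I × I) : Fin 2 → ℝ := ![z.1, z.2]

/-- `f` is an affine homeomorphism with derivative `A`: it preserves the set of vertices (for the
surfaces considered here, all vertices are cone points, so these are the zeros of the 1-form), and
in the coordinates of the squares it has the form `z ↦ A z + b` near each other point. -/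
def IsAffine (O : Origami n) (f : O.Surface ≃ₜ O.Surface)
    (A : Matrix.SpecialLinearGroup (Fin 2) ℝ) : Prop :=
  (∀ p, f p ∈ O.vertices ↔ p ∈ O.vertices) ∧
  ∀ (i j : Fin n) (z w : I × I), O.pt i z ∉ O.vertices → f (O.pt i z) = O.pt j w →
    ∀ᶠ z' in 𝓝 z, ∀ w' : I × I,
      vec w' - vec w = A.1.mulVec (vec z' - vec z) → f (O.pt i z') = O.pt j w'

/-- The affine group `Aff(X)`. -/
def affineGroup (O : Origami n) : Set (O.Surface ≃ₜ O.Surface) :=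
  {f | ∃ A, O.IsAffine f A}

/-- The Veech group `SL(X)`: the matrices `A` such that `A · X` and `X` are isomorphic translation
surfaces, that is, the derivatives of the affine homeomorphisms of `X`. -/
def veechGroup (O : Origami n) : Set (Matrix.SpecialLinearGroup (Fin 2) ℝ) :=
  {A | ∃ f, O.IsAffine f A}

/-- The automorphism group `Aut(X)`: the homeomorphisms over the square torus. -/
def automorphismGroup (O : Origami n) : Set (O.Surface ≃ₜ O.Surface) :=
  {f | ∀ p, O.toTorus (f p) = O.toTorus p}

/-! ### Holonomy -/

open Classical in
/-- The increment of a continuous real-valued lift of a path in the circle `ℝ/ℤ`. -/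
noncomputable def increment (θ : stdSimplex ℝ (Fin 2) → UnitAddCircle) : ℝ :=
  if H : ∃ l : C(stdSimplex ℝ (Fin 2), ℝ), ∀ t, ((l t : ℝ) : UnitAddCircle) = θ t then
    H.choose (stdSimplex.vertex 1) - H.choose (stdSimplex.vertex 0)
  else 0

/-- The holonomy `∫_c ω` of a singular 1-chain, where `ω` is the pull-back of `dz = dx + i dy`
from the square torus. -/
noncomputable def holonomy (O : Origami n) : Chain 1 O.Surface →ₗ[ℝ] ℝ × ℝ :=
  Finsupp.linearCombination ℝ fun s : Simplex 1 O.Surface =>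
    (increment fun t => (O.toTorus (s t)).1, increment fun t => (O.toTorus (s t)).2)

/-- The zero-holonomy subspace of `H₁(X; ℝ)`: the classes of the 1-cycles of holonomy zero. -/
noncomputable def zeroHolonomy (O : Origami n) : Submodule ℝ (H1 O.Surface) :=
  ((LinearMap.ker O.holonomy).comap (cycles O.Surface).subtype).map (boundaries O.Surface).mkQ

/-! ### The monodromy representation -/

/-- `φ = α(f)`: the automorphism `φ` of the zero-holonomy subspace is the restriction of `f_*`. -/
def IsMonodromy (O : Origami n) (f : O.Surface ≃ₜ O.Surface)
    (φ : O.zeroHolonomy ≃ₗ[ℝ] O.zeroHolonomy) : Prop :=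
  ∀ c : O.zeroHolonomy, (φ c : H1 O.Surface) = H1map (f : C(O.Surface, O.Surface)) c

/-- `α(G)`, for a set `G` of homeomorphisms of the surface. -/
def monodromyImage (O : Origami n) (G : Set (O.Surface ≃ₜ O.Surface)) :
    Set (O.zeroHolonomy ≃ₗ[ℝ] O.zeroHolonomy) :=
  {φ | ∃ f ∈ G, O.IsMonodromy f φ}

/-- The Kontsevich–Zorich monodromy group `α(Aff(X))`. -/
def kzMonodromyGroup (O : Origami n) : Set (O.zeroHolonomy ≃ₗ[ℝ] O.zeroHolonomy) :=
  O.monodromyImage O.affineGroup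

/-! ### Straight closed curves -/

/-- The straight segment from `z` to `w` in the square `i`, as a singular 1-simplex. -/
noncomputable def segment (O : Origami n) (i : Fin n) (z w : I × I) : Simplex 1 O.Surface where
  toFun t := O.pt i
    (⟨t 0 * z.1 + t 1 * w.1,
        convex_Icc (0 : ℝ) 1 z.1.2 w.1.2 (t.2.1 0) (t.2.1 1) (stdSimplex.add_eq_one t)⟩,
      ⟨t 0 * z.2 + t 1 * w.2,
        convex_Icc (0 : ℝ) 1 z.2.2 w.2.2 (t.2.1 0) (t.2.1 1) (stdSimplex.add_eq_one t)⟩)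
  continuous_toFun := by
    have h (k : Fin 2) : Continuous fun t : stdSimplex ℝ (Fin 2) => t k :=
      (continuous_apply k).comp continuous_subtype_val
    exact (O.continuous_pt i).comp
      (.prodMk
        (.subtype_mk (((h 0).mul continuous_const).add ((h 1).mul continuous_const)) _)
        (.subtype_mk (((h 0).mul continuous_const).add ((h 1).mul continuous_const)) _))

/-- The segment from `z` to `w` in the square `i`, as a singular 1-chain. -/
noncomputable def segmentChain (O : Origami n) (i : Fin n) (z w : I × I) : Chain 1 O.Surface :=
  simplexChain (O.segment i z w)

/-- A point of the surface as a singular 0-chain. -/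
noncomputable def pointChain (O : Origami n) (i : Fin n) (z : I × I) : Chain 0 O.Surface :=
  simplexChain (ContinuousMap.const _ (O.pt i z))

theorem boundary_segmentChain (O : Origami n) (i : Fin n) (z w : I × I) :
    boundary 0 O.Surface (O.segmentChain i z w) = O.pointChain i w - O.pointChain i z := by
  have key (k : Fin 2) (u : I × I) (hu : u = if k = 0 then w else z) :
      (O.segment i z w).comp (faceMap 0 k) = ContinuousMap.const _ (O.pt i u) := by
    ext t
    have ht : t = stdSimplex.vertex 0 := Subsingleton.elim _ _
    have hf : faceMap 0 k t = stdSimplex.vertex (k.succAbove 0) := by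
      rw [ht]
      exact stdSimplex.map_vertex _ _
    subst hu
    rw [ContinuousMap.comp_apply, hf]
    change O.pt i _ = O.pt i _
    congr 1
    fin_cases k <;> ext <;> simp
  simp [boundary, segmentChain, pointChain, Fin.sum_univ_two, key 0 w rfl, key 1 z rfl,
    pushforward_simplexChain, sub_eq_add_neg]

/-- The squares that one meets when one repeats `p`, beginning in `i`. -/
def orbit (p : Equiv.Perm (Fin n)) (i : Fin n) : Finset (Fin n) :=
  Finset.univ.filter fun j => p.SameCycle i j

theorem sum_orbit_sub {M : Type} [AddCommGroup M] (p : Equiv.Perm (Fin n)) (i : Fin n)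
    (F : Fin n → M) : ∑ j ∈ orbit p i, (F (p j) - F j) = 0 := by
  rw [Finset.sum_sub_distrib, sub_eq_zero]
  refine Finset.sum_equiv p (fun j => ?_) (fun _ _ => rfl)
  simp [orbit]

/-- The midpoint of the unit interval. -/
noncomputable def half : I := ⟨1 / 2, by norm_num, by norm_num⟩

/-- The horizontal closed curve `σ_i` at half height, from the left side of the square `i`. -/
noncomputable def sigma (O : Origami n) (i : Fin n) : cycles O.Surface :=
  ⟨∑ j ∈ orbit O.h i, O.segmentChain j (0, half) (1, half), by
    rw [LinearMap.mem_ker, map_sum, ← sum_orbit_sub O.h i fun j => O.pointChain j (0, half)]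
    refine Finset.sum_congr rfl fun j _ => ?_
    rw [boundary_segmentChain, pointChain, pt, Quot.sound (Glue.side j half)]
    rfl⟩

/-- The vertical closed curve `ζ_i` at half width, from the bottom side of the square `i`. -/
noncomputable def zeta (O : Origami n) (i : Fin n) : cycles O.Surface :=
  ⟨∑ j ∈ orbit O.v i, O.segmentChain j (half, 0) (half, 1), by
    rw [LinearMap.mem_ker, map_sum, ← sum_orbit_sub O.v i fun j => O.pointChain j (half, 0)]
    refine Finset.sum_congr rfl fun j _ => ?_
    rw [boundary_segmentChain, pointChain, pt, Quot.sound (Glue.top j half)]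
    rfl⟩

/-- The closed curve `η_i` of slope one, from the midpoint of the bottom side of the square `i`.
From the square `j` it leaves to the right, into `h j`, and then upwards, into `v (h j)`. -/
noncomputable def eta (O : Origami n) (i : Fin n) : cycles O.Surface :=
  ⟨∑ j ∈ orbit (O.v * O.h) i,
      (O.segmentChain j (half, 0) (1, half) + O.segmentChain (O.h j) (0, half) (half, 1)), by
    rw [LinearMap.mem_ker, map_sum,
      ← sum_orbit_sub (O.v * O.h) i fun j => O.pointChain j (half, 0)]
    refine Finset.sum_congr rfl fun j _ => ?_
    have h1 : O.pt j (1, half) = O.pt (O.h j) (0, half) := Quot.sound (Glue.side j half)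
    have h2 : O.pt (O.h j) (half, 1) = O.pt (O.v (O.h j)) (half, 0) :=
      Quot.sound (Glue.top (O.h j) half)
    rw [map_add, boundary_segmentChain, boundary_segmentChain]
    simp only [pointChain, h1, h2, Equiv.Perm.mul_apply]
    abel⟩

end Origami

/-! ### The 4-cover of the cube -/

namespace CubeCover

/-- The unfolding of the cube. The 24 squares are labelled by the residues `1, …, 24` modulo `24`
(so the label `24` is the element `0` of `Fin 24`). -/
def C₁ : Origami 24 where
  h := List.formPerm [1, 2, 3, 4] * List.formPerm [5, 6, 7, 8] * List.formPerm [9, 10, 11, 12] *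
    List.formPerm [13, 14, 15, 16] * List.formPerm [17, 18, 19, 20] *
    List.formPerm [21, 22, 23, 24]
  v := List.formPerm [1, 9, 14, 22] * List.formPerm [2, 20, 13, 7] *
    List.formPerm [3, 24, 16, 11] * List.formPerm [4, 5, 15, 18] *
    List.formPerm [6, 10, 17, 21] * List.formPerm [8, 23, 19, 12]

/-- The surface `C = T S² C₁` in the orbit of the unfolding of the cube. -/
def C : Origami 24 := C₁.S.S.T

/-- The classes `Σ_i = σ_i - σ_9`, `Z_j = ζ_j - ζ_8` and `H_k = η_k - 2 σ_9 - (4/3) ζ_8`. -/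
noncomputable def zeroHolonomyClass (k : Fin 16) : H1 C.Surface :=
  Submodule.Quotient.mk <|
    (![C.sigma 1 - C.sigma 9, C.sigma 2 - C.sigma 9, C.sigma 3 - C.sigma 9,
       C.sigma 5 - C.sigma 9, C.sigma 8 - C.sigma 9,
       C.zeta 1 - C.zeta 8, C.zeta 2 - C.zeta 8, C.zeta 3 - C.zeta 8,
       C.zeta 4 - C.zeta 8, C.zeta 5 - C.zeta 8,
       C.eta 1 - (2 : ℝ) • C.sigma 9 - (4 / 3 : ℝ) • C.zeta 8,
       C.eta 2 - (2 : ℝ) • C.sigma 9 - (4 / 3 : ℝ) • C.zeta 8,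
       C.eta 3 - (2 : ℝ) • C.sigma 9 - (4 / 3 : ℝ) • C.zeta 8,
       C.eta 4 - (2 : ℝ) • C.sigma 9 - (4 / 3 : ℝ) • C.zeta 8,
       C.eta 6 - (2 : ℝ) • C.sigma 9 - (4 / 3 : ℝ) • C.zeta 8,
       C.eta 8 - (2 : ℝ) • C.sigma 9 - (4 / 3 : ℝ) • C.zeta 8] : Fin 16 → cycles C.Surface) k

/-- The matrix `g₁`. -/
def g₁ : Matrix.SpecialLinearGroup (Fin 2) ℝ :=
  ⟨!![1, 2; 0, 1], by norm_num [Matrix.det_fin_two_of]⟩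

/-- The matrix `g₂`. -/
def g₂ : Matrix.SpecialLinearGroup (Fin 2) ℝ :=
  ⟨!![5, -2; 3, -1], by norm_num [Matrix.det_fin_two_of]⟩

/-- The matrix `g₃`. -/
def g₃ : Matrix.SpecialLinearGroup (Fin 2) ℝ :=
  ⟨!![3, -2; 5, -3], by norm_num [Matrix.det_fin_two_of]⟩

/-- The matrix `α(g_1)`, in the ordered basis `Σ₁,Σ₂,Σ₃,Σ₅,Σ₈, Z₁,…,Z₅, H₁,H₂,H₃,H₄,H₆,H₈`. -/
def alphaMatrix1 : Matrix (Fin 16) (Fin 16) ℚ :=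
  !![1, 0, 0, 0, 0, 0, -1, -7, -8, -1, -1/3, -19/3, -13/3, -19/3, -16/3, -4/3;
     0, 1, 0, 0, 0, 0, 1, 1, 2, 1, 4/3, 7/3, 4/3, 7/3, 1/3, 1/3;
     0, 0, 1, 0, 0, 0, 0, 8, 8, 0, 1/3, 22/3, 13/3, 22/3, 13/3, 1/3;
     0, 0, 0, 1, 0, 0, 1, 2, 1, 1, 1/3, 7/3, 1/3, 7/3, 4/3, 4/3;
     0, 0, 0, 0, 1, 0, -1, 0, 1, -1, -1, 1, -1, 1, 0, 0;
     0, 0, 0, 0, 0, -1, -1, -11/2, -15/2, -1, -5/3, -31/6, -11/3, -43/6, -31/6, -7/6;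
     0, 0, 0, 0, 0, 0, 0, 3/2, 7/2, 1, 0, 3/2, 2, 7/2, 1/2, 1/2;
     0, 0, 0, 0, 0, 0, 0, 2, 1, 0, 1/3, 4/3, 1/3, 4/3, 1/3, 1/3;
     0, 0, 0, 0, 0, 0, 0, 1, 2, 0, 1/3, 4/3, 1/3, 4/3, 1/3, 1/3;
     0, 0, 0, 0, 0, 0, 1, -1/2, -5/2, 0, 1/3, -1/6, -5/3, -13/6, -1/6, -1/6;
     0, 0, 0, 0, 0, 1, 1, 5/2, 5/2, 0, 2, 5/2, 1, 5/2, 5/2, 1/2;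
     0, 0, 0, 0, 0, -1, 0, -4, -6, -1, -1, -3, -3, -6, -3, -1;
     0, 0, 0, 0, 0, -1, -1, -7/2, -7/2, 0, -4/3, -23/6, -1/3, -23/6, -17/6, -5/6;
     0, 0, 0, 0, 0, 1, 0, 3, 5, 1, 2/3, 8/3, 8/3, 17/3, 8/3, 2/3;
     0, 0, 0, 0, 0, 1, 1, 3/2, 3/2, 0, 2/3, 7/6, 2/3, 7/6, 19/6, 1/6;
     0, 0, 0, 0, 0, -1, -1, -5/2, -5/2, 0, -1, -5/2, -1, -5/2, -5/2, 1/2]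

/-- The matrix `α(g_2)`, in the ordered basis `Σ₁,Σ₂,Σ₃,Σ₅,Σ₈, Z₁,…,Z₅, H₁,H₂,H₃,H₄,H₆,H₈`. -/
def alphaMatrix2 : Matrix (Fin 16) (Fin 16) ℚ :=
  !![0, -2, -1, -5, 1, 0, 8, 7, 1, 6, 13/3, 1/3, 13/3, 1/3, 4/3, 4/3;
     -1, 0, -1, 1, 0, 0, -2, -1, -1, -2, -7/3, -4/3, -7/3, -4/3, -1/3, -1/3;
     0, 1, 1, 6, -1, 0, -8, -8, 0, -6, -16/3, -1/3, -16/3, -1/3, -1/3, -1/3;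
     0, 0, 0, 1, 0, 0, -1, -2, -1, -1, -7/3, -1/3, -7/3, -1/3, -4/3, -4/3;
     1, 1, 1, 2, 1, 0, -1, 0, 1, -1, 1, 3, 1, 3, 2, 2;
     0, -2, 0, -9/2, 1, 1, 15/2, 11/2, 1, 11/2, 25/6, 2/3, 25/6, 2/3, 7/6, 7/6;
     -1, 1, -1, 3/2, 0, 0, -7/2, -3/2, 0, -5/2, -5/2, -1, -5/2, -1, -1/2, -1/2;
     0, -1, 0, 1, -1, 0, -1, -2, 0, -1, -7/3, -4/3, -7/3, -4/3, -4/3, -4/3;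
     0, 1, 0, 2, 0, 0, -2, -1, 0, -2, -1/3, 2/3, -1/3, 2/3, 2/3, 2/3;
     0, -1, 0, -3/2, 0, 0, 5/2, 1/2, -1, 3/2, 1/6, -1/3, 1/6, -1/3, -5/6, -5/6;
     1, 0, 0, 5/2, -1, -1, -5/2, -5/2, -1, -5/2, -3/2, -1, -3/2, 0, -1/2, -1/2;
     0, -1, 1, -3, 1, 1, 6, 4, 0, 4, 4, 2, 5, 2, 2, 2;
     -1, 0, 0, -7/2, 1, 1, 7/2, 7/2, 1, 7/2, 17/6, 1/3, 17/6, -2/3, 5/6, 5/6;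
     0, 1, -1, 2, -1, -1, -5, -3, 0, -3, -11/3, -5/3, -14/3, -5/3, -5/3, -5/3;
     1, 1, 1, 1/2, 0, -1, -3/2, -3/2, -1, -1/2, 5/6, 4/3, 5/6, 4/3, 5/6, -1/6;
     -1, -1, -1, -3/2, 0, 1, 5/2, 5/2, 1, 3/2, 1/2, -1, 1/2, -1, -3/2, -1/2]

/-- The matrix `α(g_3)`, in the ordered basis `Σ₁,Σ₂,Σ₃,Σ₅,Σ₈, Z₁,…,Z₅, H₁,H₂,H₃,H₄,H₆,H₈`. -/
def alphaMatrix3 : Matrix (Fin 16) (Fin 16) ℚ :=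
  !![-1, 5, -1, 1, 1, 0, -4, 1, -7, -6, 0, 1, 0, 1, -3, -3;
     0, -1, 0, 1, 0, 0, 0, -1, 1, 0, -1, 0, -1, 0, 1, 1;
     1, -6, 1, -1, 0, 0, 6, 0, 8, 8, 1/3, 1/3, 1/3, 1/3, 16/3, 16/3;
     -1, -2, -1, -1, -1, 0, 1, -1, 0, 1, -2, -3, -2, -3, -1, -1;
     0, -1, 0, 0, 0, 0, 1, 1, 2, 1, 4/3, 1/3, 4/3, 1/3, 7/3, 7/3;
     -1, 9/2, -1/2, 0, 1, 0, -7/2, 0, -13/2, -9/2, 1/6, 2/3, 1/6, 2/3, -17/6, -17/6;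
     0, -3/2, 1/2, 1, 0, 1, 3/2, 0, 7/2, 3/2, 1/2, 1, 1/2, 1, 5/2, 5/2;
     0, -2, 0, -1, 0, 0, 2, 0, 1, 2, -2/3, -2/3, -2/3, -2/3, 1/3, 1/3;
     1, -1, 1, 1, 0, 0, 1, 0, 2, 1, 4/3, 4/3, 4/3, 4/3, 7/3, 7/3;
     -1, 1/2, -3/2, -1, -1, -1, -3/2, -1, -7/2, -3/2, -5/2, -3, -5/2, -3, -7/2, -7/2;
     0, -5/2, -1/2, -1, -1, 0, 3/2, 0, 5/2, 5/2, -1/2, -2, -1/2, -1, 1/2, 1/2;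
     0, 4, 0, 0, 0, 0, -3, 0, -5, -4, 1/3, 1/3, 1/3, 1/3, -8/3, -11/3;
     -1, 5/2, -1/2, 0, 0, 0, -5/2, 0, -7/2, -7/2, -1/2, 0, -1/2, -1, -5/2, -5/2;
     1, -2, 1, 0, 0, 0, 2, 0, 4, 3, 2/3, 2/3, 2/3, 2/3, 5/3, 8/3;
     0, -1/2, -1/2, 0, 0, 0, 1/2, 0, 1/2, 1/2, 1/6, -1/3, -5/6, -1/3, 1/6, 1/6;
     0, 3/2, 1/2, 1, 1, 0, -3/2, 0, -3/2, -3/2, -1/6, 4/3, 5/6, 4/3, -1/6, -1/6]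

end CubeCover

namespace SingularHomology

variable {X Y : Type} [TopologicalSpace X] [TopologicalSpace Y]

/-- Singular 1-chains modulo boundaries. -/
abbrev ChainClass (X : Type) [TopologicalSpace X] : Type :=
  Chain 1 X ⧸ LinearMap.range (boundary 1 X)

/-- The class of a singular 1-chain modulo boundaries. -/
noncomputable def chainClass (X : Type) [TopologicalSpace X] : Chain 1 X →ₗ[ℝ] ChainClass X :=
  (LinearMap.range (boundary 1 X)).mkQ

/-- The inclusion of the homology into the chains modulo boundaries. -/
noncomputable def H1incl (X : Type) [TopologicalSpace X] : H1 X →ₗ[ℝ] ChainClass X :=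
  (boundaries X).mapQ (LinearMap.range (boundary 1 X)) (cycles X).subtype le_rfl

theorem H1incl_mk (c : cycles X) :
    H1incl X (Submodule.Quotient.mk c) = chainClass X (c : Chain 1 X) := rfl

theorem H1incl_injective : Function.Injective (H1incl X) := by
  rw [← LinearMap.ker_eq_bot, LinearMap.ker_eq_bot']
  intro x hx
  obtain ⟨c, rfl⟩ := Submodule.Quotient.mk_surjective _ x
  rw [H1incl_mk] at hx
  rw [Submodule.Quotient.mk_eq_zero]
  exact (Submodule.Quotient.mk_eq_zero (LinearMap.range (boundary 1 X))).1 hx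

/-- The map induced on chains modulo boundaries. -/
noncomputable def classMap (f : C(X, Y)) : ChainClass X →ₗ[ℝ] ChainClass Y :=
  (LinearMap.range (boundary 1 X)).mapQ (LinearMap.range (boundary 1 Y)) (chainMap 1 f) (by
    rintro _ ⟨b, rfl⟩
    exact ⟨chainMap 2 f b, boundary_chainMap 1 f b⟩)

theorem classMap_chainClass (f : C(X, Y)) (c : Chain 1 X) :
    classMap f (chainClass X c) = chainClass Y (chainMap 1 f c) := rfl

theorem H1incl_H1map (f : C(X, Y)) (c : H1 X) :
    H1incl Y (H1map f c) = classMap f (H1incl X c) := by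
  obtain ⟨c, rfl⟩ := Submodule.Quotient.mk_surjective _ c
  rfl

theorem chainMap_simplexChain {n : ℕ} (f : C(X, Y)) (s : Simplex n X) :
    chainMap n f (simplexChain s) = simplexChain (f.comp s) :=
  pushforward_simplexChain _ _

theorem chain_induction {n : ℕ} {p : Chain n X → Prop} (h0 : p 0)
    (hadd : ∀ a b, p a → p b → p (a + b)) (hs : ∀ (r : ℝ) s, p (r • simplexChain s)) (c) : p c := by
  refine Finsupp.induction_linear (motive := p) c h0 (fun a b => hadd a b) fun s r => ?_
  have := hs r s
  rw [simplexChain] at this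
  have h2 : r • (Finsupp.single s (1 : ℝ) : Simplex n X →₀ ℝ) = Finsupp.single s r := by simp
  rw [← h2]
  exact this

theorem chain_linearMap_ext {n : ℕ} {M : Type*} [AddCommGroup M] [Module ℝ M]
    {f g : Chain n X →ₗ[ℝ] M} (h : ∀ s, f (simplexChain s) = g (simplexChain s)) : f = g :=
  LinearMap.ext fun c => by
    induction c using chain_induction with
    | h0 => simp
    | hadd a b ha hb => simp [ha, hb]
    | hs r s => simp [h]

/-- The linear extension to chains of a function on simplices. -/
noncomputable def chainLift {n : ℕ} {M : Type*} [AddCommGroup M] [Module ℝ M]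
    (f : Simplex n X → M) : Chain n X →ₗ[ℝ] M :=
  Finsupp.linearCombination ℝ f

theorem chainLift_simplexChain {n : ℕ} {M : Type*} [AddCommGroup M] [Module ℝ M]
    (f : Simplex n X → M) (s : Simplex n X) : chainLift f (simplexChain s) = f s := by
  have : Finsupp.linearCombination ℝ f (Finsupp.single s 1) = f s := by simp
  exact this

/-! ### Paths -/

/-- The parameter of a point of the standard 1-simplex. -/
noncomputable def param : C(stdSimplex ℝ (Fin 2), I) where
  toFun t := ⟨t 1, t.2.1 1, stdSimplex.le_one t 1⟩
  continuous_toFun := ((continuous_apply 1).comp continuous_subtype_val).subtype_mk _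

/-- The point of the standard 1-simplex with a given parameter. -/
noncomputable def unparam : C(I, stdSimplex ℝ (Fin 2)) where
  toFun t := ⟨![1 - t, t], by
    constructor
    · intro k
      fin_cases k
      · simpa using t.2.2
      · simpa using t.2.1
    · simp⟩
  continuous_toFun := by
    refine Continuous.subtype_mk (continuous_pi fun k => ?_) _
    fin_cases k
    · simp; fun_prop
    · simp; fun_prop

theorem unparam_param (t : stdSimplex ℝ (Fin 2)) : unparam (param t) = t := by
  ext k
  have h := stdSimplex.add_eq_one t
  fin_cases k
  · change 1 - t 1 = t 0
    linarith
  · rfl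

theorem param_vertex_zero : param (stdSimplex.vertex 0) = 0 := by
  ext; simp [param]

theorem param_vertex_one : param (stdSimplex.vertex 1) = 1 := by
  ext; simp [param]

/-- A path as a singular 1-simplex. -/
noncomputable def pathSimplex (γ : C(I, X)) : Simplex 1 X := γ.comp param

theorem exists_pathSimplex_eq (s : Simplex 1 X) : ∃ γ, pathSimplex γ = s :=
  ⟨s.comp unparam, by ext t; simp [pathSimplex, unparam_param]⟩

/-- The class of a path modulo boundaries. -/
noncomputable def pathClass (γ : C(I, X)) : ChainClass X :=
  chainClass X (simplexChain (pathSimplex γ))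

theorem classMap_pathClass (f : C(X, Y)) (γ : C(I, X)) :
    classMap f (pathClass γ) = pathClass (f.comp γ) := by
  rw [pathClass, classMap_chainClass, chainMap_simplexChain]
  rfl

/-- A point as a singular 0-chain. -/
noncomputable def point (x : X) : Chain 0 X := simplexChain (ContinuousMap.const _ x)

theorem faceMap_zero_apply (k : Fin 2) (t) : faceMap 0 k t = stdSimplex.vertex (k.succAbove 0) := by
  have ht : t = stdSimplex.vertex 0 := Subsingleton.elim _ _
  rw [ht]
  exact stdSimplex.map_vertex _ _

theorem boundary_pathSimplex (γ : C(I, X)) :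
    boundary 0 X (simplexChain (pathSimplex γ)) = point (γ 1) - point (γ 0) := by
  have h0 : (pathSimplex γ).comp (faceMap 0 0) = ContinuousMap.const _ (γ 1) := by
    ext t
    simp [pathSimplex, faceMap_zero_apply, param_vertex_one]
  have h1 : (pathSimplex γ).comp (faceMap 0 1) = ContinuousMap.const _ (γ 0) := by
    ext t
    simp [pathSimplex, faceMap_zero_apply, param_vertex_zero]
  simp [boundary, Fin.sum_univ_two, pushforward_simplexChain, h0, h1, point, sub_eq_add_neg]

/-! ### Triangles and squares -/

theorem boundary_one_simplexChain (s : Simplex 2 X) :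
    boundary 1 X (simplexChain s) = simplexChain (s.comp (faceMap 1 0))
      - simplexChain (s.comp (faceMap 1 1)) + simplexChain (s.comp (faceMap 1 2)) := by
  simp [boundary, Fin.sum_univ_three, pushforward_simplexChain, sub_eq_add_neg]

theorem faceMap_one_apply (k : Fin 3) (t : stdSimplex ℝ (Fin 2)) (j : Fin 3) :
    faceMap 1 k t j = if k = j then 0 else if (j : ℕ) < k then t 0 * (if j = 0 then 1 else 0) +
      t 1 * (if j = 1 then 1 else 0) else t 0 * (if j = 1 then 1 else 0) +
      t 1 * (if j = 2 then 1 else 0) := by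
  change (stdSimplex.map k.succAbove t : Fin 3 → ℝ) j = _
  rw [stdSimplex.map_coe, FunOnFinite.linearMap_apply_apply]
  fin_cases k <;> fin_cases j <;>
    simp [Finset.sum_filter, Fin.sum_univ_two, Fin.succAbove, Fin.lt_def] 

theorem pathClass_triangle (s : Simplex 2 X) (a b c : C(I, X))
    (ha : ∀ t, s (faceMap 1 0 t) = a (param t)) (hb : ∀ t, s (faceMap 1 1 t) = b (param t))
    (hc : ∀ t, s (faceMap 1 2 t) = c (param t)) :
    pathClass c + pathClass a = pathClass b := by
  have h := boundary_one_simplexChain s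
  have h0 : s.comp (faceMap 1 0) = pathSimplex a := ContinuousMap.ext ha
  have h1 : s.comp (faceMap 1 1) = pathSimplex b := ContinuousMap.ext hb
  have h2 : s.comp (faceMap 1 2) = pathSimplex c := ContinuousMap.ext hc
  rw [h0, h1, h2] at h
  have hz : chainClass X (boundary 1 X (simplexChain s)) = 0 :=
    (Submodule.Quotient.mk_eq_zero _).2 ⟨_, rfl⟩
  rw [h, map_add, map_sub] at hz
  have : pathClass a - pathClass b + pathClass c = 0 := hz
  rw [← sub_eq_zero, ← this]
  abel

/-- The triangle in the unit square with vertices `(0, 0)`, `(1, 0)`, `(1, 1)`. -/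
noncomputable def lowerTriangle : C(stdSimplex ℝ (Fin 3), I × I) where
  toFun t := (⟨t 1 + t 2, add_nonneg (t.2.1 1) (t.2.1 2), by
      have h := stdSimplex.sum_eq_one t
      have h0 := stdSimplex.zero_le t 0
      rw [Fin.sum_univ_three] at h
      linarith⟩, ⟨t 2, t.2.1 2, stdSimplex.le_one t 2⟩)
  continuous_toFun := by
    have h (k : Fin 3) : Continuous fun t : stdSimplex ℝ (Fin 3) => t k :=
      (continuous_apply k).comp continuous_subtype_val
    exact .prodMk (.subtype_mk ((h 1).add (h 2)) _) (.subtype_mk (h 2) _)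

theorem pathClass_lowerTriangle (F : C(I × I, X)) :
    pathClass (F.comp ⟨fun t => (t, 0), by fun_prop⟩) +
        pathClass (F.comp ⟨fun t => (1, t), by fun_prop⟩) =
      pathClass (F.comp ⟨fun t => (t, t), by fun_prop⟩) := by
  refine pathClass_triangle (F.comp lowerTriangle) _ _ _ ?_ ?_ ?_ <;> intro t <;>
    refine congrArg F (Prod.ext (Subtype.ext ?_) (Subtype.ext ?_)) <;>
    simp [lowerTriangle, faceMap_one_apply, param]
  exact stdSimplex.add_eq_one t

theorem pathClass_square (F : C(I × I, X)) {a b c d : C(I, X)} (ha : ∀ t, F (t, 0) = a t)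
    (hb : ∀ t, F (1, t) = b t) (hc : ∀ t, F (0, t) = c t) (hd : ∀ t, F (t, 1) = d t) :
    pathClass a + pathClass b = pathClass c + pathClass d := by
  obtain rfl : F.comp ⟨fun t => (t, 0), by fun_prop⟩ = a := ContinuousMap.ext ha
  obtain rfl : F.comp ⟨fun t => (1, t), by fun_prop⟩ = b := ContinuousMap.ext hb
  obtain rfl : F.comp ⟨fun t => (0, t), by fun_prop⟩ = c := ContinuousMap.ext hc
  obtain rfl : F.comp ⟨fun t => (t, 1), by fun_prop⟩ = d := ContinuousMap.ext hd
  rw [pathClass_lowerTriangle]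
  exact (pathClass_lowerTriangle (F.comp ⟨Prod.swap, by fun_prop⟩)).symm

theorem pathClass_const (x : X) : pathClass (ContinuousMap.const I x) = 0 := by
  have h := pathClass_lowerTriangle (ContinuousMap.const (I × I) x)
  exact add_eq_left.1 h

/-! ### Increments of circle-valued functions -/

theorem increment_eq_of_lift {θ : stdSimplex ℝ (Fin 2) → UnitAddCircle}
    (l : C(stdSimplex ℝ (Fin 2), ℝ)) (hl : ∀ t, ((l t : ℝ) : UnitAddCircle) = θ t) :
    Origami.increment θ = l (stdSimplex.vertex 1) - l (stdSimplex.vertex 0) := by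
  have H : ∃ l : C(stdSimplex ℝ (Fin 2), ℝ), ∀ t, ((l t : ℝ) : UnitAddCircle) = θ t := ⟨l, hl⟩
  rw [Origami.increment, dif_pos H]
  have hm := H.choose_spec
  set m := H.choose
  have key : (fun t => m t + (l (stdSimplex.vertex 0) - m (stdSimplex.vertex 0))) = l := by
    refine (AddCircle.isCoveringMap_coe (1 : ℝ)).eq_of_comp_eq (by fun_prop) (by fun_prop) ?_
      (stdSimplex.vertex 0) (by simp)
    funext t
    have e : ((l (stdSimplex.vertex 0) - m (stdSimplex.vertex 0) : ℝ) : UnitAddCircle) = 0 := by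
      rw [AddCircle.coe_sub, hl, hm, sub_self]
    change ((m t + _ : ℝ) : UnitAddCircle) = ((l t : ℝ) : UnitAddCircle)
    rw [AddCircle.coe_add, e, add_zero, hl, hm]
  have h1 := congrFun key (stdSimplex.vertex 1)
  linarith

/-- The increment of a circle-valued function along a chain. -/
noncomputable def incChain (θ : C(X, UnitAddCircle)) : Chain 1 X →ₗ[ℝ] ℝ :=
  chainLift fun s => Origami.increment fun t => θ (s t)

theorem incChain_pathSimplex (θ : C(X, UnitAddCircle)) (γ : C(I, X)) (l : C(I, ℝ))
    (hl : ∀ t, ((l t : ℝ) : UnitAddCircle) = θ (γ t)) :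
    incChain θ (simplexChain (pathSimplex γ)) = l 1 - l 0 := by
  rw [incChain, chainLift_simplexChain, increment_eq_of_lift (l.comp param)]
  · simp [param_vertex_one, param_vertex_zero]
  · intro t
    exact hl _

theorem exists_lift_path (θ : C(I, UnitAddCircle)) :
    ∃ l : C(I, ℝ), ∀ t, ((l t : ℝ) : UnitAddCircle) = θ t := by
  obtain ⟨x, hx⟩ := QuotientAddGroup.mk_surjective (θ 0)
  obtain ⟨l, hl, -⟩ := (AddCircle.isCoveringMap_coe (1 : ℝ)).exists_path_lifts θ x hx.symm
  exact ⟨l, fun t => congrFun hl t⟩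

theorem exists_lift_square (θ : C(I × I, UnitAddCircle)) :
    ∃ l : C(I × I, ℝ), ∀ z, ((l z : ℝ) : UnitAddCircle) = θ z := by
  obtain ⟨m, hm⟩ := exists_lift_path (θ.comp ⟨fun t => (0, t), by fun_prop⟩)
  refine ⟨(AddCircle.isCoveringMap_coe (1 : ℝ)).liftHomotopy θ m fun a => (hm a).symm, fun z => ?_⟩
  exact congrFun ((AddCircle.isCoveringMap_coe (1 : ℝ)).liftHomotopy_lifts θ m _) z

/-- The unit square, with its left side collapsed, as the standard 2-simplex. -/
noncomputable def collapse : C(I × I, stdSimplex ℝ (Fin 3)) where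
  toFun z := ⟨![1 - z.1, z.1 * (1 - z.2), z.1 * z.2], by
    constructor
    · intro k
      fin_cases k
      · simpa using z.1.2.2
      · simpa using mul_nonneg z.1.2.1 (sub_nonneg.2 z.2.2.2)
      · simpa using mul_nonneg z.1.2.1 z.2.2.1
    · simp [Fin.sum_univ_three]
      ring⟩
  continuous_toFun := by
    refine Continuous.subtype_mk (continuous_pi fun k => ?_) _
    fin_cases k
    · simp; fun_prop
    · simp; fun_prop
    · simp; fun_prop

theorem incChain_boundary (θ : C(X, UnitAddCircle)) (c : Chain 2 X) :
    incChain θ (boundary 1 X c) = 0 := by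
  suffices incChain θ ∘ₗ boundary 1 X = 0 from LinearMap.congr_fun this c
  refine chain_linearMap_ext fun s => ?_
  obtain ⟨l, hl⟩ := exists_lift_square ((θ.comp s).comp collapse)
  have side (k : Fin 3) (j : C(I, I × I))
      (hj : ∀ t, collapse (j t) = faceMap 1 k (unparam t)) :
      incChain θ (simplexChain (s.comp (faceMap 1 k))) = l (j 1) - l (j 0) := by
    have : s.comp (faceMap 1 k) = pathSimplex ((s.comp collapse).comp j) := by
      ext t
      simp [pathSimplex, hj, unparam_param]
    rw [this]
    exact incChain_pathSimplex θ _ (l.comp j) fun t => hl _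
  have hc : l (0, 1) = l (0, 0) := by
    have h1 := incChain_pathSimplex θ (ContinuousMap.const I (s (collapse (0, 0))))
      (l.comp ⟨fun t => (0, t), by fun_prop⟩) (fun t => by
        have e : collapse (0, t) = collapse (0, 0) := by
          ext k; fin_cases k <;> simp [collapse]
        simp [hl, e])
    have h2 := incChain_pathSimplex θ (ContinuousMap.const I (s (collapse (0, 0))))
      (ContinuousMap.const I (l (0, 0))) (fun t => by simp [hl])
    rw [h1] at h2
    simpa [sub_eq_zero] using h2
  have e0 := side 0 ⟨fun t => (1, t), by fun_prop⟩ (fun t => by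
    ext k
    change _ = faceMap 1 0 (unparam t) k
    rw [faceMap_one_apply]
    fin_cases k <;> simp [collapse, unparam, DFunLike.coe])
  have e1 := side 1 ⟨fun t => (t, 1), by fun_prop⟩ (fun t => by
    ext k
    change _ = faceMap 1 1 (unparam t) k
    rw [faceMap_one_apply]
    fin_cases k <;> simp [collapse, unparam, DFunLike.coe])
  have e2 := side 2 ⟨fun t => (t, 0), by fun_prop⟩ (fun t => by
    ext k
    change _ = faceMap 1 2 (unparam t) k
    rw [faceMap_one_apply]
    fin_cases k <;> simp [collapse, unparam, DFunLike.coe])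
  simp only [LinearMap.comp_apply, boundary_one_simplexChain, map_add, map_sub, e0, e1, e2,
    LinearMap.zero_apply]
  simp [hc]

/-- The increment of a circle-valued function, on chains modulo boundaries. -/
noncomputable def incClass (θ : C(X, UnitAddCircle)) : ChainClass X →ₗ[ℝ] ℝ :=
  (LinearMap.range (boundary 1 X)).liftQ (incChain θ) (by
    rintro _ ⟨b, rfl⟩
    exact incChain_boundary θ b)

theorem incClass_chainClass (θ : C(X, UnitAddCircle)) (c : Chain 1 X) :
    incClass θ (chainClass X c) = incChain θ c := rfl

theorem incClass_pathClass (θ : C(X, UnitAddCircle)) (γ : C(I, X)) (l : C(I, ℝ))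
    (hl : ∀ t, ((l t : ℝ) : UnitAddCircle) = θ (γ t)) : incClass θ (pathClass γ) = l 1 - l 0 :=
  incChain_pathSimplex θ γ l hl

end SingularHomology

/-! ### Convex combinations in the unit square -/

/-- The convex combination `(1 - s) x + s y` in the unit interval. -/
noncomputable def unitInterval.comb (s x y : I) : I :=
  ⟨(1 - s) * x + s * y, convex_Icc (0 : ℝ) 1 x.2 y.2 (sub_nonneg.2 s.2.2) s.2.1 (by ring)⟩

namespace unitInterval

theorem coe_comb (s x y : I) : (comb s x y : ℝ) = (1 - s) * x + s * y := rfl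

theorem continuous_comb : Continuous fun p : I × I × I => comb p.1 p.2.1 p.2.2 := by
  refine Continuous.subtype_mk ?_ _
  fun_prop

@[fun_prop]
theorem _root_.Continuous.comb {X : Type*} [TopologicalSpace X] {f g k : X → I} (hf : Continuous f)
    (hg : Continuous g) (hk : Continuous k) : Continuous fun a => comb (f a) (g a) (k a) :=
  continuous_comb.comp (hf.prodMk (hg.prodMk hk))

@[simp] theorem comb_zero (x y : I) : comb 0 x y = x := by ext; simp [coe_comb]
@[simp] theorem comb_one (x y : I) : comb 1 x y = y := by ext; simp [coe_comb]
@[simp] theorem comb_self (s x : I) : comb s x x = x := by ext; simp [coe_comb]; ring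
@[simp] theorem comb_zero_one (s : I) : comb s 0 1 = s := by ext; simp [coe_comb]

/-- The straight path in the unit square. -/
noncomputable def line (z w : I × I) : C(I, I × I) where
  toFun t := (comb t z.1 w.1, comb t z.2 w.2)
  continuous_toFun := by fun_prop

@[simp] theorem line_apply (z w : I × I) (t : I) :
    line z w t = (comb t z.1 w.1, comb t z.2 w.2) := rfl

end unitInterval

namespace SingularHomology

variable {X : Type} [TopologicalSpace X]

theorem pathClass_cone (F : C(I × I, X)) (c : I × I) (γ : C(I, I × I)) :
    pathClass (F.comp (line c (γ 0))) + pathClass (F.comp γ) =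
      pathClass (F.comp (line c (γ 1))) := by
  have h := pathClass_square (c := ContinuousMap.const I (F c))
    (F.comp ⟨fun p : I × I => (comb p.1 c.1 (γ p.2).1, comb p.1 c.2 (γ p.2).2), by fun_prop⟩)
    (a := F.comp (line c (γ 0))) (b := F.comp γ) (d := F.comp (line c (γ 1)))
    (fun t => rfl) (fun t => by simp) (fun t => by simp) (fun t => rfl)
  rwa [pathClass_const, zero_add] at h

/-- The part of a path between two parameters. -/
noncomputable def subpath (γ : C(I, X)) (a b : I) : C(I, X) where
  toFun t := γ (comb t a b)
  continuous_toFun := by fun_prop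

@[simp] theorem subpath_apply (γ : C(I, X)) (a b t : I) : subpath γ a b t = γ (comb t a b) := rfl

theorem pathClass_subpath_add (γ : C(I, X)) (a b c : I) :
    pathClass (subpath γ a b) + pathClass (subpath γ b c) = pathClass (subpath γ a c) := by
  have h := pathClass_square (c := ContinuousMap.const I (γ a))
    (γ.comp ⟨fun p : I × I => comb p.1 a (comb p.2 b c), by fun_prop⟩)
    (a := subpath γ a b) (b := subpath γ b c) (d := subpath γ a c)
    (fun t => by simp) (fun t => by simp) (fun t => by simp) (fun t => by simp)
  rwa [pathClass_const, zero_add] at h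

theorem subpath_zero_one (γ : C(I, X)) : subpath γ 0 1 = γ := by
  ext; simp

/-- A relation between paths and their end points that holds for all paths contained in a member
of an open cover, and is additive, holds for all paths. -/
theorem pathClass_eq_of_cover {M : Type*} [AddCommGroup M] [Module ℝ M]
    (L : ChainClass X →ₗ[ℝ] M) (r : X → M) {ι : Type*} (U : ι → Set X) (hU : ∀ k, IsOpen (U k))
    (hcov : ∀ x, ∃ k, x ∈ U k)
    (hloc : ∀ (γ : C(I, X)) k, (∀ t, γ t ∈ U k) → L (pathClass γ) = r (γ 1) - r (γ 0))
    (γ : C(I, X)) : L (pathClass γ) = r (γ 1) - r (γ 0) := by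
  obtain ⟨t, ht0, hmono, ⟨m, hm⟩, hsub⟩ := exists_monotone_Icc_subset_open_cover_unitInterval
    (c := fun k => γ ⁻¹' U k) (fun k => (hU k).preimage γ.continuous)
    (fun s _ => Set.mem_iUnion.2 (hcov (γ s)))
  have key : ∀ k, L (pathClass (subpath γ 0 (t k))) = r (γ (t k)) - r (γ 0) := by
    intro k
    induction k with
    | zero =>
      have : subpath γ 0 (t 0) = ContinuousMap.const I (γ 0) := by ext; simp [ht0]
      rw [this, pathClass_const, map_zero, ht0, sub_self]
    | succ k ih =>
      obtain ⟨j, hj⟩ := hsub k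
      have h := hloc (subpath γ (t k) (t (k + 1))) j (fun s => hj ⟨?_, ?_⟩)
      · rw [← pathClass_subpath_add γ 0 (t k), map_add, ih, h]
        simp
      · have := hmono k.le_succ
        rw [← Subtype.coe_le_coe] at this ⊢
        rw [coe_comb]
        nlinarith [s.2.1, s.2.2]
      · have := hmono k.le_succ
        rw [← Subtype.coe_le_coe] at this ⊢
        rw [coe_comb]
        nlinarith [s.2.1, s.2.2]
  have := key m
  rwa [hm m le_rfl, subpath_zero_one] at this

/-- The difference of the values of a function at the end points, on chains modulo boundaries. -/
noncomputable def endClass {M : Type*} [AddCommGroup M] [Module ℝ M] (u : X → M) :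
    ChainClass X →ₗ[ℝ] M :=
  (LinearMap.range (boundary 1 X)).liftQ
    ((chainLift fun s : Simplex 0 X => u (s default)) ∘ₗ boundary 0 X) (by
    rw [LinearMap.range_le_ker_iff]
    refine chain_linearMap_ext fun s => ?_
    have e (k : Fin 3) : boundary 0 X (simplexChain (s.comp (faceMap 1 k))) =
        point (s (stdSimplex.vertex (k.succAbove 1))) -
          point (s (stdSimplex.vertex (k.succAbove 0))) := by
      obtain ⟨γ, hγ⟩ := exists_pathSimplex_eq (s.comp (faceMap 1 k))
      rw [← hγ, boundary_pathSimplex]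
      have hv (j : Fin 2) : s (stdSimplex.vertex (k.succAbove j)) =
          γ (param (stdSimplex.vertex j)) := by
        have := DFunLike.congr_fun hγ (stdSimplex.vertex j)
        rw [show γ (param (stdSimplex.vertex j)) = pathSimplex γ (stdSimplex.vertex j) from rfl, hγ]
        exact congrArg s (stdSimplex.map_vertex _ _).symm
      rw [hv, hv, param_vertex_zero, param_vertex_one]
    simp only [LinearMap.comp_apply, boundary_one_simplexChain, map_add, map_sub, e, point,
      chainLift_simplexChain, LinearMap.zero_apply, ContinuousMap.const_apply]
    simp [Fin.succAbove, Fin.lt_def])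

theorem endClass_pathClass {M : Type*} [AddCommGroup M] [Module ℝ M] (u : X → M) (γ : C(I, X)) :
    endClass u (pathClass γ) = u (γ 1) - u (γ 0) := by
  change chainLift _ (boundary 0 X (simplexChain (pathSimplex γ))) = _
  rw [boundary_pathSimplex, map_sub, point, point, chainLift_simplexChain, chainLift_simplexChain]
  rfl

theorem endClass_H1incl {M : Type*} [AddCommGroup M] [Module ℝ M] (u : X → M) (c : H1 X) :
    endClass u (H1incl X c) = 0 := by
  obtain ⟨⟨c, hc⟩, rfl⟩ := Submodule.Quotient.mk_surjective _ c
  change chainLift _ (boundary 0 X c) = 0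
  rw [LinearMap.mem_ker.1 hc, map_zero]

theorem linearMap_eq_endClass {M : Type*} [AddCommGroup M] [Module ℝ M]
    {L : ChainClass X →ₗ[ℝ] M} {u : X → M}
    (h : ∀ γ : C(I, X), L (pathClass γ) = u (γ 1) - u (γ 0)) : L = endClass u := by
  refine Submodule.linearMap_qext _ (chain_linearMap_ext fun s => ?_)
  obtain ⟨γ, rfl⟩ := exists_pathSimplex_eq s
  exact (h γ).trans (endClass_pathClass u γ).symm

end SingularHomology

namespace Origami

variable {n : ℕ} (O : Origami n)

/-! ### The topology of the surface -/

theorem exists_pt_eq (q : O.Surface) : ∃ i z, O.pt i z = q := by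
  obtain ⟨⟨i, z⟩, rfl⟩ := Quot.exists_rep q
  exact ⟨i, z, rfl⟩

theorem pt_side (i : Fin n) (y : I) : O.pt i (1, y) = O.pt (O.h i) (0, y) :=
  Quot.sound (Glue.side i y)

theorem pt_top (i : Fin n) (x : I) : O.pt i (x, 1) = O.pt (O.v i) (x, 0) :=
  Quot.sound (Glue.top i x)

/-- Functions on the surface, given on the squares. -/
def lift {A : Sort*} (g : Fin n → I × I → A) (hs : ∀ i y, g i (1, y) = g (O.h i) (0, y))
    (ht : ∀ i x, g i (x, 1) = g (O.v i) (x, 0)) : O.Surface → A :=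
  Quot.lift (fun q => g q.1 q.2) (by
    rintro _ _ (⟨i, y⟩ | ⟨i, x⟩)
    · exact hs i y
    · exact ht i x)

@[simp] theorem lift_pt {A : Sort*} (g : Fin n → I × I → A) (hs ht) (i : Fin n) (z : I × I) :
    O.lift g hs ht (O.pt i z) = g i z := rfl

theorem continuous_of_pt {A : Type*} [TopologicalSpace A] {f : O.Surface → A}
    (h : ∀ i, Continuous fun z => f (O.pt i z)) : Continuous f := by
  refine isQuotientMap_quot_mk.continuous_iff.2 ?_
  exact continuous_prod_of_discrete_left.2 h

theorem isOpen_of_pt {U : Set O.Surface} (h : ∀ i, IsOpen (O.pt i ⁻¹' U)) : IsOpen U :=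
  continuous_Prop.1 (O.continuous_of_pt (f := fun q => q ∈ U) fun i => continuous_Prop.2 (h i))

/-- A square of the surface. -/
noncomputable def ptC (i : Fin n) : C(I × I, O.Surface) := ⟨O.pt i, O.continuous_pt i⟩

@[simp] theorem ptC_apply (i : Fin n) (z : I × I) : O.ptC i z = O.pt i z := rfl

@[simp] theorem toTorus_pt (i : Fin n) (z : I × I) :
    O.toTorus (O.pt i z) = (((z.1 : ℝ) : UnitAddCircle), ((z.2 : ℝ) : UnitAddCircle)) := rfl

theorem continuous_toTorus : Continuous O.toTorus := by
  refine O.continuous_of_pt fun i => ?_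
  simp only [toTorus_pt]
  exact ((AddCircle.continuous_mk' 1).comp (by fun_prop)).prodMk
    ((AddCircle.continuous_mk' 1).comp (by fun_prop))

/-! ### Edges -/

/-- The class of the straight path from `z` to `w` in the square `i`. -/
noncomputable def lineClass (i : Fin n) (z w : I × I) : ChainClass O.Surface :=
  pathClass ((O.ptC i).comp (line z w))

theorem chainClass_segmentChain (i : Fin n) (z w : I × I) :
    chainClass O.Surface (O.segmentChain i z w) = O.lineClass i z w := by
  rw [lineClass, pathClass, segmentChain]
  congr 2
  ext t
  have h := stdSimplex.add_eq_one t
  have h0 : t 0 = 1 - t 1 := by linarith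
  change O.pt i _ = O.pt i _
  congr 1
  refine Prod.ext (Subtype.ext ?_) (Subtype.ext ?_) <;> simp [coe_comb, param, h0]

theorem lineClass_cone (i : Fin n) (c : I × I) (γ : C(I, I × I)) :
    O.lineClass i c (γ 0) + pathClass ((O.ptC i).comp γ) = O.lineClass i c (γ 1) :=
  pathClass_cone _ _ _

theorem lineClass_add (i : Fin n) (c z w : I × I) :
    O.lineClass i c z + O.lineClass i z w = O.lineClass i c w := by
  simpa [lineClass] using O.lineClass_cone i c (line z w)

theorem lineClass_side (i : Fin n) (y y' : I) :
    O.lineClass i (1, y) (1, y') = O.lineClass (O.h i) (0, y) (0, y') := by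
  refine congrArg pathClass (ContinuousMap.ext fun t => ?_)
  simp [pt_side]

theorem lineClass_top (i : Fin n) (x x' : I) :
    O.lineClass i (x, 1) (x', 1) = O.lineClass (O.v i) (x, 0) (x', 0) := by
  refine congrArg pathClass (ContinuousMap.ext fun t => ?_)
  simp [pt_top]

/-- Cellular 1-chains: the coefficients of the bottom sides and of the left sides. -/
abbrev Edges (n : ℕ) (R : Type := ℝ) : Type := (Fin n → R) × (Fin n → R)

/-- The class of the bottom side of a square. -/
noncomputable def bottom (i : Fin n) : ChainClass O.Surface := O.lineClass i (0, 0) (1, 0)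

/-- The class of the left side of a square. -/
noncomputable def left (i : Fin n) : ChainClass O.Surface := O.lineClass i (0, 0) (0, 1)

/-- The class of a cellular chain. -/
noncomputable def edgeClass : Edges n →ₗ[ℝ] ChainClass O.Surface :=
  (Fintype.linearCombination ℝ O.bottom).coprod (Fintype.linearCombination ℝ O.left)

theorem edgeClass_apply (x : Edges n) :
    O.edgeClass x = ∑ i, x.1 i • O.bottom i + ∑ i, x.2 i • O.left i := by
  simp [edgeClass, Fintype.linearCombination_apply]

theorem bottom_mem (i : Fin n) : O.bottom i ∈ LinearMap.range O.edgeClass :=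
  ⟨(Pi.single i 1, 0), by simp [edgeClass]⟩

theorem left_mem (i : Fin n) : O.left i ∈ LinearMap.range O.edgeClass :=
  ⟨(0, Pi.single i 1), by simp [edgeClass]⟩

theorem bottom_add_left (i : Fin n) :
    O.bottom i + O.left (O.h i) = O.left i + O.bottom (O.v i) := by
  rw [bottom, left, left, bottom, ← lineClass_side, ← lineClass_top, lineClass_add, lineClass_add]

/-- The cellular boundary of a combination of squares. -/
noncomputable def faceBoundary (l : Fin n → ℝ) : Edges n :=
  (fun i => l i - l (O.v⁻¹ i), fun i => l (O.h⁻¹ i) - l i)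

theorem edgeClass_faceBoundary (l : Fin n → ℝ) : O.edgeClass (O.faceBoundary l) = 0 := by
  have h1 : ∑ i, l (O.v⁻¹ i) • O.bottom i = ∑ i, l i • O.bottom (O.v i) := by
    rw [← Equiv.sum_comp O.v]; simp
  have h2 : ∑ i, l (O.h⁻¹ i) • O.left i = ∑ i, l i • O.left (O.h i) := by
    rw [← Equiv.sum_comp O.h]; simp
  rw [edgeClass_apply]
  simp only [faceBoundary, sub_smul, Finset.sum_sub_distrib, h1, h2]
  simp only [← Finset.sum_sub_distrib, ← Finset.sum_add_distrib, ← smul_sub, ← smul_add]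
  refine Finset.sum_eq_zero fun i _ => ?_
  have := O.bottom_add_left i
  rw [show O.bottom i - O.bottom (O.v i) + (O.left (O.h i) - O.left i) =
    (O.bottom i + O.left (O.h i)) - (O.left i + O.bottom (O.v i)) by abel, this, sub_self,
    smul_zero]

/-- The class, modulo the edges, of the straight paths from the corners of a square to a point. -/
noncomputable def radial : O.Surface → ChainClass O.Surface ⧸ LinearMap.range O.edgeClass :=
  O.lift (fun i z => Submodule.Quotient.mk (O.lineClass i (0, 0) z))
    (fun i y => by
      rw [← O.lineClass_add i (0, 0) (1, 0), lineClass_side, Submodule.Quotient.mk_add,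
        add_eq_right]
      exact (Submodule.Quotient.mk_eq_zero _).2 (O.bottom_mem i))
    (fun i x => by
      rw [← O.lineClass_add i (0, 0) (0, 1), lineClass_top, Submodule.Quotient.mk_add,
        add_eq_right]
      exact (Submodule.Quotient.mk_eq_zero _).2 (O.left_mem i))

theorem mkQ_pathClass_of_square (i : Fin n) (γ : C(I, I × I)) :
    (LinearMap.range O.edgeClass).mkQ (pathClass ((O.ptC i).comp γ)) =
      O.radial (O.pt i (γ 1)) - O.radial (O.pt i (γ 0)) := by
  rw [eq_sub_iff_add_eq']
  change Submodule.Quotient.mk _ + Submodule.Quotient.mk _ = Submodule.Quotient.mk _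
  rw [← Submodule.Quotient.mk_add, lineClass_cone]

/-! ### The deformation towards the edges -/

/-- The dilation about the midpoint of the unit interval, cut off at the end points. -/
noncomputable def dilate (s x : I) : I :=
  Set.projIcc 0 1 zero_le_one ((x : ℝ) + s * (x - 1 / 2))

@[fun_prop]
theorem _root_.Continuous.dilate {X : Type*} [TopologicalSpace X] {f g : X → I} (hf : Continuous f)
    (hg : Continuous g) : Continuous fun a => dilate (f a) (g a) :=
  continuous_projIcc.comp (by fun_prop)

@[simp] theorem dilate_zero_left (x : I) : dilate 0 x = x := by
  simp [dilate]

theorem dilate_eq_zero (s x : I) (h : (x : ℝ) + s * (x - 1 / 2) ≤ 0) : dilate s x = 0 :=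
  Set.projIcc_of_le_left _ h

theorem dilate_eq_one (s x : I) (h : 1 ≤ (x : ℝ) + s * (x - 1 / 2)) : dilate s x = 1 :=
  Set.projIcc_of_right_le _ h

@[simp] theorem dilate_zero (s : I) : dilate s 0 = 0 := by
  refine dilate_eq_zero _ _ ?_
  have := s.2.1
  simp; linarith

@[simp] theorem dilate_one (s : I) : dilate s 1 = 1 := by
  refine dilate_eq_one _ _ ?_
  have := s.2.1
  simp; linarith

/-- The deformation of the surface that dilates each square. -/
noncomputable def deform (s : I) : O.Surface → O.Surface :=
  O.lift (fun i z => O.pt i (dilate s z.1, dilate s z.2))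
    (fun i y => by simp [pt_side]) (fun i x => by simp [pt_top])

@[simp] theorem deform_pt (s : I) (i : Fin n) (z : I × I) :
    O.deform s (O.pt i z) = O.pt i (dilate s z.1, dilate s z.2) := rfl

theorem continuous_deform : Continuous fun p : I × O.Surface => O.deform p.1 p.2 := by
  have hq : IsQuotientMap (Quot.mk O.Glue) := isQuotientMap_quot_mk
  refine hq.continuous_lift_prod_right (g := fun p : I × O.Surface => O.deform p.1 p.2) ?_
  have h : Continuous fun p : Fin n × (I × (I × I)) =>
      O.pt p.1 (dilate p.2.1 p.2.2.1, dilate p.2.1 p.2.2.2) := by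
    refine continuous_prod_of_discrete_left.2 fun i => (O.continuous_pt i).comp ?_
    fun_prop
  exact h.comp (f := fun p : I × (Fin n × (I × I)) => (p.2.1, (p.1, p.2.2))) (by fun_prop)

theorem mkQ_pathClass_of_deform (γ : C(I, O.Surface)) (δ : C(I, O.Surface))
    (hδ : ∀ t, δ t = O.deform 1 (γ t))
    (h : (LinearMap.range O.edgeClass).mkQ (pathClass δ) = O.radial (δ 1) - O.radial (δ 0)) :
    (LinearMap.range O.edgeClass).mkQ (pathClass γ) = O.radial (γ 1) - O.radial (γ 0) := by
  have track (q : O.Surface) : ∃ τ : C(I, O.Surface), (∀ s, τ s = O.deform s q) ∧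
      (LinearMap.range O.edgeClass).mkQ (pathClass τ) = O.radial (O.deform 1 q) - O.radial q := by
    obtain ⟨i, z, rfl⟩ := O.exists_pt_eq q
    refine ⟨(O.ptC i).comp ⟨fun s => (dilate s z.1, dilate s z.2), by fun_prop⟩, fun s => rfl, ?_⟩
    rw [mkQ_pathClass_of_square]
    simp
  obtain ⟨a, ha, ha'⟩ := track (γ 0)
  obtain ⟨d, hd, hd'⟩ := track (γ 1)
  have hsq := pathClass_square
    ⟨fun p : I × I => O.deform p.1 (γ p.2),
      O.continuous_deform.comp (f := fun p : I × I => (p.1, γ p.2)) (by fun_prop)⟩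
    (a := a) (b := δ) (c := γ) (d := d) (fun t => (ha t).symm) (fun t => (hδ t).symm)
    (fun t => by
      change O.deform 0 (γ t) = γ t
      obtain ⟨i, z, hz⟩ := O.exists_pt_eq (γ t)
      rw [← hz]
      simp) (fun t => (hd t).symm)
  have := congrArg (LinearMap.range O.edgeClass).mkQ hsq
  rw [map_add, map_add, h, ha', hd', hδ, hδ] at this
  rw [← sub_eq_iff_eq_add] at this
  rw [← this]
  abel

end Origami

namespace Origami

variable {n : ℕ} (O : Origami n)

/-! ### An open cover of the surface -/

theorem _root_.unitInterval.coe_circle_eq_coe_iff {x y : I} (hx : x ≠ 1) (hy : y ≠ 1) :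
    ((x : ℝ) : UnitAddCircle) = ((y : ℝ) : UnitAddCircle) ↔ x = y := by
  have m {u : I} (hu : u ≠ 1) : (u : ℝ) ∈ Set.Ico (0 : ℝ) (0 + 1) :=
    ⟨u.2.1, by simpa using lt_of_le_of_ne u.2.2 fun h => hu (Subtype.ext h)⟩
  rw [AddCircle.coe_eq_coe_iff_of_mem_Ico (m hx) (m hy), Subtype.ext_iff]

theorem _root_.unitInterval.coe_circle_eq_zero_iff {x : I} :
    ((x : ℝ) : UnitAddCircle) = 0 ↔ x = 0 ∨ x = 1 := by
  constructor
  · intro h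
    by_contra! hx
    refine hx.1 ((coe_circle_eq_coe_iff hx.2 zero_ne_one).1 ?_)
    simpa using h
  · rintro (rfl | rfl)
    · simp
    · simp [AddCircle.coe_period]

theorem _root_.unitInterval.exists_circle_coordinate {X : Type*} [TopologicalSpace X]
    (θ : C(X, UnitAddCircle)) (h : ∀ t, θ t ≠ 0) :
    ∃ y : C(X, I), ∀ t (u : I), u ≠ 1 → ((u : ℝ) : UnitAddCircle) = θ t → y t = u := by
  have hc : Continuous fun t => ((AddCircle.equivIco (1 : ℝ) 0 (θ t) : ℝ)) := by
    rw [continuous_iff_continuousAt]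
    intro t
    have := AddCircle.continuousAt_equivIco (p := (1 : ℝ)) (a := 0) (x := θ t) (by simpa using h t)
    exact (continuous_subtype_val.continuousAt.comp this).comp θ.continuous.continuousAt
  have hm (t : X) : ((AddCircle.equivIco (1 : ℝ) 0 (θ t) : ℝ)) ∈ I := by
    obtain ⟨h0, h1⟩ := (AddCircle.equivIco (1 : ℝ) 0 (θ t)).2
    exact ⟨h0, by linarith⟩
  refine ⟨⟨fun t => ⟨_, hm t⟩, hc.subtype_mk _⟩, fun t u hu he => Subtype.ext ?_⟩
  have m : (u : ℝ) ∈ Set.Ico (0 : ℝ) (0 + 1) :=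
    ⟨u.2.1, by simpa using lt_of_le_of_ne u.2.2 fun h => hu (Subtype.ext h)⟩
  simp [← he, AddCircle.equivIco_coe_eq m]

/-- The open square `i`. -/
def openSquare (i : Fin n) : Set O.Surface :=
  O.lift (fun k z => k = i ∧ (z.1 ≠ 0 ∧ z.1 ≠ 1) ∧ (z.2 ≠ 0 ∧ z.2 ≠ 1))
    (fun _ _ => by simp) (fun _ _ => by simp)

theorem pt_mem_openSquare {i k : Fin n} {z : I × I} : O.pt k z ∈ O.openSquare i ↔
    k = i ∧ (z.1 ≠ 0 ∧ z.1 ≠ 1) ∧ (z.2 ≠ 0 ∧ z.2 ≠ 1) := Iff.rfl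

/-- A neighbourhood of the open left side of the square `i`. -/
def leftNbhd (i : Fin n) : Set O.Surface :=
  O.lift (fun k z => ((k = i ∧ (z.1 : ℝ) < 1 / 4) ∨ (O.h k = i ∧ 3 / 4 < (z.1 : ℝ))) ∧
      (z.2 ≠ 0 ∧ z.2 ≠ 1))
    (fun _ _ => by norm_num) (fun _ _ => by simp)

theorem pt_mem_leftNbhd {i k : Fin n} {z : I × I} : O.pt k z ∈ O.leftNbhd i ↔
    ((k = i ∧ (z.1 : ℝ) < 1 / 4) ∨ (O.h k = i ∧ 3 / 4 < (z.1 : ℝ))) ∧ (z.2 ≠ 0 ∧ z.2 ≠ 1) :=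
  Iff.rfl

/-- A neighbourhood of the open bottom side of the square `i`. -/
def bottomNbhd (i : Fin n) : Set O.Surface :=
  O.lift (fun k z => ((k = i ∧ (z.2 : ℝ) < 1 / 4) ∨ (O.v k = i ∧ 3 / 4 < (z.2 : ℝ))) ∧
      (z.1 ≠ 0 ∧ z.1 ≠ 1))
    (fun _ _ => by simp) (fun _ _ => by norm_num)

theorem pt_mem_bottomNbhd {i k : Fin n} {z : I × I} : O.pt k z ∈ O.bottomNbhd i ↔
    ((k = i ∧ (z.2 : ℝ) < 1 / 4) ∨ (O.v k = i ∧ 3 / 4 < (z.2 : ℝ))) ∧ (z.1 ≠ 0 ∧ z.1 ≠ 1) :=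
  Iff.rfl

/-- A neighbourhood of the vertex `q`. -/
def vertexNbhd (q : O.Surface) : Set O.Surface :=
  O.lift (fun k z => (((z.1 : ℝ) < 1 / 4 ∨ 3 / 4 < (z.1 : ℝ)) ∧
      ((z.2 : ℝ) < 1 / 4 ∨ 3 / 4 < (z.2 : ℝ))) ∧ O.deform 1 (O.pt k z) = q)
    (fun _ _ => by rw [pt_side]; norm_num) (fun _ _ => by rw [pt_top]; norm_num)

theorem pt_mem_vertexNbhd {q : O.Surface} {k : Fin n} {z : I × I} : O.pt k z ∈ O.vertexNbhd q ↔
    (((z.1 : ℝ) < 1 / 4 ∨ 3 / 4 < (z.1 : ℝ)) ∧ ((z.2 : ℝ) < 1 / 4 ∨ 3 / 4 < (z.2 : ℝ))) ∧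
      O.deform 1 (O.pt k z) = q := Iff.rfl

theorem _root_.unitInterval.isOpen_ne_zero_and_ne_one {X : Type*} [TopologicalSpace X] {f : X → I}
    (hf : Continuous f) : IsOpen {z | f z ≠ 0 ∧ f z ≠ 1} :=
  (isOpen_ne_fun hf continuous_const).inter (isOpen_ne_fun hf continuous_const)

theorem isOpen_openSquare (i : Fin n) : IsOpen (O.openSquare i) := by
  refine O.isOpen_of_pt fun k => ?_
  change IsOpen {z : I × I | k = i ∧ (z.1 ≠ 0 ∧ z.1 ≠ 1) ∧ (z.2 ≠ 0 ∧ z.2 ≠ 1)}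
  exact isOpen_const.and ((isOpen_ne_zero_and_ne_one continuous_fst).and
    (isOpen_ne_zero_and_ne_one continuous_snd))

theorem isOpen_leftNbhd (i : Fin n) : IsOpen (O.leftNbhd i) := by
  refine O.isOpen_of_pt fun k => ?_
  change IsOpen {z : I × I | ((k = i ∧ (z.1 : ℝ) < 1 / 4) ∨ (O.h k = i ∧ 3 / 4 < (z.1 : ℝ))) ∧
    (z.2 ≠ 0 ∧ z.2 ≠ 1)}
  refine IsOpen.and (IsOpen.union ?_ ?_) (isOpen_ne_zero_and_ne_one continuous_snd) <;>
    exact IsOpen.and isOpen_const (isOpen_lt (by fun_prop) (by fun_prop))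

theorem isOpen_bottomNbhd (i : Fin n) : IsOpen (O.bottomNbhd i) := by
  refine O.isOpen_of_pt fun k => ?_
  change IsOpen {z : I × I | ((k = i ∧ (z.2 : ℝ) < 1 / 4) ∨ (O.v k = i ∧ 3 / 4 < (z.2 : ℝ))) ∧
    (z.1 ≠ 0 ∧ z.1 ≠ 1)}
  refine IsOpen.and (IsOpen.union ?_ ?_) (isOpen_ne_zero_and_ne_one continuous_fst) <;>
    exact IsOpen.and isOpen_const (isOpen_lt (by fun_prop) (by fun_prop))

theorem dilate_one_of_lt {x : I} (h : (x : ℝ) < 1 / 4) : dilate 1 x = 0 :=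
  dilate_eq_zero _ _ (by simp; linarith)

theorem dilate_one_of_gt {x : I} (h : 3 / 4 < (x : ℝ)) : dilate 1 x = 1 :=
  dilate_eq_one _ _ (by simp; linarith)

theorem isOpen_vertexNbhd (q : O.Surface) : IsOpen (O.vertexNbhd q) := by
  refine O.isOpen_of_pt fun k => ?_
  have : O.pt k ⁻¹' O.vertexNbhd q =
      {z | (((z.1 : ℝ) < 1 / 4 ∧ (z.2 : ℝ) < 1 / 4) ∧ O.pt k (0, 0) = q) ∨
        (((z.1 : ℝ) < 1 / 4 ∧ 3 / 4 < (z.2 : ℝ)) ∧ O.pt k (0, 1) = q) ∨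
        ((3 / 4 < (z.1 : ℝ) ∧ (z.2 : ℝ) < 1 / 4) ∧ O.pt k (1, 0) = q) ∨
        ((3 / 4 < (z.1 : ℝ) ∧ 3 / 4 < (z.2 : ℝ)) ∧ O.pt k (1, 1) = q)} := by
    ext z
    rw [Set.mem_preimage, pt_mem_vertexNbhd, deform_pt, Set.mem_ofPred_eq]
    constructor
    · rintro ⟨⟨h1 | h1, h2 | h2⟩, h⟩ <;>
        simp only [h1, h2, dilate_one_of_lt, dilate_one_of_gt] at h <;>
        simp only [h1, h2, h, and_self, true_or, or_true]
    · rintro (⟨⟨h1, h2⟩, h⟩ | ⟨⟨h1, h2⟩, h⟩ | ⟨⟨h1, h2⟩, h⟩ | ⟨⟨h1, h2⟩, h⟩) <;>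
        simp only [h1, h2, dilate_one_of_lt, dilate_one_of_gt, h, and_self, true_or, or_true]
  rw [this]
  refine IsOpen.union (IsOpen.and ?_ isOpen_const) (IsOpen.union (IsOpen.and ?_ isOpen_const)
    (IsOpen.union (IsOpen.and ?_ isOpen_const) (IsOpen.and ?_ isOpen_const))) <;>
  exact IsOpen.and (isOpen_lt (by fun_prop) (by fun_prop)) (isOpen_lt (by fun_prop) (by fun_prop))

theorem mem_vertices_iff (q : O.Surface) : q ∈ O.vertices ↔ O.toTorus q = 0 := by
  constructor
  · rintro ⟨i, x, y, hx, hy, rfl⟩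
    rw [toTorus_pt]
    exact Prod.ext (coe_circle_eq_zero_iff.2 hx) (coe_circle_eq_zero_iff.2 hy)
  · obtain ⟨i, z, rfl⟩ := O.exists_pt_eq q
    intro h
    rw [toTorus_pt, Prod.ext_iff] at h
    exact ⟨i, z.1, z.2, coe_circle_eq_zero_iff.1 h.1, coe_circle_eq_zero_iff.1 h.2, rfl⟩

/-- A point that is not a vertex lies in an open square or near an open side. -/
theorem exists_mem_nbhd {q : O.Surface} (hq : q ∉ O.vertices) :
    ∃ i, q ∈ O.openSquare i ∨ q ∈ O.leftNbhd i ∨ q ∈ O.bottomNbhd i := by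
  obtain ⟨i, ⟨x, y⟩, rfl⟩ := O.exists_pt_eq q
  simp only [pt_mem_openSquare, pt_mem_leftNbhd, pt_mem_bottomNbhd]
  by_cases hx : x = 0 ∨ x = 1
  · by_cases hy : y = 0 ∨ y = 1
    · exact absurd ⟨i, x, y, hx, hy, rfl⟩ hq
    · rw [not_or] at hy
      rcases hx with rfl | rfl
      · exact ⟨i, Or.inr (Or.inl ⟨Or.inl ⟨rfl, by norm_num⟩, hy⟩)⟩
      · exact ⟨O.h i, Or.inr (Or.inl ⟨Or.inr ⟨rfl, by norm_num⟩, hy⟩)⟩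
  · rw [not_or] at hx
    by_cases hy : y = 0 ∨ y = 1
    · rcases hy with rfl | rfl
      · exact ⟨i, Or.inr (Or.inr ⟨Or.inl ⟨rfl, by norm_num⟩, hx⟩)⟩
      · exact ⟨O.v i, Or.inr (Or.inr ⟨Or.inr ⟨rfl, by norm_num⟩, hx⟩)⟩
    · rw [not_or] at hy
      exact ⟨i, Or.inl ⟨rfl, hx, hy⟩⟩

theorem exists_pt_of_mem_leftNbhd {i : Fin n} {q : O.Surface} (hq : q ∈ O.leftNbhd i) :
    ∃ y : I, (y ≠ 0 ∧ y ≠ 1) ∧ ((y : ℝ) : UnitAddCircle) = (O.toTorus q).2 ∧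
      O.deform 1 q = O.pt i (0, dilate 1 y) := by
  obtain ⟨k, ⟨x, y⟩, rfl⟩ := O.exists_pt_eq q
  rw [pt_mem_leftNbhd] at hq
  refine ⟨y, hq.2, rfl, ?_⟩
  obtain ⟨⟨rfl, h⟩ | ⟨rfl, h⟩, -⟩ := hq
  · simp [dilate_one_of_lt h]
  · simp [dilate_one_of_gt h, pt_side]

theorem exists_pt_of_mem_bottomNbhd {i : Fin n} {q : O.Surface} (hq : q ∈ O.bottomNbhd i) :
    ∃ x : I, (x ≠ 0 ∧ x ≠ 1) ∧ ((x : ℝ) : UnitAddCircle) = (O.toTorus q).1 ∧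
      O.deform 1 q = O.pt i (dilate 1 x, 0) := by
  obtain ⟨k, ⟨x, y⟩, rfl⟩ := O.exists_pt_eq q
  rw [pt_mem_bottomNbhd] at hq
  refine ⟨x, hq.2, rfl, ?_⟩
  obtain ⟨⟨rfl, h⟩ | ⟨rfl, h⟩, -⟩ := hq
  · simp [dilate_one_of_lt h]
  · simp [dilate_one_of_gt h, pt_top]

/-- The covering of the torus as a continuous map. -/
noncomputable def torusMap : C(O.Surface, UnitAddCircle × UnitAddCircle) :=
  ⟨O.toTorus, O.continuous_toTorus⟩

/-- The first coordinate of the covering of the torus. -/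
noncomputable def torusFst : C(O.Surface, UnitAddCircle) := ContinuousMap.fst.comp O.torusMap

/-- The second coordinate of the covering of the torus. -/
noncomputable def torusSnd : C(O.Surface, UnitAddCircle) := ContinuousMap.snd.comp O.torusMap

theorem mkQ_pathClass (γ : C(I, O.Surface)) :
    (LinearMap.range O.edgeClass).mkQ (pathClass γ) = O.radial (γ 1) - O.radial (γ 0) := by
  refine pathClass_eq_of_cover _ O.radial
    (fun U : {U : Set O.Surface // (∃ i, U = O.openSquare i) ∨ (∃ i, U = O.leftNbhd i) ∨
      (∃ i, U = O.bottomNbhd i) ∨ ∃ q, U = O.vertexNbhd q} => U.1) ?_ ?_ ?_ γ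
  · rintro ⟨U, ⟨i, rfl⟩ | ⟨i, rfl⟩ | ⟨i, rfl⟩ | ⟨q, rfl⟩⟩
    exacts [O.isOpen_openSquare i, O.isOpen_leftNbhd i, O.isOpen_bottomNbhd i,
      O.isOpen_vertexNbhd q]
  · intro q
    by_cases hq : q ∈ O.vertices
    · refine ⟨⟨O.vertexNbhd q, Or.inr (Or.inr (Or.inr ⟨q, rfl⟩))⟩, ?_⟩
      obtain ⟨i, x, y, hx, hy, rfl⟩ := hq
      change O.pt _ _ ∈ O.vertexNbhd _
      rw [pt_mem_vertexNbhd]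
      rcases hx with rfl | rfl <;> rcases hy with rfl | rfl <;> norm_num
    · obtain ⟨i, h | h | h⟩ := O.exists_mem_nbhd hq
      exacts [⟨⟨_, Or.inl ⟨i, rfl⟩⟩, h⟩, ⟨⟨_, Or.inr (Or.inl ⟨i, rfl⟩)⟩, h⟩,
        ⟨⟨_, Or.inr (Or.inr (Or.inl ⟨i, rfl⟩))⟩, h⟩]
  · rintro γ ⟨U, ⟨i, rfl⟩ | ⟨i, rfl⟩ | ⟨i, rfl⟩ | ⟨q, rfl⟩⟩ hγ <;>
      change ∀ t, γ t ∈ _ at hγ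
    · have hz (t : I) : ∃ z : I × I, (z.1 ≠ 0 ∧ z.1 ≠ 1) ∧ (z.2 ≠ 0 ∧ z.2 ≠ 1) ∧
          γ t = O.pt i z := by
        have := hγ t
        obtain ⟨k, z, hz⟩ := O.exists_pt_eq (γ t)
        rw [← hz, pt_mem_openSquare] at this
        obtain ⟨rfl, h1, h2⟩ := this
        exact ⟨z, h1, h2, hz.symm⟩
      obtain ⟨x, hx⟩ := exists_circle_coordinate (O.torusFst.comp γ) fun t h => by
        obtain ⟨z, h1, h2, hz⟩ := hz t
        have h : (O.toTorus (γ t)).1 = 0 := h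
        rw [hz, toTorus_pt, coe_circle_eq_zero_iff] at h
        exact h.elim h1.1 h1.2
      obtain ⟨y, hy⟩ := exists_circle_coordinate (O.torusSnd.comp γ) fun t h => by
        obtain ⟨z, h1, h2, hz⟩ := hz t
        have h : (O.toTorus (γ t)).2 = 0 := h
        rw [hz, toTorus_pt, coe_circle_eq_zero_iff] at h
        exact h.elim h2.1 h2.2
      have e : γ = (O.ptC i).comp (x.prodMk y) := by
        ext t
        obtain ⟨z, h1, h2, hz⟩ := hz t
        have ex : x t = z.1 := hx t z.1 h1.2 (by change _ = (O.toTorus (γ t)).1; rw [hz]; rfl)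
        have ey : y t = z.2 := hy t z.2 h2.2 (by change _ = (O.toTorus (γ t)).2; rw [hz]; rfl)
        simp [ex, ey, hz]
      rw [e]
      exact O.mkQ_pathClass_of_square i _
    · obtain ⟨y, hy⟩ := exists_circle_coordinate (O.torusSnd.comp γ) fun t h => by
        obtain ⟨y, hy, he, -⟩ := O.exists_pt_of_mem_leftNbhd (hγ t)
        exact (coe_circle_eq_zero_iff.1 (he.trans h)).elim hy.1 hy.2
      refine O.mkQ_pathClass_of_deform γ
        ((O.ptC i).comp ⟨fun t => (0, dilate 1 (y t)), by fun_prop⟩) (fun t => ?_)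
        (O.mkQ_pathClass_of_square i _)
      obtain ⟨u, hu, he, hd⟩ := O.exists_pt_of_mem_leftNbhd (hγ t)
      rw [hd, ← hy t u hu.2 he]
      rfl
    · obtain ⟨x, hx⟩ := exists_circle_coordinate (O.torusFst.comp γ) fun t h => by
        obtain ⟨x, hx, he, -⟩ := O.exists_pt_of_mem_bottomNbhd (hγ t)
        exact (coe_circle_eq_zero_iff.1 (he.trans h)).elim hx.1 hx.2
      refine O.mkQ_pathClass_of_deform γ
        ((O.ptC i).comp ⟨fun t => (dilate 1 (x t), 0), by fun_prop⟩) (fun t => ?_)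
        (O.mkQ_pathClass_of_square i _)
      obtain ⟨u, hu, he, hd⟩ := O.exists_pt_of_mem_bottomNbhd (hγ t)
      rw [hd, ← hx t u hu.2 he]
      rfl
    · refine O.mkQ_pathClass_of_deform γ (ContinuousMap.const I q) (fun t => ?_) ?_
      · have := hγ t
        obtain ⟨k, z, hz⟩ := O.exists_pt_eq (γ t)
        rw [← hz, pt_mem_vertexNbhd] at this
        rw [← hz, this.2]
        rfl
      · simp [pathClass_const]

/-- Every homology class is cellular. -/
theorem H1incl_mem_range_edgeClass (c : H1 O.Surface) :
    H1incl O.Surface c ∈ LinearMap.range O.edgeClass := by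
  rw [← Submodule.Quotient.mk_eq_zero, ← Submodule.mkQ_apply,
    linearMap_eq_endClass O.mkQ_pathClass, endClass_H1incl]

end Origami

namespace Origami

variable {n : ℕ} (O : Origami n)

/-! ### The dimension of the homology -/

open Classical in
/-- The function on the surface with given values at the vertices that vanishes elsewhere; `W i`
is the value at the lower left corner of the square `i`. -/
noncomputable def vertexFun {M : Type*} [Zero M] (W : Fin n → M)
    (hW : ∀ i, W (O.h (O.v i)) = W (O.v (O.h i))) : O.Surface → M :=
  O.lift (fun k z => if z.1 = 0 then (if z.2 = 0 then W k else if z.2 = 1 then W (O.v k) else 0)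
      else if z.1 = 1 then (if z.2 = 0 then W (O.h k) else if z.2 = 1 then W (O.v (O.h k)) else 0)
      else 0)
    (fun i y => by simp) (fun i x => by simp [hW])

theorem endClass_vertexFun_bottom {M : Type*} [AddCommGroup M] [Module ℝ M] (W : Fin n → M)
    (hW : ∀ i, W (O.h (O.v i)) = W (O.v (O.h i))) (i : Fin n) :
    endClass (O.vertexFun W hW) (O.bottom i) = W (O.h i) - W i := by
  rw [bottom, lineClass, endClass_pathClass]
  simp [vertexFun]

theorem endClass_vertexFun_left {M : Type*} [AddCommGroup M] [Module ℝ M] (W : Fin n → M)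
    (hW : ∀ i, W (O.h (O.v i)) = W (O.v (O.h i))) (i : Fin n) :
    endClass (O.vertexFun W hW) (O.left i) = W (O.v i) - W i := by
  rw [left, lineClass, endClass_pathClass]
  simp [vertexFun]

/-- `O` is connected: every square can be reached from the square `i₀`. -/
def ReachableFrom (i₀ : Fin n) : Prop :=
  ∀ P : Fin n → Prop, P i₀ → (∀ i, P i → P (O.h i)) → (∀ i, P i → P (O.v i)) → ∀ i, P i

/-- `faceBoundary` as a linear map. -/
noncomputable def faceBoundaryₗ : (Fin n → ℝ) →ₗ[ℝ] Edges n where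
  toFun := O.faceBoundary
  map_add' a b := by ext i <;> simp [faceBoundary] <;> ring
  map_smul' r a := by ext i <;> simp [faceBoundary] <;> ring

variable {O} in
theorem ReachableFrom.finrank_ker_faceBoundary_le {i₀ : Fin n} (h : O.ReachableFrom i₀) :
    Module.finrank ℝ (LinearMap.ker O.faceBoundaryₗ) ≤ 1 := by
  have hle : LinearMap.ker O.faceBoundaryₗ ≤ Submodule.span ℝ {fun _ => (1 : ℝ)} := by
    intro l hl
    have hl : O.faceBoundary l = 0 := hl
    rw [Submodule.mem_span_singleton]
    refine ⟨l i₀, ?_⟩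
    suffices ∀ i, l i = l i₀ by ext i; simp [this]
    refine h _ rfl (fun i hi => ?_) (fun i hi => ?_)
    · have := congrFun (congrArg Prod.snd hl) (O.h i)
      simp [faceBoundary, sub_eq_zero] at this
      rw [← this, hi]
    · have := congrFun (congrArg Prod.fst hl) (O.v i)
      simp [faceBoundary, sub_eq_zero] at this
      rw [this, hi]
  exact (Submodule.finrank_mono hle).trans ((finrank_span_le_card _).trans (by simp))

variable {O} in
theorem ReachableFrom.finrank_H1_le {i₀ : Fin n} (h : O.ReachableFrom i₀) {m : ℕ}
    (w : Fin n → Fin m) (hw : ∀ i, w (O.h (O.v i)) = w (O.v (O.h i)))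
    (hsurj : Function.Surjective w) :
    FiniteDimensional ℝ (H1 O.Surface) ∧ Module.finrank ℝ (H1 O.Surface) + m ≤ n + 2 := by
  set W : Fin n → (Fin m → ℝ) := fun i => Pi.single (w i) 1
  have hW : ∀ i, W (O.h (O.v i)) = W (O.v (O.h i)) := fun i => by simp [W, hw]
  set D : Edges n →ₗ[ℝ] (Fin m → ℝ) := endClass (O.vertexFun W hW) ∘ₗ O.edgeClass
  set K := LinearMap.ker D
  set κ := O.edgeClass.domRestrict K
  have hD : m ≤ Module.finrank ℝ (LinearMap.range D) + 1 := by
    have htop : LinearMap.range D ⊔ Submodule.span ℝ {W i₀} = ⊤ := by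
      have hmem : ∀ i, W i ∈ LinearMap.range D ⊔ Submodule.span ℝ {W i₀} := by
        refine h _ (Submodule.mem_sup_right (Submodule.mem_span_singleton_self _))
          (fun i hi => ?_) (fun i hi => ?_)
        · have : W (O.h i) - W i ∈ LinearMap.range D := by
            obtain ⟨x, hx⟩ := O.bottom_mem i
            exact ⟨x, by simp [D, hx, endClass_vertexFun_bottom]⟩
          simpa using Submodule.add_mem _ (Submodule.mem_sup_left this) hi
        · have : W (O.v i) - W i ∈ LinearMap.range D := by
            obtain ⟨x, hx⟩ := O.left_mem i
            exact ⟨x, by simp [D, hx, endClass_vertexFun_left]⟩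
          simpa using Submodule.add_mem _ (Submodule.mem_sup_left this) hi
      rw [eq_top_iff, ← (Pi.basisFun ℝ (Fin m)).span_eq, Submodule.span_le]
      rintro _ ⟨k, rfl⟩
      obtain ⟨i, rfl⟩ := hsurj k
      simpa [W] using hmem i
    have h1 := Submodule.finrank_add_le_finrank_add_finrank (LinearMap.range D)
      (Submodule.span ℝ {W i₀})
    rw [htop, finrank_top, Module.finrank_fin_fun] at h1
    have : Module.finrank ℝ (Submodule.span ℝ {W i₀}) ≤ 1 :=
      (finrank_span_le_card _).trans (by simp)
    omega
  have hK : _ + Module.finrank ℝ K = _ := LinearMap.finrank_range_add_finrank_ker D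
  have hE : Module.finrank ℝ (Edges n) = n + n := by
    rw [Module.finrank_prod, Module.finrank_fin_fun]
  have hface (l : Fin n → ℝ) : O.faceBoundaryₗ l ∈ K := by
    simp [K, D, faceBoundaryₗ, edgeClass_faceBoundary]
  set F : (Fin n → ℝ) →ₗ[ℝ] LinearMap.ker κ :=
    (O.faceBoundaryₗ.codRestrict K hface).codRestrict (LinearMap.ker κ) fun l => by
      simp [κ, faceBoundaryₗ, edgeClass_faceBoundary]
  have hF : n ≤ Module.finrank ℝ (LinearMap.ker κ) + 1 := by
    have h1 := LinearMap.finrank_range_add_finrank_ker (V := Fin n → ℝ) (V₂ := LinearMap.ker κ) F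
    rw [Module.finrank_fin_fun] at h1
    have h2 := (LinearMap.range F).finrank_le
    have h3 : LinearMap.ker F = LinearMap.ker O.faceBoundaryₗ := by
      ext l
      rw [LinearMap.mem_ker, LinearMap.mem_ker, Subtype.ext_iff, Subtype.ext_iff]
      rfl
    have h4 := h.finrank_ker_faceBoundary_le
    rw [h3] at h1
    omega
  have hκ := LinearMap.finrank_range_add_finrank_ker κ
  have hle : LinearMap.range (H1incl O.Surface) ≤ LinearMap.range κ := by
    rintro _ ⟨c, rfl⟩
    obtain ⟨x, hx⟩ := O.H1incl_mem_range_edgeClass c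
    refine ⟨⟨x, ?_⟩, hx⟩
    rw [LinearMap.mem_ker, LinearMap.comp_apply, hx, endClass_H1incl]
  have hfin : FiniteDimensional ℝ (LinearMap.range (H1incl O.Surface)) :=
    Submodule.finiteDimensional_of_le hle
  have e := LinearEquiv.ofInjective (H1incl O.Surface) H1incl_injective
  refine ⟨e.symm.finiteDimensional, ?_⟩
  have := Submodule.finrank_mono hle
  rw [← e.finrank_eq] at this
  omega

/-! ### Cocycles -/

/-- The circle-valued function of an integral cellular cocycle, with values `a` on the bottom sides
and `b` on the left sides. -/
noncomputable def cocycleMap (a b : Fin n → ℤ) (hab : ∀ i, a i + b (O.h i) = b i + a (O.v i)) :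
    C(O.Surface, UnitAddCircle) where
  toFun := O.lift
    (fun i z => ((a i * z.1 + b i * z.2 + (a (O.v i) - a i) * (z.1 * z.2) : ℝ) : UnitAddCircle))
    (fun i y => by
      have h : (a i : ℝ) + b (O.h i) = b i + a (O.v i) := by exact_mod_cast hab i
      have e : (a i * (1 : I) + b i * y + (a (O.v i) - a i) * ((1 : I) * y) : ℝ) =
          (a (O.h i) * (0 : I) + b (O.h i) * y +
            (a (O.v (O.h i)) - a (O.h i)) * ((0 : I) * y) : ℝ) + a i • (1 : ℝ) := by
        simp
        linear_combination (-y : ℝ) * h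
      dsimp only
      rw [e, AddCircle.coe_add, AddCircle.coe_zsmul, AddCircle.coe_period, smul_zero, add_zero])
    (fun i x => by
      have e : (a i * x + b i * (1 : I) + (a (O.v i) - a i) * (x * (1 : I)) : ℝ) =
          (a (O.v i) * x + b (O.v i) * (0 : I) +
            (a (O.v (O.v i)) - a (O.v i)) * (x * (0 : I)) : ℝ) + b i • (1 : ℝ) := by
        simp
        ring
      dsimp only
      rw [e, AddCircle.coe_add, AddCircle.coe_zsmul, AddCircle.coe_period, smul_zero, add_zero])
  continuous_toFun := O.continuous_of_pt fun i => by
    simp only [lift_pt]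
    exact (AddCircle.continuous_mk' 1).comp (by fun_prop)

theorem incClass_cocycleMap_bottom (a b : Fin n → ℤ) (hab) (i : Fin n) :
    incClass (O.cocycleMap a b hab) (O.bottom i) = a i := by
  rw [bottom, lineClass, incClass_pathClass _ _ ⟨fun t => (a i * t : ℝ), by fun_prop⟩]
  · simp
  · intro t
    simp [cocycleMap]

theorem incClass_cocycleMap_left (a b : Fin n → ℤ) (hab) (i : Fin n) :
    incClass (O.cocycleMap a b hab) (O.left i) = b i := by
  rw [left, lineClass, incClass_pathClass _ _ ⟨fun t => (b i * t : ℝ), by fun_prop⟩]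
  · simp
  · intro t
    simp [cocycleMap]

theorem incClass_cocycleMap_edgeClass (a b : Fin n → ℤ) (hab) (x : Edges n) :
    incClass (O.cocycleMap a b hab) (O.edgeClass x) = ∑ i, x.1 i * a i + ∑ i, x.2 i * b i := by
  simp [edgeClass_apply, incClass_cocycleMap_bottom, incClass_cocycleMap_left]

/-! ### Holonomy -/

theorem torusFst_eq_cocycleMap : O.torusFst = O.cocycleMap 1 0 (fun _ => by simp) := by
  ext q
  obtain ⟨i, z, rfl⟩ := O.exists_pt_eq q
  simp [cocycleMap, torusFst, torusMap]

theorem torusSnd_eq_cocycleMap : O.torusSnd = O.cocycleMap 0 1 (fun _ => by simp) := by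
  ext q
  obtain ⟨i, z, rfl⟩ := O.exists_pt_eq q
  simp [cocycleMap, torusSnd, torusMap]

theorem holonomy_apply (c : Chain 1 O.Surface) :
    O.holonomy c = (incChain O.torusFst c, incChain O.torusSnd c) := by
  suffices O.holonomy = (incChain O.torusFst).prod (incChain O.torusSnd) from
    LinearMap.congr_fun this c
  refine chain_linearMap_ext fun s => ?_
  have h : O.holonomy (simplexChain s) =
      (increment fun t => (O.toTorus (s t)).1, increment fun t => (O.toTorus (s t)).2) :=
    chainLift_simplexChain _ s
  rw [h]
  change _ = (incChain O.torusFst (simplexChain s), incChain O.torusSnd (simplexChain s))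
  rw [incChain, incChain, chainLift_simplexChain, chainLift_simplexChain]
  rfl

theorem mem_zeroHolonomy_iff (c : H1 O.Surface) :
    c ∈ O.zeroHolonomy ↔ incClass O.torusFst (H1incl O.Surface c) = 0 ∧
      incClass O.torusSnd (H1incl O.Surface c) = 0 := by
  obtain ⟨c, rfl⟩ := Submodule.Quotient.mk_surjective _ c
  rw [H1incl_mk, incClass_chainClass, incClass_chainClass]
  constructor
  · rintro ⟨c', hc', he⟩
    have hc' : O.holonomy c' = 0 := hc'
    rw [holonomy_apply, Prod.ext_iff] at hc'
    have e : chainClass O.Surface (c : Chain 1 O.Surface) = chainClass O.Surface c' := by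
      rw [← H1incl_mk, ← H1incl_mk, ← he]
      rfl
    rw [← incClass_chainClass, ← incClass_chainClass, e]
    exact hc'
  · intro h
    refine ⟨c, ?_, rfl⟩
    change O.holonomy c = 0
    rw [holonomy_apply, h.1, h.2]
    rfl

theorem edgeClass_mem_zeroHolonomy_iff {c : H1 O.Surface} {x : Edges n}
    (h : H1incl O.Surface c = O.edgeClass x) :
    c ∈ O.zeroHolonomy ↔ ∑ i, x.1 i = 0 ∧ ∑ i, x.2 i = 0 := by
  rw [mem_zeroHolonomy_iff, h, torusFst_eq_cocycleMap, torusSnd_eq_cocycleMap,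
    incClass_cocycleMap_edgeClass, incClass_cocycleMap_edgeClass]
  simp

/-! ### The classes of straight closed curves -/

theorem chainClass_sigma (i : Fin n) :
    chainClass O.Surface (O.sigma i) = ∑ j ∈ orbit O.h i, O.bottom j := by
  rw [sigma, map_sum, ← sub_eq_zero, ← Finset.sum_sub_distrib,
    ← sum_orbit_sub O.h i fun j => O.lineClass j (0, 0) (0, half)]
  refine Finset.sum_congr rfl fun j _ => ?_
  rw [chainClass_segmentChain, bottom, ← lineClass_side, sub_eq_sub_iff_add_eq_add, add_comm,
    lineClass_add, add_comm, lineClass_add]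

theorem chainClass_zeta (i : Fin n) :
    chainClass O.Surface (O.zeta i) = ∑ j ∈ orbit O.v i, O.left j := by
  rw [zeta, map_sum, ← sub_eq_zero, ← Finset.sum_sub_distrib,
    ← sum_orbit_sub O.v i fun j => O.lineClass j (0, 0) (half, 0)]
  refine Finset.sum_congr rfl fun j _ => ?_
  rw [chainClass_segmentChain, left, ← lineClass_top, sub_eq_sub_iff_add_eq_add, add_comm,
    lineClass_add, add_comm, lineClass_add]

theorem chainClass_eta (i : Fin n) :
    chainClass O.Surface (O.eta i) =
      ∑ j ∈ orbit (O.v * O.h) i, (O.bottom j + O.left (O.h j)) := by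
  rw [eta, map_sum, ← sub_eq_zero, ← Finset.sum_sub_distrib,
    ← sum_orbit_sub (O.v * O.h) i fun j => O.lineClass j (0, 0) (half, 0)]
  refine Finset.sum_congr rfl fun j _ => ?_
  have h1 := O.lineClass_add j (0, 0) (half, 0) (1, half)
  have h2 := O.lineClass_add j (0, 0) (1, 0) (1, half)
  have h3 := O.lineClass_add (O.h j) (0, 0) (0, half) (half, 1)
  have h4 := O.lineClass_add (O.h j) (0, 0) (0, 1) (half, 1)
  rw [lineClass_side] at h2
  rw [lineClass_top] at h4
  rw [map_add, chainClass_segmentChain, chainClass_segmentChain, bottom, left,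
    eq_sub_of_add_eq' h1, eq_sub_of_add_eq' h3, ← h2, ← h4, Equiv.Perm.mul_apply]
  abel

end Origami

namespace Origami

variable {n : ℕ} (O : Origami n)

/-! ### The action of integral matrices on the torus -/

/-- The linear action of an integral matrix on the square torus. -/
def torusAct (A : Matrix (Fin 2) (Fin 2) ℤ) (u : UnitAddCircle × UnitAddCircle) :
    UnitAddCircle × UnitAddCircle :=
  (A 0 0 • u.1 + A 0 1 • u.2, A 1 0 • u.1 + A 1 1 • u.2)

theorem torusAct_one (u) : torusAct 1 u = u := by
  simp [torusAct]

theorem torusAct_mul (A B : Matrix (Fin 2) (Fin 2) ℤ) (u) :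
    torusAct (A * B) u = torusAct A (torusAct B u) := by
  simp only [torusAct, Matrix.mul_apply, Fin.sum_univ_two, smul_add, add_smul, mul_smul]
  ext <;> simp only [] <;> abel

theorem torusAct_zero (A : Matrix (Fin 2) (Fin 2) ℤ) : torusAct A 0 = 0 := by
  simp [torusAct]

/-- The projection of the plane to the square torus. -/
noncomputable def planeToTorus : (Fin 2 → ℝ) →+ UnitAddCircle × UnitAddCircle where
  toFun v := (((v 0 : ℝ) : UnitAddCircle), ((v 1 : ℝ) : UnitAddCircle))
  map_zero' := by simp
  map_add' v w := by simp

theorem torusAct_planeToTorus (A : Matrix (Fin 2) (Fin 2) ℤ) (v : Fin 2 → ℝ) :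
    torusAct A (planeToTorus v) = planeToTorus ((A.map (Int.cast : ℤ → ℝ)).mulVec v) := by
  change (A 0 0 • ((v 0 : ℝ) : UnitAddCircle) + A 0 1 • ((v 1 : ℝ) : UnitAddCircle),
    A 1 0 • ((v 0 : ℝ) : UnitAddCircle) + A 1 1 • ((v 1 : ℝ) : UnitAddCircle)) = (_, _)
  simp only [← AddCircle.coe_zsmul, ← AddCircle.coe_add]
  simp [Matrix.mulVec, dotProduct, Fin.sum_univ_two]

theorem toTorus_pt_eq_planeToTorus (i : Fin n) (z : I × I) :
    O.toTorus (O.pt i z) = planeToTorus (vec z) := rfl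

theorem continuous_planeToTorus : Continuous planeToTorus :=
  ((AddCircle.continuous_mk' 1).comp (continuous_apply 0)).prodMk
    ((AddCircle.continuous_mk' 1).comp (continuous_apply 1))

theorem continuous_vec : Continuous vec := by
  refine continuous_pi fun k => ?_
  fin_cases k
  · exact continuous_subtype_val.comp continuous_fst
  · exact continuous_subtype_val.comp continuous_snd

theorem isInducing_vec : IsInducing vec := by
  have hi : Function.Injective vec := fun z w h =>
    Prod.ext (Subtype.ext (congrFun h 0)) (Subtype.ext (congrFun h 1))
  exact (continuous_vec.isClosedEmbedding hi).isInducing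

/-- `f` covers the action of `A` on the square torus. -/
def Over {O O' : Origami n} (A : Matrix.SpecialLinearGroup (Fin 2) ℤ)
    (f : O.Surface → O'.Surface) : Prop :=
  ∀ q, O'.toTorus (f q) = torusAct A.1 (O.toTorus q)

theorem Over.comp {O O' O'' : Origami n} {A B : Matrix.SpecialLinearGroup (Fin 2) ℤ}
    {f : O'.Surface → O''.Surface} {g : O.Surface → O'.Surface} (hf : Over A f) (hg : Over B g) :
    Over (A * B) (f ∘ g) := fun q => by
  rw [Function.comp_apply, hf, hg, Matrix.SpecialLinearGroup.coe_mul, torusAct_mul]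

theorem Over.symm {O O' : Origami n} {A : Matrix.SpecialLinearGroup (Fin 2) ℤ}
    {f : O.Surface ≃ₜ O'.Surface} (hf : Over A f) : Over A⁻¹ f.symm := fun q => by
  have h := hf (f.symm q)
  rw [f.apply_symm_apply] at h
  rw [h, ← torusAct_mul, ← Matrix.SpecialLinearGroup.coe_mul, inv_mul_cancel,
    Matrix.SpecialLinearGroup.coe_one, torusAct_one]

theorem Over.mem_vertices_iff {O O' : Origami n} {A : Matrix.SpecialLinearGroup (Fin 2) ℤ}
    {f : O.Surface ≃ₜ O'.Surface} (hf : Over A f) (q : O.Surface) :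
    f q ∈ O'.vertices ↔ q ∈ O.vertices := by
  rw [Origami.mem_vertices_iff, Origami.mem_vertices_iff]
  constructor
  · intro h
    have := hf.symm (f q)
    rwa [h, torusAct_zero, f.symm_apply_apply] at this
  · intro h
    rw [hf, h, torusAct_zero]

/-! ### The covering of the torus is a local homeomorphism off the vertices -/

theorem _root_.unitInterval.coe_circle_eq_coe {x y : I}
    (h : ((x : ℝ) : UnitAddCircle) = ((y : ℝ) : UnitAddCircle)) :
    x = y ∨ (x = 0 ∧ y = 1) ∨ (x = 1 ∧ y = 0) := by
  by_cases hx : x = 1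
  · subst hx
    have h0 : ((y : ℝ) : UnitAddCircle) = 0 := by
      rw [← h]
      simp [AddCircle.coe_period]
    rcases coe_circle_eq_zero_iff.1 h0 with rfl | rfl <;> simp
  · by_cases hy : y = 1
    · subst hy
      have h0 : ((x : ℝ) : UnitAddCircle) = 0 := by
        rw [h]
        simp [AddCircle.coe_period]
      rcases coe_circle_eq_zero_iff.1 h0 with rfl | rfl <;> simp
    · exact Or.inl ((coe_circle_eq_coe_iff hx hy).1 h)

theorem injOn_toTorus_openSquare (i : Fin n) : Set.InjOn O.toTorus (O.openSquare i) := by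
  intro p hp q hq h
  obtain ⟨k, ⟨x, y⟩, rfl⟩ := O.exists_pt_eq p
  obtain ⟨l, ⟨x', y'⟩, rfl⟩ := O.exists_pt_eq q
  rw [pt_mem_openSquare] at hp hq
  obtain ⟨rfl, hx, hy⟩ := hp
  obtain ⟨rfl, hx', hy'⟩ := hq
  rw [toTorus_pt, toTorus_pt, Prod.ext_iff] at h
  dsimp only at h hx hy hx' hy'
  rw [(coe_circle_eq_coe_iff hx.2 hx'.2).1 h.1, (coe_circle_eq_coe_iff hy.2 hy'.2).1 h.2]

theorem injOn_toTorus_leftNbhd (i : Fin n) : Set.InjOn O.toTorus (O.leftNbhd i) := by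
  intro p hp q hq h
  obtain ⟨k, ⟨x, y⟩, rfl⟩ := O.exists_pt_eq p
  obtain ⟨l, ⟨x', y'⟩, rfl⟩ := O.exists_pt_eq q
  rw [pt_mem_leftNbhd] at hp hq
  obtain ⟨hx, hy⟩ := hp
  obtain ⟨hx', hy'⟩ := hq
  rw [toTorus_pt, toTorus_pt, Prod.ext_iff] at h
  dsimp only at h hx hy hx' hy'
  rw [(coe_circle_eq_coe_iff hy.2 hy'.2).1 h.2]
  rcases coe_circle_eq_coe h.1 with e | ⟨e, e'⟩ | ⟨e, e'⟩
  · subst e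
    rcases hx with ⟨rfl, hx⟩ | ⟨hk, hx⟩ <;> rcases hx' with ⟨rfl, hx'⟩ | ⟨hl, hx'⟩
    · rfl
    · linarith
    · linarith
    · rw [O.h.injective (hk.trans hl.symm)]
  · subst e e'
    norm_num at hx hx'
    rw [pt_side, hx', hx]
  · subst e e'
    norm_num at hx hx'
    rw [pt_side, hx', hx]

theorem injOn_toTorus_bottomNbhd (i : Fin n) : Set.InjOn O.toTorus (O.bottomNbhd i) := by
  intro p hp q hq h
  obtain ⟨k, ⟨x, y⟩, rfl⟩ := O.exists_pt_eq p
  obtain ⟨l, ⟨x', y'⟩, rfl⟩ := O.exists_pt_eq q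
  rw [pt_mem_bottomNbhd] at hp hq
  obtain ⟨hy, hx⟩ := hp
  obtain ⟨hy', hx'⟩ := hq
  rw [toTorus_pt, toTorus_pt, Prod.ext_iff] at h
  dsimp only at h hx hy hx' hy'
  rw [(coe_circle_eq_coe_iff hx.2 hx'.2).1 h.1]
  rcases coe_circle_eq_coe h.2 with e | ⟨e, e'⟩ | ⟨e, e'⟩
  · subst e
    rcases hy with ⟨rfl, hy⟩ | ⟨hk, hy⟩ <;> rcases hy' with ⟨rfl, hy'⟩ | ⟨hl, hy'⟩
    · rfl
    · linarith
    · linarith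
    · rw [O.v.injective (hk.trans hl.symm)]
  · subst e e'
    norm_num at hy hy'
    rw [pt_top, hy', hy]
  · subst e e'
    norm_num at hy hy'
    rw [pt_top, hy', hy]

theorem exists_injOn_toTorus {q : O.Surface} (hq : q ∉ O.vertices) :
    ∃ U, IsOpen U ∧ q ∈ U ∧ Set.InjOn O.toTorus U := by
  obtain ⟨i, h | h | h⟩ := O.exists_mem_nbhd hq
  exacts [⟨_, O.isOpen_openSquare i, h, O.injOn_toTorus_openSquare i⟩,
    ⟨_, O.isOpen_leftNbhd i, h, O.injOn_toTorus_leftNbhd i⟩,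
    ⟨_, O.isOpen_bottomNbhd i, h, O.injOn_toTorus_bottomNbhd i⟩]

/-! ### Affine homeomorphisms cover linear maps of the torus -/

variable {O} in
theorem Over.isAffine {A : Matrix.SpecialLinearGroup (Fin 2) ℤ} {f : O.Surface ≃ₜ O.Surface}
    (hf : Over A f) : O.IsAffine f (Matrix.SpecialLinearGroup.map (Int.castRingHom ℝ) A) := by
  refine ⟨hf.mem_vertices_iff, fun i j z w hz hw => ?_⟩
  have hq : O.pt j w ∉ O.vertices := by rwa [← hw, hf.mem_vertices_iff]
  obtain ⟨U, hU, hqU, hinj⟩ := O.exists_injOn_toTorus hq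
  have h1 : ∀ᶠ z' in 𝓝 z, f (O.pt i z') ∈ U := by
    have hc : Continuous fun z' => f (O.pt i z') := f.continuous.comp (O.continuous_pt i)
    exact hc.continuousAt.eventually_mem (hU.mem_nhds (by rwa [hw]))
  have h2 : ∃ M ∈ 𝓝 (vec w), vec ⁻¹' M ⊆ O.pt j ⁻¹' U := by
    have : O.pt j ⁻¹' U ∈ 𝓝 w := (hU.preimage (O.continuous_pt j)).mem_nhds hqU
    rwa [isInducing_vec.nhds_eq_comap, Filter.mem_comap] at this
  obtain ⟨M, hM, hMU⟩ := h2
  set B : Matrix (Fin 2) (Fin 2) ℝ := A.1.map (Int.cast : ℤ → ℝ)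
  have h3 : ∀ᶠ z' in 𝓝 z, vec w + B.mulVec (vec z' - vec z) ∈ M := by
    have hc : Continuous fun z' => vec w + B.mulVec (vec z' - vec z) :=
      continuous_const.add (Continuous.matrix_mulVec continuous_const
        (continuous_vec.sub continuous_const))
    exact hc.continuousAt.eventually_mem (by simpa using hM)
  filter_upwards [h1, h3] with z' hz1 hz3 w' hw'
  have hw' : vec w' - vec w = B.mulVec (vec z' - vec z) := hw'
  have e : vec w' = vec w + B.mulVec (vec z' - vec z) := by rw [← hw']; abel
  refine hinj hz1 (hMU (by rwa [← e] at hz3)) ?_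
  rw [hf, toTorus_pt_eq_planeToTorus, toTorus_pt_eq_planeToTorus, e, map_add,
    ← torusAct_planeToTorus, ← toTorus_pt_eq_planeToTorus O j w, ← hw, hf,
    toTorus_pt_eq_planeToTorus, torusAct_planeToTorus, torusAct_planeToTorus,
    torusAct_planeToTorus, ← map_add, ← Matrix.mulVec_add]
  congr 2
  abel

theorem _root_.unitInterval.eventually_add_mem {x : I} (h0 : x ≠ 0) (h1 : x ≠ 1) :
    ∀ᶠ d in 𝓝 (0 : ℝ), (x : ℝ) + d ∈ I := by
  have hx : Set.Icc (0 : ℝ) 1 ∈ 𝓝 ((x : ℝ) + 0) := by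
    rw [add_zero]
    exact Icc_mem_nhds (lt_of_le_of_ne x.2.1 fun h => h0 (Subtype.ext h.symm))
      (lt_of_le_of_ne x.2.2 fun h => h1 (Subtype.ext h))
  exact (continuous_const.add continuous_id).continuousAt.eventually_mem hx

theorem _root_.unitInterval.eventually_mem_or :
    ∀ᶠ d in 𝓝 (0 : ℝ), (0 : ℝ) + d ∈ I ∨ (1 : ℝ) + d ∈ I := by
  filter_upwards [Icc_mem_nhds (show (-1 : ℝ) < 0 by norm_num) (show (0 : ℝ) < 1 by norm_num)]
    with d hd
  rcases le_total 0 d with h | h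
  · exact Or.inl ⟨by linarith, by linarith [hd.2]⟩
  · exact Or.inr ⟨by linarith [hd.1], by linarith⟩

/-- Near a point that is not a vertex, the surface is covered by at most two squares. -/
theorem exists_two_charts {q : O.Surface} (hq : q ∉ O.vertices) :
    ∃ (j : Bool → Fin n) (w : Bool → I × I), (∀ r, O.pt (j r) (w r) = q) ∧
      ∀ᶠ d in 𝓝 (0 : Fin 2 → ℝ), ∃ r w', vec w' = vec (w r) + d := by
  obtain ⟨i, ⟨x, y⟩, rfl⟩ := O.exists_pt_eq q
  have hvec (w : I × I) (d : Fin 2 → ℝ) (h1 : (w.1 : ℝ) + d 0 ∈ I) (h2 : (w.2 : ℝ) + d 1 ∈ I) :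
      ∃ w', vec w' = vec w + d :=
    ⟨(⟨_, h1⟩, ⟨_, h2⟩), by ext k; fin_cases k <;> simp [vec]⟩
  have t (k : Fin 2) : Filter.Tendsto (fun d : Fin 2 → ℝ => d k) (𝓝 0) (𝓝 0) :=
    (continuous_apply k).tendsto' _ _ rfl
  by_cases hx : x = 0 ∨ x = 1
  · by_cases hy : y = 0 ∨ y = 1
    · exact absurd ⟨i, x, y, hx, hy, rfl⟩ hq
    · rw [not_or] at hy
      obtain ⟨k, hk⟩ : ∃ k, O.pt i (x, y) = O.pt k (0, y) := by
        rcases hx with rfl | rfl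
        exacts [⟨i, rfl⟩, ⟨O.h i, O.pt_side i y⟩]
      rw [hk]
      refine ⟨fun r => bif r then k else O.h⁻¹ k, fun r => bif r then (0, y) else (1, y), ?_, ?_⟩
      · rintro (_ | _) <;> simp [pt_side]
      · filter_upwards [(t 0).eventually eventually_mem_or,
          (t 1).eventually (eventually_add_mem hy.1 hy.2)] with d h1 h2
        rcases h1 with h1 | h1
        exacts [⟨true, hvec _ _ h1 h2⟩, ⟨false, hvec _ _ h1 h2⟩]
  · rw [not_or] at hx
    by_cases hy : y = 0 ∨ y = 1
    · obtain ⟨k, hk⟩ : ∃ k, O.pt i (x, y) = O.pt k (x, 0) := by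
        rcases hy with rfl | rfl
        exacts [⟨i, rfl⟩, ⟨O.v i, O.pt_top i x⟩]
      rw [hk]
      refine ⟨fun r => bif r then k else O.v⁻¹ k, fun r => bif r then (x, 0) else (x, 1), ?_, ?_⟩
      · rintro (_ | _) <;> simp [pt_top]
      · filter_upwards [(t 1).eventually eventually_mem_or,
          (t 0).eventually (eventually_add_mem hx.1 hx.2)] with d h1 h2
        rcases h1 with h1 | h1
        exacts [⟨true, hvec _ _ h2 h1⟩, ⟨false, hvec _ _ h2 h1⟩]
    · rw [not_or] at hy
      refine ⟨fun _ => i, fun _ => (x, y), fun _ => rfl, ?_⟩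
      filter_upwards [(t 0).eventually (eventually_add_mem hx.1 hx.2),
          (t 1).eventually (eventually_add_mem hy.1 hy.2)] with d h1 h2
      exact ⟨true, hvec _ _ h1 h2⟩

/-- The open unit square. -/
def openUnitSquare : Set (I × I) := Set.Ioo 0 1 ×ˢ Set.Ioo 0 1

theorem isPreconnected_openUnitSquare : IsPreconnected openUnitSquare :=
  isPreconnected_Ioo.prod isPreconnected_Ioo

theorem dense_openUnitSquare : Dense openUnitSquare := by
  rw [dense_iff_closure_eq, openUnitSquare, closure_prod_eq, closure_Ioo zero_ne_one]
  ext z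
  exact ⟨fun _ => trivial, fun _ => ⟨⟨z.1.2.1, z.1.2.2⟩, ⟨z.2.2.1, z.2.2.2⟩⟩⟩

theorem ne_of_mem_openUnitSquare {z : I × I} (hz : z ∈ openUnitSquare) :
    (z.1 ≠ 0 ∧ z.1 ≠ 1) ∧ (z.2 ≠ 0 ∧ z.2 ≠ 1) :=
  ⟨⟨hz.1.1.ne', hz.1.2.ne⟩, ⟨hz.2.1.ne', hz.2.2.ne⟩⟩

theorem not_mem_vertices_of_mem_openUnitSquare (i : Fin n) {z : I × I} (hz : z ∈ openUnitSquare) :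
    O.pt i z ∉ O.vertices := by
  rw [mem_vertices_iff, toTorus_pt, Prod.ext_iff, not_and_or]
  left
  rw [Prod.fst_zero, coe_circle_eq_zero_iff]
  have := ne_of_mem_openUnitSquare hz
  tauto

variable {O} in
theorem IsAffine.toTorus_eq {A : Matrix.SpecialLinearGroup (Fin 2) ℝ} {f : O.Surface ≃ₜ O.Surface}
    (hf : O.IsAffine f A) (i : Fin n) (z : I × I) :
    O.toTorus (f (O.pt i z)) = planeToTorus (A.1.mulVec (vec z)) := by
  set g : I × I → UnitAddCircle × UnitAddCircle := fun z =>
    O.toTorus (f (O.pt i z)) - planeToTorus (A.1.mulVec (vec z))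
  have hg : Continuous g := by
    refine (O.continuous_toTorus.comp (f.continuous.comp (O.continuous_pt i))).sub
      (continuous_planeToTorus.comp (Continuous.matrix_mulVec continuous_const continuous_vec))
  have hloc : ∀ z ∈ openUnitSquare, ∀ᶠ z' in 𝓝 z, g z' = g z := by
    intro z hz
    have hv := O.not_mem_vertices_of_mem_openUnitSquare i hz
    obtain ⟨j, w, hj, hd⟩ := O.exists_two_charts (q := f (O.pt i z)) (by rwa [hf.1])
    have hall : ∀ᶠ z' in 𝓝 z, ∀ r, ∀ w' : I × I,
        vec w' - vec (w r) = A.1.mulVec (vec z' - vec z) → f (O.pt i z') = O.pt (j r) w' :=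
      Filter.eventually_all.2 fun r => hf.2 i (j r) z (w r) hv (hj r).symm
    have hc : Filter.Tendsto (fun z' => A.1.mulVec (vec z' - vec z)) (𝓝 z) (𝓝 0) := by
      have : Continuous fun z' => A.1.mulVec (vec z' - vec z) :=
        Continuous.matrix_mulVec continuous_const (continuous_vec.sub continuous_const)
      exact this.tendsto' _ _ (by simp)
    filter_upwards [hall, hc.eventually hd] with z' h1 h2
    obtain ⟨r, w', hw'⟩ := h2
    have e := h1 r w' (by rw [hw']; abel)
    simp only [g]
    rw [e, ← hj r, toTorus_pt_eq_planeToTorus, toTorus_pt_eq_planeToTorus, hw', ← map_sub,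
      ← map_sub, Matrix.mulVec_sub]
    congr 1
    abel
  have hcst : ∀ z ∈ openUnitSquare, ∀ z' ∈ openUnitSquare, g z = g z' := by
    have hpre : PreconnectedSpace openUnitSquare :=
      isPreconnected_iff_preconnectedSpace.1 isPreconnected_openUnitSquare
    have hlc : IsLocallyConstant fun z : openUnitSquare => g z :=
      (IsLocallyConstant.iff_eventually_eq _).2 fun z =>
        continuous_subtype_val.continuousAt.eventually (hloc z z.2)
    intro z hz z' hz'
    exact hlc.apply_eq_of_preconnectedSpace ⟨z, hz⟩ ⟨z', hz'⟩
  have hhalf : (half, half) ∈ openUnitSquare := by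
    refine ⟨⟨?_, ?_⟩, ⟨?_, ?_⟩⟩ <;> rw [← Subtype.coe_lt_coe] <;> norm_num [half]
  have hall : ∀ z, g z = g (half, half) := fun z =>
    congrFun (Continuous.ext_on dense_openUnitSquare hg continuous_const
      fun z hz => hcst z hz _ hhalf) z
  have h0 : g (0, 0) = 0 := by
    have : O.toTorus (f (O.pt i (0, 0))) = 0 := by
      rw [← mem_vertices_iff, hf.1]
      exact ⟨i, 0, 0, Or.inl rfl, Or.inl rfl, rfl⟩
    simp only [g, this]
    have : vec (0, 0) = 0 := by ext k; fin_cases k <;> simp [vec]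
    simp [this]
  have := hall z
  rw [← hall (0, 0), h0] at this
  exact sub_eq_zero.1 this

variable {O} in
/-- The derivative of an affine homeomorphism is integral, and it acts on the torus below. -/
theorem IsAffine.exists_over {A : Matrix.SpecialLinearGroup (Fin 2) ℝ}
    {f : O.Surface ≃ₜ O.Surface} (hf : O.IsAffine f A) (i : Fin n) :
    ∃ B : Matrix.SpecialLinearGroup (Fin 2) ℤ,
      Matrix.SpecialLinearGroup.map (Int.castRingHom ℝ) B = A ∧ Over B f := by
  have hAint (k l : Fin 2) : ∃ m : ℤ, (m : ℝ) = A.1 k l := by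
    have hz : ∃ z : I × I, (z.1 = 0 ∨ z.1 = 1) ∧ (z.2 = 0 ∨ z.2 = 1) ∧ vec z = Pi.single l 1 := by
      fin_cases l
      · exact ⟨(1, 0), by simp, by simp, by ext k; fin_cases k <;> simp [vec]⟩
      · exact ⟨(0, 1), by simp, by simp, by ext k; fin_cases k <;> simp [vec]⟩
    obtain ⟨z, h1, h2, hz⟩ := hz
    have h := hf.toTorus_eq i z
    rw [hz, Matrix.mulVec_single_one, (O.mem_vertices_iff _).1 ((hf.1 _).2
      ⟨i, z.1, z.2, h1, h2, rfl⟩)] at h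
    have hk : ((A.1 k l : ℝ) : UnitAddCircle) = 0 := by
      rw [eq_comm, Prod.ext_iff] at h
      fin_cases k
      exacts [h.1, h.2]
    obtain ⟨m, hm⟩ := AddCircle.coe_eq_zero_iff _ |>.1 hk
    exact ⟨m, by simpa using hm⟩
  choose B hB using hAint
  have hBA : (Matrix.of B).map (Int.cast : ℤ → ℝ) = A.1 := by
    ext k l
    simp [hB]
  have hdet : (Matrix.of B).det = 1 := by
    have h := A.2
    rw [← hBA] at h
    have h2 : ((Matrix.of B).det : ℝ) = 1 := by
      rw [← h]
      exact (Int.castRingHom ℝ).map_det _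
    exact_mod_cast h2
  refine ⟨⟨Matrix.of B, hdet⟩, Subtype.ext hBA, fun q => ?_⟩
  obtain ⟨k, z, rfl⟩ := O.exists_pt_eq q
  rw [hf.toTorus_eq, toTorus_pt_eq_planeToTorus, torusAct_planeToTorus, hBA]

end Origami

namespace Origami

variable {n : ℕ}

/-! ### Homeomorphisms over the torus -/

theorem half_mem_openUnitSquare : (half, half) ∈ openUnitSquare := by
  refine ⟨⟨?_, ?_⟩, ⟨?_, ?_⟩⟩ <;> rw [← Subtype.coe_lt_coe] <;> norm_num [half]

theorem half_ne : half ≠ 0 ∧ half ≠ 1 := (ne_of_mem_openUnitSquare half_mem_openUnitSquare).1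

/-- A homeomorphism over the torus maps open squares to open squares. -/
theorem Over.exists_square {O O' : Origami n} {f : O.Surface ≃ₜ O'.Surface} (hf : Over 1 f)
    (i : Fin n) : ∃ j, ∀ z ∈ openUnitSquare, f (O.pt i z) = O'.pt j z := by
  have hfp (q) : O'.toTorus (f q) = O.toTorus q := (hf q).trans (torusAct_one _)
  have hrep : ∀ z ∈ openUnitSquare, ∃ j, f (O.pt i z) = O'.pt j z := by
    intro z hz
    obtain ⟨j, w, hw⟩ := O'.exists_pt_eq (f (O.pt i z))
    obtain ⟨hz1, hz2⟩ := ne_of_mem_openUnitSquare hz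
    have h := hfp (O.pt i z)
    rw [← hw, toTorus_pt, toTorus_pt, Prod.ext_iff] at h
    refine ⟨j, ?_⟩
    rw [← hw]
    congr 1
    refine Prod.ext ?_ ?_
    · rcases coe_circle_eq_coe h.1 with h | h | h
      exacts [h, absurd h.2 hz1.2, absurd h.2 hz1.1]
    · rcases coe_circle_eq_coe h.2 with h | h | h
      exacts [h, absurd h.2 hz2.2, absurd h.2 hz2.1]
  obtain ⟨j, hj⟩ := hrep _ half_mem_openUnitSquare
  refine ⟨j, fun z hz => ?_⟩
  have hc : Continuous fun z => f (O.pt i z) := f.continuous.comp (O.continuous_pt i)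
  have hsub : openUnitSquare ⊆ (fun z => f (O.pt i z)) ⁻¹' O'.openSquare j := by
    refine IsPreconnected.subset_left_of_subset_union
      ((O'.isOpen_openSquare j).preimage hc)
      ((isOpen_biUnion (s := {k | k ≠ j}) fun k _ => O'.isOpen_openSquare k).preimage hc) ?_ ?_ ?_
      isPreconnected_openUnitSquare
    · rw [Set.disjoint_left]
      intro z h1 h2
      rw [Set.mem_preimage, Set.mem_iUnion₂] at h2
      obtain ⟨k, hk, h2⟩ := h2
      rw [Set.mem_preimage] at h1
      obtain ⟨l, w, hw⟩ := O'.exists_pt_eq (f (O.pt i z))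
      rw [← hw, pt_mem_openSquare] at h1 h2
      exact hk (h2.1.symm.trans h1.1)
    · intro z hz
      obtain ⟨k, hk⟩ := hrep z hz
      have hm : f (O.pt i z) ∈ O'.openSquare k := by
        rw [hk, pt_mem_openSquare]
        exact ⟨rfl, ne_of_mem_openUnitSquare hz⟩
      by_cases hkj : k = j
      · subst hkj
        exact Or.inl hm
      · exact Or.inr (Set.mem_iUnion₂.2 ⟨k, hkj, hm⟩)
    · refine ⟨_, half_mem_openUnitSquare, ?_⟩
      change f _ ∈ O'.openSquare j
      rw [hj, pt_mem_openSquare]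
      exact ⟨rfl, ne_of_mem_openUnitSquare half_mem_openUnitSquare⟩
  obtain ⟨k, hk⟩ := hrep z hz
  have h := hsub hz
  rw [Set.mem_preimage, hk, pt_mem_openSquare] at h
  rw [hk, h.1]

theorem frequently_mem_Ioo {l : Filter I} {a : I} (ha : 𝓝 a = l) :
    ∃ᶠ x in l, x ∈ Set.Ioo (0 : I) 1 := by
  subst ha
  rw [← mem_closure_iff_frequently, closure_Ioo zero_ne_one]
  exact ⟨a.2.1, a.2.2⟩

/-- A homeomorphism over the torus is given by a relabelling of the squares. -/
theorem Over.exists_relabelling {O O' : Origami n} {f : O.Surface ≃ₜ O'.Surface}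
    (hf : Over 1 f) : ∃ π : Fin n → Fin n, Function.Injective π ∧
      (∀ i, π (O.h i) = O'.h (π i)) ∧ ∀ i, π (O.v i) = O'.v (π i) := by
  choose π hπ using hf.exists_square
  have hfp (q) : O'.toTorus (f q) = O.toTorus q := (hf q).trans (torusAct_one _)
  have hm {x : I} (hx : x ∈ Set.Ioo (0 : I) 1) :
      (x, half) ∈ openUnitSquare ∧ (half, x) ∈ openUnitSquare :=
    ⟨⟨hx, half_mem_openUnitSquare.2⟩, ⟨half_mem_openUnitSquare.1, hx⟩⟩
  have hc (i : Fin n) : Continuous fun z => f (O.pt i z) := f.continuous.comp (O.continuous_pt i)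
  refine ⟨π, fun i k hik => ?_, fun i => ?_, fun i => ?_⟩
  · have h := hπ i _ half_mem_openUnitSquare
    rw [hik, ← hπ k _ half_mem_openUnitSquare] at h
    have h2 : O.pt k (half, half) ∈ O.openSquare k :=
      ⟨rfl, ne_of_mem_openUnitSquare half_mem_openUnitSquare⟩
    rw [← f.injective h, pt_mem_openSquare] at h2
    exact h2.1
  · obtain ⟨k, hk⟩ : ∃ k, f (O.pt i (1, half)) ∈ O'.leftNbhd k := by
      have h := hfp (O.pt i (1, half))
      obtain ⟨l, w, hw⟩ := O'.exists_pt_eq (f (O.pt i (1, half)))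
      rw [← hw, toTorus_pt, toTorus_pt, Prod.ext_iff] at h
      rw [← hw]
      simp only [pt_mem_leftNbhd]
      have hw2 : w.2 = half := by
        rcases coe_circle_eq_coe h.2 with h | h | h
        exacts [h, absurd h.2 half_ne.2, absurd h.2 half_ne.1]
      have hw1 : w.1 = 0 ∨ w.1 = 1 := by
        rw [← coe_circle_eq_zero_iff]
        exact h.1.trans (coe_circle_eq_zero_iff.2 (Or.inr rfl))
      rw [hw2]
      rcases hw1 with hw1 | hw1 <;> rw [hw1]
      · exact ⟨l, Or.inl ⟨rfl, by norm_num⟩, half_ne⟩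
      · exact ⟨O'.h l, Or.inr ⟨rfl, by norm_num⟩, half_ne⟩
    have e1 : O'.h (π i) = k := by
      have hev : ∀ᶠ x in 𝓝 (1 : I), f (O.pt i (x, half)) ∈ O'.leftNbhd k ∧ (1 / 4 : ℝ) < x :=
        (((hc i).comp (Continuous.prodMk_left half)).continuousAt.eventually_mem
          ((O'.isOpen_leftNbhd k).mem_nhds hk)).and
          (continuous_subtype_val.continuousAt.eventually (lt_mem_nhds (by norm_num)))
      obtain ⟨x, hx, h1, h2⟩ := ((frequently_mem_Ioo rfl).and_eventually hev).exists
      rw [hπ i _ (hm hx).1, pt_mem_leftNbhd] at h1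
      rcases h1.1 with h | h
      · exact absurd h.2 (not_lt.2 h2.le)
      · exact h.1
    have e2 : π (O.h i) = k := by
      have hev : ∀ᶠ x in 𝓝 (0 : I), f (O.pt (O.h i) (x, half)) ∈ O'.leftNbhd k ∧ (x : ℝ) < 3 / 4 :=
        (((hc (O.h i)).comp (Continuous.prodMk_left half)).continuousAt.eventually_mem
          ((O'.isOpen_leftNbhd k).mem_nhds (by
            change f (O.pt (O.h i) (0, half)) ∈ _
            rwa [← pt_side]))).and
          (continuous_subtype_val.continuousAt.eventually (gt_mem_nhds (by norm_num)))
      obtain ⟨x, hx, h1, h2⟩ := ((frequently_mem_Ioo rfl).and_eventually hev).exists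
      rw [hπ (O.h i) _ (hm hx).1, pt_mem_leftNbhd] at h1
      rcases h1.1 with h | h
      · exact h.1
      · exact absurd h.2 (not_lt.2 h2.le)
    rw [e1, e2]
  · obtain ⟨k, hk⟩ : ∃ k, f (O.pt i (half, 1)) ∈ O'.bottomNbhd k := by
      have h := hfp (O.pt i (half, 1))
      obtain ⟨l, w, hw⟩ := O'.exists_pt_eq (f (O.pt i (half, 1)))
      rw [← hw, toTorus_pt, toTorus_pt, Prod.ext_iff] at h
      rw [← hw]
      simp only [pt_mem_bottomNbhd]
      have hw2 : w.1 = half := by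
        rcases coe_circle_eq_coe h.1 with h | h | h
        exacts [h, absurd h.2 half_ne.2, absurd h.2 half_ne.1]
      have hw1 : w.2 = 0 ∨ w.2 = 1 := by
        rw [← coe_circle_eq_zero_iff]
        exact h.2.trans (coe_circle_eq_zero_iff.2 (Or.inr rfl))
      rw [hw2]
      rcases hw1 with hw1 | hw1 <;> rw [hw1]
      · exact ⟨l, Or.inl ⟨rfl, by norm_num⟩, half_ne⟩
      · exact ⟨O'.v l, Or.inr ⟨rfl, by norm_num⟩, half_ne⟩
    have e1 : O'.v (π i) = k := by
      have hev : ∀ᶠ x in 𝓝 (1 : I), f (O.pt i (half, x)) ∈ O'.bottomNbhd k ∧ (1 / 4 : ℝ) < x :=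
        (((hc i).comp (Continuous.prodMk_right half)).continuousAt.eventually_mem
          ((O'.isOpen_bottomNbhd k).mem_nhds hk)).and
          (continuous_subtype_val.continuousAt.eventually (lt_mem_nhds (by norm_num)))
      obtain ⟨x, hx, h1, h2⟩ := ((frequently_mem_Ioo rfl).and_eventually hev).exists
      rw [hπ i _ (hm hx).2, pt_mem_bottomNbhd] at h1
      rcases h1.1 with h | h
      · exact absurd h.2 (not_lt.2 h2.le)
      · exact h.1
    have e2 : π (O.v i) = k := by
      have hev : ∀ᶠ x in 𝓝 (0 : I),
          f (O.pt (O.v i) (half, x)) ∈ O'.bottomNbhd k ∧ (x : ℝ) < 3 / 4 :=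
        (((hc (O.v i)).comp (Continuous.prodMk_right half)).continuousAt.eventually_mem
          ((O'.isOpen_bottomNbhd k).mem_nhds (by
            change f (O.pt (O.v i) (half, 0)) ∈ _
            rwa [← pt_top]))).and
          (continuous_subtype_val.continuousAt.eventually (gt_mem_nhds (by norm_num)))
      obtain ⟨x, hx, h1, h2⟩ := ((frequently_mem_Ioo rfl).and_eventually hev).exists
      rw [hπ (O.v i) _ (hm hx).2, pt_mem_bottomNbhd] at h1
      rcases h1.1 with h | h
      · exact h.1
      · exact absurd h.2 (not_lt.2 h2.le)
    rw [e1, e2]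

/-! ### Holonomy and affine homeomorphisms -/

theorem _root_.SingularHomology.classLinearMap_ext {X : Type} [TopologicalSpace X] {M : Type*}
    [AddCommGroup M] [Module ℝ M] {L L' : ChainClass X →ₗ[ℝ] M}
    (h : ∀ γ : C(I, X), L (pathClass γ) = L' (pathClass γ)) : L = L' := by
  refine Submodule.linearMap_qext _ (chain_linearMap_ext fun s => ?_)
  obtain ⟨γ, rfl⟩ := exists_pathSimplex_eq s
  exact h γ

theorem _root_.SingularHomology.incClass_classMap_of_eq {X Y : Type} [TopologicalSpace X]
    [TopologicalSpace Y] (f : C(X, Y)) (θ : C(Y, UnitAddCircle)) (θ₁ θ₂ : C(X, UnitAddCircle))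
    (a b : ℤ) (h : ∀ x, θ (f x) = a • θ₁ x + b • θ₂ x) (c : ChainClass X) :
    incClass θ (classMap f c) = a * incClass θ₁ c + b * incClass θ₂ c := by
  suffices incClass θ ∘ₗ classMap f = (a : ℝ) • incClass θ₁ + (b : ℝ) • incClass θ₂ from
    LinearMap.congr_fun this c
  refine classLinearMap_ext fun γ => ?_
  obtain ⟨l₁, h₁⟩ := exists_lift_path (θ₁.comp γ)
  obtain ⟨l₂, h₂⟩ := exists_lift_path (θ₂.comp γ)
  rw [LinearMap.comp_apply, classMap_pathClass, LinearMap.add_apply, LinearMap.smul_apply,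
    LinearMap.smul_apply, incClass_pathClass θ₁ γ l₁ h₁, incClass_pathClass θ₂ γ l₂ h₂,
    incClass_pathClass θ (f.comp γ) (a • l₁ + b • l₂)]
  · simp
    ring
  · intro t
    rw [ContinuousMap.comp_apply, h, ContinuousMap.add_apply, ContinuousMap.smul_apply,
      ContinuousMap.smul_apply, AddCircle.coe_add, AddCircle.coe_zsmul, AddCircle.coe_zsmul, h₁, h₂]
    rfl

theorem Over.H1map_mem_zeroHolonomy {O O' : Origami n} {A : Matrix.SpecialLinearGroup (Fin 2) ℤ}
    {f : O.Surface ≃ₜ O'.Surface} (hf : Over A f) {c : H1 O.Surface} (hc : c ∈ O.zeroHolonomy) :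
    H1map (f : C(O.Surface, O'.Surface)) c ∈ O'.zeroHolonomy := by
  rw [mem_zeroHolonomy_iff] at hc ⊢
  rw [H1incl_H1map,
    incClass_classMap_of_eq (f : C(O.Surface, O'.Surface)) O'.torusFst O.torusFst O.torusSnd
      (A 0 0) (A 0 1) fun q => congrArg Prod.fst (hf q),
    incClass_classMap_of_eq (f : C(O.Surface, O'.Surface)) O'.torusSnd O.torusFst O.torusSnd
      (A 1 0) (A 1 1) fun q => congrArg Prod.snd (hf q), hc.1, hc.2]
  simp

end Origami

namespace Origami

variable {n : ℕ}

/-! ### Homeomorphisms with a known action on the edges -/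

/-- `f` covers the matrix `A` and acts as `F` on cellular chains. -/
structure ActsAs {O O' : Origami n} (f : O.Surface ≃ₜ O'.Surface)
    (A : Matrix.SpecialLinearGroup (Fin 2) ℤ) (F : Edges n → Edges n) : Prop where
  covers : Over A f
  edges : ∀ x, classMap (f : C(O.Surface, O'.Surface)) (O.edgeClass x) = O'.edgeClass (F x)

theorem _root_.SingularHomology.classMap_comp {X Y Z : Type} [TopologicalSpace X]
    [TopologicalSpace Y] [TopologicalSpace Z] (g : C(Y, Z)) (f : C(X, Y)) (c : ChainClass X) :
    classMap (g.comp f) c = classMap g (classMap f c) := by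
  suffices classMap (g.comp f) = classMap g ∘ₗ classMap f from LinearMap.congr_fun this c
  refine classLinearMap_ext fun γ => ?_
  rw [LinearMap.comp_apply, classMap_pathClass, classMap_pathClass, classMap_pathClass]
  rfl

theorem _root_.SingularHomology.classMap_id {X : Type} [TopologicalSpace X] (c : ChainClass X) :
    classMap (ContinuousMap.id X) c = c := by
  suffices classMap (ContinuousMap.id X) = LinearMap.id from LinearMap.congr_fun this c
  refine classLinearMap_ext fun γ => ?_
  rw [classMap_pathClass]
  rfl

theorem ActsAs.trans {O O' O'' : Origami n} {f : O.Surface ≃ₜ O'.Surface}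
    {g : O'.Surface ≃ₜ O''.Surface} {A B : Matrix.SpecialLinearGroup (Fin 2) ℤ}
    {F G : Edges n → Edges n} (hf : ActsAs f A F) (hg : ActsAs g B G) :
    ActsAs (f.trans g) (B * A) (G ∘ F) where
  covers := hg.covers.comp hf.covers
  edges x := by
    have e : (f.trans g : C(O.Surface, O''.Surface)) =
      (g : C(O'.Surface, O''.Surface)).comp (f : C(O.Surface, O'.Surface)) := rfl
    rw [Function.comp_apply, ← hg.edges, ← hf.edges, e, classMap_comp]

theorem ActsAs.symm {O O' : Origami n} {f : O.Surface ≃ₜ O'.Surface}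
    {A : Matrix.SpecialLinearGroup (Fin 2) ℤ} {F G : Edges n → Edges n} (hf : ActsAs f A F)
    (hFG : ∀ x, F (G x) = x) : ActsAs f.symm A⁻¹ G where
  covers := hf.covers.symm
  edges x := by
    have h := hf.edges (G x)
    rw [hFG] at h
    rw [← h, ← classMap_comp]
    have : (f.symm : C(O'.Surface, O.Surface)).comp (f : C(O.Surface, O'.Surface)) =
        ContinuousMap.id _ := by
      ext q
      simp
    rw [this, classMap_id]

/-! ### Relabelling -/

/-- The homeomorphism of an isomorphism of gluing data. -/
noncomputable def relabel (O O' : Origami n) (π : Equiv.Perm (Fin n))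
    (hh : ∀ i, π (O.h i) = O'.h (π i)) (hv : ∀ i, π (O.v i) = O'.v (π i)) :
    O.Surface ≃ₜ O'.Surface where
  toFun := O.lift (fun i z => O'.pt (π i) z) (fun i y => by rw [pt_side, hh])
    (fun i x => by rw [pt_top, hv])
  invFun := O'.lift (fun i z => O.pt (π.symm i) z)
    (fun i y => by
      rw [pt_side]
      congr 1
      rw [Equiv.eq_symm_apply, hh, Equiv.apply_symm_apply])
    (fun i x => by
      rw [pt_top]
      congr 1
      rw [Equiv.eq_symm_apply, hv, Equiv.apply_symm_apply])
  left_inv q := by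
    obtain ⟨i, z, rfl⟩ := O.exists_pt_eq q
    simp
  right_inv q := by
    obtain ⟨i, z, rfl⟩ := O'.exists_pt_eq q
    simp
  continuous_toFun := O.continuous_of_pt fun i => O'.continuous_pt (π i)
  continuous_invFun := O'.continuous_of_pt fun i => O.continuous_pt (π.symm i)

theorem relabel_pt (O O' : Origami n) (π : Equiv.Perm (Fin n)) (hh hv) (i : Fin n) (z : I × I) :
    relabel O O' π hh hv (O.pt i z) = O'.pt (π i) z := rfl

/-- The action of a relabelling on cellular chains. -/
def relabelEdges {R : Type} (π : Equiv.Perm (Fin n)) (x : Edges n R) : Edges n R :=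
  (fun i => x.1 (π⁻¹ i), fun i => x.2 (π⁻¹ i))

theorem classMap_lineClass {O O' : Origami n} (f : C(O.Surface, O'.Surface)) {i j : Fin n}
    {z w z' w' : I × I} (h : ∀ t, f (O.pt i (line z w t)) = O'.pt j (line z' w' t)) :
    classMap f (O.lineClass i z w) = O'.lineClass j z' w' := by
  rw [lineClass, classMap_pathClass]
  exact congrArg pathClass (ContinuousMap.ext h)

theorem actsAs_relabel (O O' : Origami n) (π : Equiv.Perm (Fin n)) (hh hv) :
    ActsAs (relabel O O' π hh hv) 1 (relabelEdges π) where
  covers q := by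
    obtain ⟨i, z, rfl⟩ := O.exists_pt_eq q
    rw [relabel_pt, toTorus_pt, toTorus_pt]
    exact (torusAct_one _).symm
  edges x := by
    have hb (i : Fin n) : classMap (relabel O O' π hh hv : C(O.Surface, O'.Surface)) (O.bottom i) =
        O'.bottom (π i) := classMap_lineClass _ fun t => relabel_pt _ _ _ _ _ _ _
    have hl (i : Fin n) : classMap (relabel O O' π hh hv : C(O.Surface, O'.Surface)) (O.left i) =
        O'.left (π i) := classMap_lineClass _ fun t => relabel_pt _ _ _ _ _ _ _
    rw [edgeClass_apply, edgeClass_apply, map_add, map_sum, map_sum]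
    simp only [map_smul, hb, hl, relabelEdges]
    rw [← Equiv.sum_comp π fun i => x.1 (π⁻¹ i) • O'.bottom i,
      ← Equiv.sum_comp π fun i => x.2 (π⁻¹ i) • O'.left i]
    simp

/-! ### Reflection -/

/-- The reflection of a square-tiled surface in the diagonal. -/
def swap (O : Origami n) : Origami n := ⟨O.v, O.h⟩

/-- The reflection in the diagonal. -/
noncomputable def reflect (O : Origami n) : O.Surface ≃ₜ O.swap.Surface where
  toFun := O.lift (fun i z => O.swap.pt i (z.2, z.1)) (fun i y => O.swap.pt_top i y)
    (fun i x => O.swap.pt_side i x)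
  invFun := O.swap.lift (fun i z => O.pt i (z.2, z.1)) (fun i y => O.pt_top i y)
    (fun i x => O.pt_side i x)
  left_inv q := by
    obtain ⟨i, z, rfl⟩ := O.exists_pt_eq q
    rfl
  right_inv q := by
    obtain ⟨i, z, rfl⟩ := O.swap.exists_pt_eq q
    rfl
  continuous_toFun := O.continuous_of_pt fun i => (O.swap.continuous_pt _).comp continuous_swap
  continuous_invFun := O.swap.continuous_of_pt fun i => (O.continuous_pt _).comp continuous_swap

theorem reflect_pt (O : Origami n) (i : Fin n) (z : I × I) :
    O.reflect (O.pt i z) = O.swap.pt i (z.2, z.1) := rfl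

theorem toTorus_reflect (O : Origami n) (q : O.Surface) :
    O.swap.toTorus (O.reflect q) = (O.toTorus q).swap := by
  obtain ⟨i, z, rfl⟩ := O.exists_pt_eq q
  rfl

theorem classMap_reflect (O : Origami n) (x : Edges n) :
    classMap (O.reflect : C(O.Surface, O.swap.Surface)) (O.edgeClass x) =
      O.swap.edgeClass x.swap := by
  have hb (i : Fin n) : classMap (O.reflect : C(O.Surface, O.swap.Surface)) (O.bottom i) =
      O.swap.left i := classMap_lineClass _ fun t => reflect_pt _ _ _
  have hl (i : Fin n) : classMap (O.reflect : C(O.Surface, O.swap.Surface)) (O.left i) =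
      O.swap.bottom i := classMap_lineClass _ fun t => reflect_pt _ _ _
  rw [edgeClass_apply, edgeClass_apply, map_add, map_sum, map_sum]
  simp only [map_smul, hb, hl]
  rw [add_comm]
  rfl

/-! ### Shears -/

/-- The image of a point of the square `i` under the shear `(x, y) ↦ (x + y, y)`. -/
noncomputable def shearPt (O : Origami n) (i : Fin n) (z : I × I) : O.T.Surface :=
  if (z.1 + z.2 : ℝ) ≤ 1 then O.T.pt i (Set.projIcc 0 1 zero_le_one (z.1 + z.2 : ℝ), z.2)
  else O.T.pt (O.h i) (Set.projIcc 0 1 zero_le_one (z.1 + z.2 - 1 : ℝ), z.2)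

theorem shearPt_eq (O : Origami n) (i : Fin n) (x y u : I) (h : (u : ℝ) = x + y) :
    O.shearPt i (x, y) = O.T.pt i (u, y) := by
  rw [shearPt, if_pos (h ▸ u.2.2), ← h]
  simp

theorem shearPt_eq' (O : Origami n) (i : Fin n) (x y u : I) (h : (u : ℝ) = x + y - 1) :
    O.shearPt i (x, y) = O.T.pt (O.h i) (u, y) := by
  by_cases hu : u = 0
  · have h1 : ((1 : I) : ℝ) = x + y := by
      rw [hu] at h
      simp at h ⊢
      linarith
    rw [O.shearPt_eq i x y 1 h1, hu]
    exact O.T.pt_side i y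
  · have : (0 : ℝ) < u := lt_of_le_of_ne u.2.1 fun e => hu (Subtype.ext e.symm)
    rw [shearPt, if_neg (by dsimp only; linarith)]
    dsimp only
    rw [← h]
    simp

theorem continuous_shearPt (O : Origami n) (i : Fin n) : Continuous (O.shearPt i) := by
  refine Continuous.if_le ?_ ?_ (by fun_prop) continuous_const fun z hz => ?_
  · exact (O.T.continuous_pt i).comp ((continuous_projIcc.comp (by fun_prop)).prodMk continuous_snd)
  · exact (O.T.continuous_pt _).comp ((continuous_projIcc.comp (by fun_prop)).prodMk continuous_snd)
  · rw [hz]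
    simp only [Set.projIcc_right, sub_self, Set.projIcc_left]
    exact O.T.pt_side i z.2

/-- The image of a point of the square `i` under the inverse shear `(x, y) ↦ (x - y, y)`. -/
noncomputable def unshearPt (O : Origami n) (i : Fin n) (z : I × I) : O.Surface :=
  if (z.2 : ℝ) ≤ z.1 then O.pt i (Set.projIcc 0 1 zero_le_one (z.1 - z.2 : ℝ), z.2)
  else O.pt (O.h⁻¹ i) (Set.projIcc 0 1 zero_le_one (z.1 - z.2 + 1 : ℝ), z.2)

theorem unshearPt_eq (O : Origami n) (i : Fin n) (x y u : I) (h : (u : ℝ) = x - y) :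
    O.unshearPt i (x, y) = O.pt i (u, y) := by
  have := u.2.1
  rw [unshearPt, if_pos (by dsimp only; linarith), ← h]
  simp

theorem unshearPt_eq' (O : Origami n) (i : Fin n) (x y u : I) (h : (u : ℝ) = x - y + 1) :
    O.unshearPt i (x, y) = O.pt (O.h⁻¹ i) (u, y) := by
  by_cases hu : u = 1
  · have h1 : ((0 : I) : ℝ) = x - y := by
      rw [hu] at h
      simp at h ⊢
      linarith
    rw [O.unshearPt_eq i x y 0 h1, hu, pt_side]
    simp
  · have : (u : ℝ) < 1 := lt_of_le_of_ne u.2.2 fun e => hu (Subtype.ext e)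
    rw [unshearPt, if_neg (by dsimp only; linarith)]
    dsimp only
    rw [← h]
    simp

theorem continuous_unshearPt (O : Origami n) (i : Fin n) : Continuous (O.unshearPt i) := by
  refine Continuous.if_le ?_ ?_ (by fun_prop) (by fun_prop) fun z hz => ?_
  · exact (O.continuous_pt i).comp ((continuous_projIcc.comp (by fun_prop)).prodMk continuous_snd)
  · exact (O.continuous_pt _).comp ((continuous_projIcc.comp (by fun_prop)).prodMk continuous_snd)
  · rw [hz]
    simp [pt_side]

/-- The affine homeomorphism with derivative `T`. -/
noncomputable def shear (O : Origami n) : O.Surface ≃ₜ O.T.Surface where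
  toFun := O.lift O.shearPt
    (fun i y => by
      rw [O.shearPt_eq' i 1 y y (by simp), O.shearPt_eq (O.h i) 0 y y (by simp)])
    (fun i x => by
      rw [O.shearPt_eq' i x 1 x (by simp), O.shearPt_eq (O.v i) x 0 x (by simp), pt_top]
      simp [T])
  invFun := O.T.lift O.unshearPt
    (fun i y => by
      rw [O.unshearPt_eq i 1 y (σ y) (by simp), O.unshearPt_eq' (O.T.h i) 0 y (σ y) (by
        simp; ring)]
      simp [T])
    (fun i x => by
      rw [O.unshearPt_eq' i x 1 x (by simp), O.unshearPt_eq (O.T.v i) x 0 x (by simp), pt_top]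
      simp [T])
  left_inv q := by
    obtain ⟨i, ⟨x, y⟩, rfl⟩ := O.exists_pt_eq q
    change O.T.lift O.unshearPt _ _ (O.shearPt i (x, y)) = _
    rcases le_total ((x : ℝ) + y) 1 with h | h
    · rw [O.shearPt_eq i x y ⟨x + y, add_nonneg x.2.1 y.2.1, h⟩ rfl, lift_pt,
        O.unshearPt_eq _ _ _ x (by simp)]
    · rw [O.shearPt_eq' i x y ⟨x + y - 1, by linarith, by linarith [x.2.2, y.2.2]⟩ rfl, lift_pt,
        O.unshearPt_eq' _ _ _ x (by simp; ring)]
      simp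
  right_inv q := by
    obtain ⟨i, ⟨x, y⟩, rfl⟩ := O.T.exists_pt_eq q
    change O.lift O.shearPt _ _ (O.unshearPt i (x, y)) = _
    rcases le_total (y : ℝ) x with h | h
    · rw [O.unshearPt_eq i x y ⟨x - y, by linarith, by linarith [x.2.2, y.2.1]⟩ rfl, lift_pt,
        O.shearPt_eq _ _ _ x (by simp)]
    · rw [O.unshearPt_eq' i x y ⟨x - y + 1, by linarith [x.2.1, y.2.2], by linarith⟩ rfl, lift_pt,
        O.shearPt_eq' _ _ _ x (by simp; ring)]
      simp
  continuous_toFun := O.continuous_of_pt O.continuous_shearPt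
  continuous_invFun := O.T.continuous_of_pt O.continuous_unshearPt

theorem shear_pt (O : Origami n) (i : Fin n) (z : I × I) :
    O.shear (O.pt i z) = O.shearPt i z := rfl

theorem toTorus_shear (O : Origami n) (q : O.Surface) :
    O.T.toTorus (O.shear q) = ((O.toTorus q).1 + (O.toTorus q).2, (O.toTorus q).2) := by
  obtain ⟨i, ⟨x, y⟩, rfl⟩ := O.exists_pt_eq q
  rw [shear_pt]
  rcases le_total ((x : ℝ) + y) 1 with h | h
  · rw [O.shearPt_eq i x y ⟨x + y, add_nonneg x.2.1 y.2.1, h⟩ rfl]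
    simp
  · rw [O.shearPt_eq' i x y ⟨x + y - 1, by linarith, by linarith [x.2.2, y.2.2]⟩ rfl]
    simp [AddCircle.coe_period]

/-- The action of the shear `T` on cellular chains. -/
def shearEdges {R : Type} [Add R] (h : Equiv.Perm (Fin n)) (x : Edges n R) : Edges n R :=
  (fun i => x.1 i + x.2 i, fun i => x.2 (h⁻¹ i))

theorem classMap_shear (O : Origami n) (x : Edges n) :
    classMap (O.shear : C(O.Surface, O.T.Surface)) (O.edgeClass x) =
      O.T.edgeClass (shearEdges O.h x) := by
  have hb (i : Fin n) : classMap (O.shear : C(O.Surface, O.T.Surface)) (O.bottom i) =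
      O.T.bottom i := by
    refine classMap_lineClass _ fun t => ?_
    refine (O.shear_pt _ _).trans ?_
    simp only [line_apply, comb_zero_one, comb_self]
    rw [O.shearPt_eq i t 0 t (by simp)]
  have hl (i : Fin n) : classMap (O.shear : C(O.Surface, O.T.Surface)) (O.left i) =
      O.T.bottom i + O.T.left (O.h i) := by
    rw [bottom, left, show O.T.left (O.h i) = O.T.lineClass i (1, 0) (1, 1) from
      (O.T.lineClass_side i 0 1).symm, lineClass_add]
    refine classMap_lineClass _ fun t => ?_
    refine (O.shear_pt _ _).trans ?_
    simp only [line_apply, comb_zero_one, comb_self]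
    rw [O.shearPt_eq i 0 t t (by simp)]
  rw [edgeClass_apply, edgeClass_apply, map_add, map_sum, map_sum]
  simp only [map_smul, hb, hl, shearEdges, smul_add, add_smul, Finset.sum_add_distrib]
  rw [← Equiv.sum_comp O.h fun i => x.2 (O.h⁻¹ i) • O.T.left i]
  simp [add_assoc]

/-- The matrix `T`. -/
def matT : Matrix.SpecialLinearGroup (Fin 2) ℤ := ⟨!![1, 1; 0, 1], by simp [Matrix.det_fin_two]⟩

/-- The matrix `S`. -/
def matS : Matrix.SpecialLinearGroup (Fin 2) ℤ := ⟨!![1, 0; 1, 1], by simp [Matrix.det_fin_two]⟩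

theorem actsAs_shear (O : Origami n) : ActsAs O.shear matT (shearEdges O.h) where
  covers q := by
    rw [toTorus_shear]
    simp [torusAct, matT]
  edges := O.classMap_shear

/-- The affine homeomorphism with derivative `S`. -/
noncomputable def shearUp (O : Origami n) : O.Surface ≃ₜ O.S.Surface :=
  (O.reflect.trans O.swap.shear).trans O.swap.T.reflect

/-- The action of the shear `S` on cellular chains. -/
def shearUpEdges {R : Type} [Add R] (v : Equiv.Perm (Fin n)) (x : Edges n R) : Edges n R :=
  (shearEdges v x.swap).swap

theorem actsAs_shearUp (O : Origami n) : ActsAs O.shearUp matS (shearUpEdges O.v) where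
  covers q := by
    change O.swap.T.swap.toTorus (O.swap.T.reflect (O.swap.shear (O.reflect q))) = _
    rw [toTorus_reflect, toTorus_shear, toTorus_reflect]
    simp [torusAct, matS, add_comm]
  edges x := by
    have h1 := O.swap.T.classMap_reflect (shearEdges O.v x.swap)
    have h2 := O.swap.classMap_shear x.swap
    have h3 := O.classMap_reflect x
    refine Eq.trans ?_ h1
    rw [show O.swap.T.edgeClass (shearEdges O.v x.swap) = _ from h2.symm, ← h3, ← classMap_comp,
      ← classMap_comp]
    rfl

/-- The action of `T⁻¹` on square-tiled surfaces. -/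
def unT (O : Origami n) : Origami n := ⟨O.h, O.v * O.h⟩

/-- The affine homeomorphism with derivative `T⁻¹`. -/
noncomputable def unshear (O : Origami n) : O.Surface ≃ₜ O.unT.Surface :=
  (relabel O O.unT.T 1 (fun _ => rfl) (fun i => by simp [unT, T])).trans O.unT.shear.symm

/-- The action of the shear `T⁻¹` on cellular chains. -/
def unshearEdges {R : Type} [Sub R] (h : Equiv.Perm (Fin n)) (x : Edges n R) : Edges n R :=
  (fun i => x.1 i - x.2 (h i), fun i => x.2 (h i))

theorem actsAs_unshear (O : Origami n) : ActsAs O.unshear matT⁻¹ (unshearEdges O.h) := by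
  have h1 := actsAs_relabel O O.unT.T 1 (fun _ => rfl) (fun i => by simp [unT, T])
  have h2 := O.unT.actsAs_shear.symm (G := unshearEdges O.h) fun x => by
    ext i <;> simp [shearEdges, unshearEdges, unT]
  have h3 := h1.trans h2
  rw [mul_one] at h3
  exact h3

end Origami

namespace SingularHomology

variable {X Y Z : Type} [TopologicalSpace X] [TopologicalSpace Y] [TopologicalSpace Z]

theorem H1map_comp (g : C(Y, Z)) (f : C(X, Y)) (c : H1 X) :
    H1map (g.comp f) c = H1map g (H1map f c) := by
  apply H1incl_injective
  rw [H1incl_H1map, H1incl_H1map, H1incl_H1map, classMap_comp]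

theorem H1map_id (c : H1 X) : H1map (ContinuousMap.id X) c = c := by
  apply H1incl_injective
  rw [H1incl_H1map, classMap_id]

end SingularHomology

namespace Origami

variable {n : ℕ} {O : Origami n}

/-! ### The monodromy representation -/

theorem IsMonodromy.one : O.IsMonodromy (Homeomorph.refl _) 1 := fun _ => (H1map_id _).symm

theorem IsMonodromy.mul {f g : O.Surface ≃ₜ O.Surface} {φ ψ : O.zeroHolonomy ≃ₗ[ℝ] O.zeroHolonomy}
    (hf : O.IsMonodromy f φ) (hg : O.IsMonodromy g ψ) : O.IsMonodromy (g.trans f) (φ * ψ) := by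
  intro c
  have e : (g.trans f : C(O.Surface, O.Surface)) =
      (f : C(O.Surface, O.Surface)).comp (g : C(O.Surface, O.Surface)) := rfl
  rw [LinearEquiv.mul_apply, hf, hg, e, H1map_comp]

theorem H1map_symm_apply (f : O.Surface ≃ₜ O.Surface) (c : H1 O.Surface) :
    H1map (f.symm : C(O.Surface, O.Surface)) (H1map (f : C(O.Surface, O.Surface)) c) = c := by
  rw [← H1map_comp]
  have : (f.symm : C(O.Surface, O.Surface)).comp (f : C(O.Surface, O.Surface)) =
      ContinuousMap.id _ := by
    ext q
    simp
  rw [this, H1map_id]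

theorem IsMonodromy.inv {f : O.Surface ≃ₜ O.Surface} {φ : O.zeroHolonomy ≃ₗ[ℝ] O.zeroHolonomy}
    (hf : O.IsMonodromy f φ) : O.IsMonodromy f.symm φ⁻¹ := by
  intro c
  have h := hf (φ⁻¹ c)
  rw [← LinearEquiv.mul_apply, mul_inv_cancel] at h
  change (c : H1 O.Surface) = _ at h
  rw [h, H1map_symm_apply]

theorem Over.exists_isMonodromy {A : Matrix.SpecialLinearGroup (Fin 2) ℤ}
    {f : O.Surface ≃ₜ O.Surface} (hf : Over A f) : ∃ φ, O.IsMonodromy f φ := by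
  refine ⟨LinearEquiv.ofLinearMap
    ((H1map (f : C(O.Surface, O.Surface))).restrict fun c hc => hf.H1map_mem_zeroHolonomy hc)
    ((H1map (f.symm : C(O.Surface, O.Surface))).restrict fun c hc =>
      hf.symm.H1map_mem_zeroHolonomy hc) ?_ ?_, fun c => rfl⟩
  · ext c
    exact (H1map_symm_apply f.symm c)
  · ext c
    exact (H1map_symm_apply f c)

theorem Over.refl : Over 1 (Homeomorph.refl O.Surface) := fun _ => (torusAct_one _).symm

theorem Over.trans {O' O'' : Origami n} {A B : Matrix.SpecialLinearGroup (Fin 2) ℤ}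
    {f : O.Surface ≃ₜ O'.Surface} {g : O'.Surface ≃ₜ O''.Surface} (hf : Over A f) (hg : Over B g) :
    Over (B * A) (f.trans g) :=
  hg.comp hf

theorem mem_automorphismGroup_iff {f : O.Surface ≃ₜ O.Surface} :
    f ∈ O.automorphismGroup ↔ Over 1 f :=
  forall_congr' fun q => by rw [Matrix.SpecialLinearGroup.coe_one, torusAct_one]

theorem mem_affineGroup_iff (i : Fin n) {f : O.Surface ≃ₜ O.Surface} :
    f ∈ O.affineGroup ↔ ∃ A, Over A f := by
  constructor
  · rintro ⟨A, hA⟩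
    obtain ⟨B, -, hB⟩ := hA.exists_over i
    exact ⟨B, hB⟩
  · rintro ⟨A, hA⟩
    exact ⟨_, hA.isAffine⟩

section Generators

variable {ι : Type*} {B : ι → Matrix.SpecialLinearGroup (Fin 2) ℤ}
  {f : ι → (O.Surface ≃ₜ O.Surface)} {φ : ι → (O.zeroHolonomy ≃ₗ[ℝ] O.zeroHolonomy)}

theorem exists_over_of_mem_closure (hf : ∀ k, Over (B k) (f k))
    (hφ : ∀ k, O.IsMonodromy (f k) (φ k))
    {A : Matrix.SpecialLinearGroup (Fin 2) ℤ} (hA : A ∈ Subgroup.closure (Set.range B)) :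
    ∃ g ψ, Over A (g : O.Surface ≃ₜ O.Surface) ∧ O.IsMonodromy g ψ ∧
      ψ ∈ Subgroup.closure (Set.range φ) := by
  induction hA using Subgroup.closure_induction with
  | mem x hx =>
    obtain ⟨k, rfl⟩ := hx
    exact ⟨f k, φ k, hf k, hφ k, Subgroup.subset_closure ⟨k, rfl⟩⟩
  | one => exact ⟨Homeomorph.refl _, 1, Over.refl, IsMonodromy.one, Subgroup.one_mem _⟩
  | mul x y _ _ hx hy =>
    obtain ⟨g, ψ, h1, h2, h3⟩ := hx
    obtain ⟨g', ψ', h1', h2', h3'⟩ := hy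
    exact ⟨g'.trans g, ψ * ψ', h1.comp h1', h2.mul h2', Subgroup.mul_mem _ h3 h3'⟩
  | inv x _ hx =>
    obtain ⟨g, ψ, h1, h2, h3⟩ := hx
    exact ⟨g.symm, ψ⁻¹, h1.symm, h2.inv, Subgroup.inv_mem _ h3⟩

theorem veechGroup_eq_closure (i : Fin n) (hf : ∀ k, Over (B k) (f k))
    (hgen : ∀ A (g : O.Surface ≃ₜ O.Surface), Over A g → A ∈ Subgroup.closure (Set.range B)) :
    O.veechGroup = (Subgroup.closure (Set.range fun k =>
      Matrix.SpecialLinearGroup.map (Int.castRingHom ℝ) (B k)) :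
        Set (Matrix.SpecialLinearGroup (Fin 2) ℝ)) := by
  have hmap : Subgroup.closure (Set.range fun k =>
      Matrix.SpecialLinearGroup.map (Int.castRingHom ℝ) (B k)) =
      (Subgroup.closure (Set.range B)).map (Matrix.SpecialLinearGroup.map (Int.castRingHom ℝ)) := by
    rw [MonoidHom.map_closure, ← Set.range_comp]
    rfl
  choose φ hφ using fun k => (hf k).exists_isMonodromy
  rw [hmap]
  ext A
  constructor
  · rintro ⟨g, hg⟩
    obtain ⟨A', rfl, hA'⟩ := hg.exists_over i
    exact ⟨A', hgen A' g hA', rfl⟩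
  · rintro ⟨A', hA', rfl⟩
    obtain ⟨g, -, hg, -⟩ := exists_over_of_mem_closure hf hφ hA'
    exact ⟨g, hg.isAffine⟩

theorem kzMonodromyGroup_eq_closure (i : Fin n) (hf : ∀ k, Over (B k) (f k))
    (hφ : ∀ k, O.IsMonodromy (f k) (φ k))
    (hgen : ∀ A (g : O.Surface ≃ₜ O.Surface), Over A g → A ∈ Subgroup.closure (Set.range B)) :
    O.kzMonodromyGroup =
      (Subgroup.closure (Set.range φ ∪ O.monodromyImage O.automorphismGroup) :
        Set (O.zeroHolonomy ≃ₗ[ℝ] O.zeroHolonomy)) := by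
  apply Set.Subset.antisymm
  · rintro ψ ⟨g, hg, hψ⟩
    obtain ⟨A, hA⟩ := (mem_affineGroup_iff i).1 hg
    obtain ⟨g', ψ', h1, h2, h3⟩ := exists_over_of_mem_closure hf hφ (hgen A g hA)
    have h4 : Over 1 (g.trans g'.symm) := by
      have := h1.symm.comp hA
      rwa [inv_mul_cancel] at this
    have h5 : ψ'⁻¹ * ψ ∈ O.monodromyImage O.automorphismGroup :=
      ⟨_, mem_automorphismGroup_iff.2 h4, h2.inv.mul hψ⟩
    have h6 := Subgroup.mul_mem _
      (Subgroup.closure_mono (Set.subset_union_left (t := O.monodromyImage O.automorphismGroup)) h3)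
      (Subgroup.subset_closure (Set.subset_union_right (s := Set.range φ) h5))
    rwa [mul_inv_cancel_left] at h6
  · let K : Subgroup (O.zeroHolonomy ≃ₗ[ℝ] O.zeroHolonomy) :=
      { carrier := O.kzMonodromyGroup
        one_mem' := ⟨_, (mem_affineGroup_iff i).2 ⟨1, Over.refl⟩, IsMonodromy.one⟩
        mul_mem' := by
          rintro a b ⟨g, hg, ha⟩ ⟨g', hg', hb⟩
          obtain ⟨A, hA⟩ := (mem_affineGroup_iff i).1 hg
          obtain ⟨A', hA'⟩ := (mem_affineGroup_iff i).1 hg'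
          exact ⟨g'.trans g, (mem_affineGroup_iff i).2 ⟨A * A', hA.comp hA'⟩, ha.mul hb⟩
        inv_mem' := by
          rintro a ⟨g, hg, ha⟩
          obtain ⟨A, hA⟩ := (mem_affineGroup_iff i).1 hg
          exact ⟨g.symm, (mem_affineGroup_iff i).2 ⟨A⁻¹, hA.symm⟩, ha.inv⟩ }
    refine (Subgroup.closure_le K).2 (Set.union_subset ?_ ?_)
    · rintro _ ⟨k, rfl⟩
      exact ⟨f k, (mem_affineGroup_iff i).2 ⟨B k, hf k⟩, hφ k⟩
    · rintro ψ ⟨g, hg, hψ⟩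
      exact ⟨g, (mem_affineGroup_iff i).2 ⟨1, mem_automorphismGroup_iff.1 hg⟩, hψ⟩

end Generators

/-! ### Edge vectors of straight closed curves, and their pairing with cocycles -/

/-- The pairing of cellular chains with integral cochains. -/
noncomputable def pair (y : Edges n ℤ) : Edges n →ₗ[ℝ] ℝ where
  toFun x := ∑ i, x.1 i * y.1 i + ∑ i, x.2 i * y.2 i
  map_add' a b := by simp [add_mul, Finset.sum_add_distrib]; ring
  map_smul' r a := by simp [mul_assoc, mul_add, ← Finset.mul_sum]

theorem pair_apply (y : Edges n ℤ) (x : Edges n) :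
    pair y x = ∑ i, x.1 i * y.1 i + ∑ i, x.2 i * y.2 i := rfl

/-- The bottom side of a square as a cellular chain. -/
noncomputable def bottomEdge (i : Fin n) : Edges n := (Pi.single i 1, 0)

/-- The left side of a square as a cellular chain. -/
noncomputable def leftEdge (i : Fin n) : Edges n := (0, Pi.single i 1)

theorem edgeClass_bottomEdge (O : Origami n) (i : Fin n) :
    O.edgeClass (bottomEdge i) = O.bottom i := by
  simp [edgeClass, bottomEdge]

theorem edgeClass_leftEdge (O : Origami n) (i : Fin n) : O.edgeClass (leftEdge i) = O.left i := by
  simp [edgeClass, leftEdge]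

theorem pair_bottomEdge (y : Edges n ℤ) (i : Fin n) : pair y (bottomEdge i) = y.1 i := by
  simp [pair_apply, bottomEdge, Pi.single_apply]

theorem pair_leftEdge (y : Edges n ℤ) (i : Fin n) : pair y (leftEdge i) = y.2 i := by
  simp [pair_apply, leftEdge, Pi.single_apply]

/-- The cellular chain of `σ_i`. -/
noncomputable def sigmaEdges (O : Origami n) (i : Fin n) : Edges n :=
  ∑ j ∈ orbit O.h i, bottomEdge j

/-- The cellular chain of `ζ_i`. -/
noncomputable def zetaEdges (O : Origami n) (i : Fin n) : Edges n :=
  ∑ j ∈ orbit O.v i, leftEdge j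

/-- The cellular chain of `η_i`. -/
noncomputable def etaEdges (O : Origami n) (i : Fin n) : Edges n :=
  ∑ j ∈ orbit (O.v * O.h) i, (bottomEdge j + leftEdge (O.h j))

theorem edgeClass_sigmaEdges (O : Origami n) (i : Fin n) :
    O.edgeClass (O.sigmaEdges i) = chainClass O.Surface (O.sigma i) := by
  simp [sigmaEdges, chainClass_sigma, edgeClass_bottomEdge]

theorem edgeClass_zetaEdges (O : Origami n) (i : Fin n) :
    O.edgeClass (O.zetaEdges i) = chainClass O.Surface (O.zeta i) := by
  simp [zetaEdges, chainClass_zeta, edgeClass_leftEdge]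

theorem edgeClass_etaEdges (O : Origami n) (i : Fin n) :
    O.edgeClass (O.etaEdges i) = chainClass O.Surface (O.eta i) := by
  simp [etaEdges, chainClass_eta, edgeClass_bottomEdge, edgeClass_leftEdge]

theorem sum_orbit {M : Type*} [AddCommMonoid M] (p : Equiv.Perm (Fin n)) (i : Fin n) (m : ℕ)
    (hm : 0 < m) (hp : (p ^ m) i = i) (hinj : ∀ a < m, ∀ b < m, (p ^ a) i = (p ^ b) i → a = b)
    (F : Fin n → M) : ∑ j ∈ orbit p i, F j = ∑ k ∈ Finset.range m, F ((p ^ k) i) := by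
  have : orbit p i = (Finset.range m).image fun k => (p ^ k) i := by
    ext j
    simp only [orbit, Finset.mem_filter, Finset.mem_univ, true_and, Finset.mem_image,
      Finset.mem_range]
    constructor
    · rintro ⟨z, rfl⟩
      have hm' : (m : ℤ) ≠ 0 := by omega
      refine ⟨(z % m).toNat, ?_, ?_⟩
      · have := Int.emod_lt_of_pos z (show (0 : ℤ) < m by omega)
        have := Int.emod_nonneg z hm'
        omega
      · have h1 := Int.emod_nonneg z hm'
        rw [← zpow_natCast, Int.toNat_of_nonneg h1]
        conv_rhs => rw [← Int.emod_add_mul_ediv z m, zpow_add, zpow_mul, zpow_natCast,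
          Equiv.Perm.mul_apply, Equiv.Perm.zpow_apply_eq_self_of_apply_eq_self hp]
    · rintro ⟨k, -, rfl⟩
      exact ⟨k, by simp⟩
  rw [this, Finset.sum_image]
  intro a ha b hb
  exact hinj a (by simpa using ha) b (by simpa using hb)

/-! ### The dual action on cochains -/

/-- The pull-back of cochains by a relabelling. -/
def relabelDual (π : Fin n → Fin n) (y : Edges n ℤ) : Edges n ℤ :=
  (fun i => y.1 (π i), fun i => y.2 (π i))

/-- The pull-back of cochains by the shear `T`. -/
def shearDual (h : Fin n → Fin n) (y : Edges n ℤ) : Edges n ℤ :=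
  (y.1, fun i => y.1 i + y.2 (h i))

/-- The pull-back of cochains by the shear `S`. -/
def shearUpDual (v : Fin n → Fin n) (y : Edges n ℤ) : Edges n ℤ :=
  (fun i => y.2 i + y.1 (v i), y.2)

/-- The pull-back of cochains by the shear `T⁻¹`; here `h` is the inverse permutation. -/
def unshearDual (h : Fin n → Fin n) (y : Edges n ℤ) : Edges n ℤ :=
  (y.1, fun i => y.2 (h i) - y.1 (h i))

theorem pair_relabelEdges (π : Equiv.Perm (Fin n)) (y : Edges n ℤ) (x : Edges n) :
    pair y (relabelEdges π x) = pair (relabelDual π y) x := by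
  simp only [pair_apply, relabelEdges, relabelDual]
  rw [← Equiv.sum_comp π, ← Equiv.sum_comp π fun i => x.2 (π⁻¹ i) * (y.2 i : ℝ)]
  simp

theorem pair_shearEdges (h : Equiv.Perm (Fin n)) (y : Edges n ℤ) (x : Edges n) :
    pair y (shearEdges h x) = pair (shearDual h y) x := by
  simp only [pair_apply, shearEdges, shearDual, add_mul, Int.cast_add, mul_add,
    Finset.sum_add_distrib]
  rw [← Equiv.sum_comp h fun i => x.2 (h⁻¹ i) * (y.2 i : ℝ)]
  simp [add_assoc]

theorem pair_shearUpEdges (v : Equiv.Perm (Fin n)) (y : Edges n ℤ) (x : Edges n) :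
    pair y (shearUpEdges v x) = pair (shearUpDual v y) x := by
  have h (y : Edges n ℤ) (x : Edges n) : pair y x.swap = pair y.swap x := by
    simp [pair_apply, add_comm]
  rw [shearUpEdges, h, pair_shearEdges, h]
  rfl

theorem pair_unshearEdges (h : Equiv.Perm (Fin n)) (y : Edges n ℤ) (x : Edges n) :
    pair y (unshearEdges h x) = pair (unshearDual ⇑h⁻¹ y) x := by
  simp only [pair_apply, unshearEdges, unshearDual, sub_mul, Int.cast_sub, mul_sub,
    Finset.sum_sub_distrib]
  rw [← Equiv.sum_comp h fun i => x.2 i * (y.2 (h⁻¹ i) : ℝ),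
    ← Equiv.sum_comp h fun i => x.2 i * (y.1 (h⁻¹ i) : ℝ)]
  simp
  ring

end Origami

namespace CubeCover

open Origami

/-! ### The surface `C` by tables -/

/-- The permutation `h` of the surface `C`. -/
def hPerm : Equiv.Perm (Fin 24) :=
  let p : Fin 24 → Fin 24 :=
    ![12, 15, 14, 13, 16, 19, 18, 17, 20, 23, 22, 21, 0, 3, 2, 1, 4, 7, 6, 5, 8, 11, 10, 9]
  ⟨p, p, by decide +kernel, by decide +kernel⟩

/-- The permutation `v` of the surface `C`. -/
def vPerm : Equiv.Perm (Fin 24) :=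
  let p : Fin 24 → Fin 24 :=
    ![8, 18, 22, 7, 11, 12, 4, 21, 13, 19, 1, 6, 16, 0, 20, 9, 5, 2, 10, 15, 23, 3, 17, 14]
  ⟨p, fun i => p (p i), by decide +kernel, by decide +kernel⟩

/-- The surface `C`, with its permutations given by tables. -/
def cube : Origami 24 := ⟨hPerm, vPerm⟩

theorem C_eq : C = cube := by
  have hh : C.h = hPerm := Equiv.ext (by decide +kernel)
  have hv : C.v = vPerm := Equiv.ext (by decide +kernel)
  exact congrArg₂ Origami.mk hh hv

/-- Words in `h` (`true`) and `v` (`false`) that lead from the square `0` to the given square. -/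
def wordTo : Fin 24 → List Bool :=
  ![
    [], [true, false, true, false, false, true], [true, false, false, true, false],
    [true, false, false], [true, false, true], [false, false, true],
    [false, false, true, false, true], [false, true, false, false], [false],
    [true, false, true, false], [false, true, false, false, true, false, true],
    [false, true, false, true], [true], [false, false], [false, false, true, false],
    [false, true, false, false, true], [false, true], [true, false, true, false, false],
    [true, false, false, true, false, true], [true, false, false, true], [true, false],
    [true, false, true, false, true], [false, true, false, false, true, false],
    [false, true, false]]

theorem C_reachableFrom : C.ReachableFrom 0 := by
  intro P h0 hh hv i
  have key (l : List Bool) : P (l.foldr (fun b j => if b then C.h j else C.v j) 0) := by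
    induction l with
    | nil => exact h0
    | cons b l ih => cases b <;> simp_all
  have e : ∀ i, (wordTo i).foldr (fun b j => if b then C.h j else C.v j) 0 = i := by
    rw [C_eq]
    decide +kernel
  exact e i ▸ key (wordTo i)

/-- A numbering of the lower left vertices of the squares of `C`. -/
def vertexLabel : Fin 24 → Fin 8 :=
  ![0, 1, 2, 3, 4, 5, 6, 1, 4, 6, 7, 2, 1, 6, 5, 0, 7, 0, 3, 2, 7, 5, 4, 3]

theorem finrank_H1_C_le :
    FiniteDimensional ℝ (H1 C.Surface) ∧ Module.finrank ℝ (H1 C.Surface) ≤ 18 := by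
  have hw : ∀ i, vertexLabel (C.h (C.v i)) = vertexLabel (C.v (C.h i)) := by
    rw [C_eq]
    decide +kernel
  have hs : Function.Surjective vertexLabel := by
    unfold Function.Surjective
    decide +kernel
  obtain ⟨h1, h2⟩ := C_reachableFrom.finrank_H1_le vertexLabel hw hs
  exact ⟨h1, by omega⟩

/-! ### The values of cochains on the basis -/

/-- The cellular chains of the classes `Σ_i`, `Z_j`, `H_k`. -/
noncomputable def basisEdges : Fin 16 → Edges 24 :=
  ![C.sigmaEdges 1 - C.sigmaEdges 9, C.sigmaEdges 2 - C.sigmaEdges 9,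
    C.sigmaEdges 3 - C.sigmaEdges 9, C.sigmaEdges 5 - C.sigmaEdges 9,
    C.sigmaEdges 8 - C.sigmaEdges 9,
    C.zetaEdges 1 - C.zetaEdges 8, C.zetaEdges 2 - C.zetaEdges 8,
    C.zetaEdges 3 - C.zetaEdges 8, C.zetaEdges 4 - C.zetaEdges 8,
    C.zetaEdges 5 - C.zetaEdges 8,
    C.etaEdges 1 - (2 : ℝ) • C.sigmaEdges 9 - (4 / 3 : ℝ) • C.zetaEdges 8,
    C.etaEdges 2 - (2 : ℝ) • C.sigmaEdges 9 - (4 / 3 : ℝ) • C.zetaEdges 8,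
    C.etaEdges 3 - (2 : ℝ) • C.sigmaEdges 9 - (4 / 3 : ℝ) • C.zetaEdges 8,
    C.etaEdges 4 - (2 : ℝ) • C.sigmaEdges 9 - (4 / 3 : ℝ) • C.zetaEdges 8,
    C.etaEdges 6 - (2 : ℝ) • C.sigmaEdges 9 - (4 / 3 : ℝ) • C.zetaEdges 8,
    C.etaEdges 8 - (2 : ℝ) • C.sigmaEdges 9 - (4 / 3 : ℝ) • C.zetaEdges 8]

theorem H1incl_zeroHolonomyClass (k : Fin 16) :
    H1incl C.Surface (zeroHolonomyClass k) = C.edgeClass (basisEdges k) := by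
  rw [zeroHolonomyClass, H1incl_mk]
  fin_cases k <;>
    simp [basisEdges, edgeClass_sigmaEdges, edgeClass_zetaEdges, edgeClass_etaEdges]

/-- The value of a cochain on `σ_i`. -/
def sigmaValue (y : Edges 24 ℤ) (i : Fin 24) : ℤ := y.1 i + y.1 (hPerm i)

/-- The value of a cochain on `ζ_i`. -/
def zetaValue (y : Edges 24 ℤ) (i : Fin 24) : ℤ :=
  y.2 i + y.2 (vPerm i) + y.2 (vPerm (vPerm i))

/-- The value of a cochain on the part of `η_i` in the squares `i` and `h i`. -/
def stepValue (y : Edges 24 ℤ) (i : Fin 24) : ℤ := y.1 i + y.2 (hPerm i)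

/-- The value of a cochain on `η_i`. -/
def etaValue (y : Edges 24 ℤ) (i : Fin 24) : ℤ :=
  stepValue y i + stepValue y (vPerm (hPerm i)) +
    stepValue y (vPerm (hPerm (vPerm (hPerm i)))) +
    stepValue y (vPerm (hPerm (vPerm (hPerm (vPerm (hPerm i))))))

/-- The values of a cochain on the classes `Σ_i`, `Z_j`, `H_k`. -/
def basisValue (y : Edges 24 ℤ) : Fin 16 → ℚ :=
  let s (i : Fin 24) : ℚ := (sigmaValue y i - sigmaValue y 9 : ℤ)
  let z (i : Fin 24) : ℚ := (zetaValue y i - zetaValue y 8 : ℤ)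
  let e (i : Fin 24) : ℚ := (etaValue y i - 2 * sigmaValue y 9 : ℤ) - 4 / 3 * (zetaValue y 8 : ℤ)
  ![s 1, s 2, s 3, s 5, s 8, z 1, z 2, z 3, z 4, z 5, e 1, e 2, e 3, e 4, e 6, e 8]

theorem pair_sigmaEdges (y : Edges 24 ℤ) (i : Fin 24) :
    pair y (C.sigmaEdges i) = sigmaValue y i := by
  rw [C_eq, sigmaEdges, map_sum, sum_orbit _ i 2 two_pos]
  · simp [Finset.sum_range_succ, pair_bottomEdge, sigmaValue, cube]
  · revert i
    decide +kernel
  · revert i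
    decide +kernel

theorem pair_zetaEdges (y : Edges 24 ℤ) (i : Fin 24) :
    pair y (C.zetaEdges i) = zetaValue y i := by
  rw [C_eq, zetaEdges, map_sum, sum_orbit _ i 3 three_pos]
  · simp [Finset.sum_range_succ, pair_leftEdge, zetaValue, cube, pow_succ]
  · revert i
    decide +kernel
  · revert i
    decide +kernel

theorem pair_etaEdges (y : Edges 24 ℤ) (i : Fin 24) :
    pair y (C.etaEdges i) = etaValue y i := by
  rw [C_eq, etaEdges, map_sum, sum_orbit _ i 4 four_pos]
  · simp [Finset.sum_range_succ, pair_leftEdge, pair_bottomEdge, etaValue, stepValue, cube,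
      pow_succ]
  · revert i
    decide +kernel
  · revert i
    decide +kernel

theorem pair_basisEdges (y : Edges 24 ℤ) (k : Fin 16) :
    pair y (basisEdges k) = basisValue y k := by
  fin_cases k <;>
    simp [basisEdges, basisValue, pair_sigmaEdges, pair_zetaEdges, pair_etaEdges]

/-! ### Coordinate cocycles -/

/-- The values of the coordinate cocycles on the bottom sides. -/
def coordBottom : Fin 16 → Fin 24 → ℤ :=
  ![![2, 8, 0, 0, -8, 0, -4, -2, 2, 0, 6, -2, 6, 0, 0, -6, 6, 0, 2, 0, -2, -2, 2, 0],
    ![0, -1, 2, 0, 3, 1, 1, 1, -1, 1, -2, 2, -1, 1, 1, 2, 0, 0, 0, 0, 2, -1, 1, 0],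
    ![-3, -8, 0, 1, 9, -1, 2, 4, -3, 0, -8, 2, -8, 0, -1, 7, -8, -3, -1, 0, 2, 1, -3, -1],
    ![-2, -2, 1, 0, 1, 1, 0, 2, -1, 0, -1, -1, 0, 0, -1, 2, -1, 0, 0, 1, 1, 1, -1, 0],
    ![0, -2, 0, -1, 3, 0, 1, 0, 1, -1, -1, 0, -2, 1, 0, 2, -3, 0, 1, 0, 1, 0, -1, 1],
    ![1, 5, -1, -1, -8, 0, -3, -2, 1, 0, 4, -3, 5, 0, 0, -6, 5, 0, -1, -1, -2, -1, 1, -1],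
    ![0, -3, 0, 0, 4, 0, 1, 0, -1, 0, -3, 2, -3, 0, 0, 3, -2, -1, 0, 0, 1, -1, -1, 0],
    ![0, -1, 1, 0, 2, 0, 1, 1, 0, 1, -1, 1, -1, 1, 0, 2, -1, 0, 0, 1, 1, 0, 0, 0],
    ![-1, -1, 0, 0, 1, 0, 0, 1, -1, 0, -1, 0, -1, 0, 0, 1, -1, -1, 0, 0, 1, 0, -1, 0],
    ![-1, 1, 0, 0, -3, -1, -2, 0, 0, -1, 1, -2, 1, -1, -1, -2, 0, 0, 0, 0, -1, 0, 0, 0],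
    ![-1, -1, 1, 0, 3, 0, 2, 2, 0, 1, -1, 1, -1, 1, 0, 2, -2, 0, 0, 1, 1, 1, 0, 0],
    ![0, 3, -3, 0, -8, 0, -5, -3, 0, -3, 3, -5, 3, -3, 0, -6, 3, 0, 0, -3, -3, 0, 0, 0],
    ![2, 4, 0, 0, -3, 1, 0, -1, 2, 1, 3, 0, 4, 1, 1, -3, 4, 1, 0, 0, -1, 0, 2, 0],
    ![-1, -3, 0, 0, 5, 0, 2, 1, -1, 0, -3, 2, -3, 0, 0, 3, -3, -1, 0, 0, 1, 0, -1, 0],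
    ![-1, -1, 0, 0, 0, -1, 0, 0, -1, -1, 0, 0, -1, -1, -1, 0, -1, 0, 0, 0, 0, 0, -1, 0],
    ![1, 1, -1, 0, -3, 0, -2, -2, 0, -1, 1, -1, 1, -1, 0, -2, 2, 0, 0, -1, -1, -1, 0, 0]]

/-- The values of the coordinate cocycles on the left sides. -/
def coordLeft : Fin 16 → Fin 24 → ℤ :=
  ![![0, 2, 0, 2, -4, -2, 4, 0, 0, -4, -2, 0, 0, 0, 2, -4, 2, 0, 0, 4, -2, -2, 0, -4],
    ![1, -1, 0, -1, 0, 1, -1, 1, -1, 1, 0, 1, 0, 0, -1, 0, -1, -1, 1, -1, 1, 0, 1, 0],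
    ![0, -5, 0, -3, 2, 2, -5, 0, -3, 4, 0, 0, 0, 0, -3, 2, -5, -3, 2, -5, 0, 0, 0, 4],
    ![0, -1, 1, -1, 1, 0, -1, 0, -1, 0, 1, 0, 1, 1, -1, 1, -1, -1, 0, -1, 0, 1, 0, 1],
    ![0, -1, 0, -1, 2, 0, -2, 0, 0, 0, 1, 0, 1, 0, -1, 2, -1, 0, 0, -2, 0, 1, 0, 1],
    ![0, 4, -1, 1, -3, -2, 4, 0, 0, -3, -1, -1, 0, 0, 1, -2, 2, 1, -1, 3, -1, -1, 0, -4],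
    ![0, -3, 0, -2, 0, 0, -3, 0, -1, 0, 0, 0, -1, -2, -1, 0, -2, -1, 0, -3, 0, -1, 0, 0],
    ![-2, -1, -2, -1, 0, 0, -3, 0, -1, 0, 0, 0, -2, 0, -3, 0, -1, -1, -2, -1, 0, 0, 0, 0],
    ![0, -1, 1, -1, 1, 0, 0, 0, 0, 1, 0, 1, 0, 0, 0, 0, 0, -1, 1, -1, 1, 1, 0, 1],
    ![0, 1, 0, 0, 0, 0, 0, 0, 0, -2, 0, 0, 1, 0, 0, 0, 1, 0, -1, 2, -1, 0, 0, -1],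
    ![0, 0, 1, -1, 1, 0, -1, 0, -1, 2, 0, 0, 1, 1, 0, 1, -1, -1, 0, -1, 0, 1, 0, 2],
    ![0, 3, 0, 3, 0, 0, 3, 0, 3, -2, 0, 0, 0, 0, 3, 0, 3, 3, 0, 3, 0, 0, 0, -2],
    ![0, 2, 0, 1, -2, -1, 2, -1, 0, -2, -1, 0, 0, 0, 2, -2, 1, 0, -1, 2, -1, 0, 0, -3],
    ![0, -2, 0, 0, 2, 1, -1, 1, -1, 3, 0, -1, 0, 1, -1, 1, -1, 0, 2, -2, 0, -1, 0, 3],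
    ![0, -1, 0, 0, 0, 0, 0, 0, 0, 0, 1, 0, 0, 0, -1, 0, 0, 0, 0, 0, 0, 0, 0, 1],
    ![0, 0, -1, 1, -1, 0, 1, 0, 1, 0, 0, 0, -1, -1, 0, -1, 1, 1, 0, 1, 0, -1, 0, 0]]

/-- Integral cocycles whose halves are dual to the basis. -/
def coordCochain (l : Fin 16) : Edges 24 ℤ := (coordBottom l, coordLeft l)

theorem coordCochain_cocycle : ∀ l i,
    coordBottom l i + coordLeft l (C.h i) = coordLeft l i + coordBottom l (C.v i) := by
  rw [C_eq]
  decide +kernel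

theorem basisValue_coordCochain : ∀ l k,
    basisValue (coordCochain l) k = 2 * (1 : Matrix (Fin 16) (Fin 16) ℚ) l k := by
  decide +kernel

/-- The coordinates of a homology class. -/
noncomputable def coordMap (l : Fin 16) : H1 C.Surface →ₗ[ℝ] ℝ :=
  (2⁻¹ : ℝ) •
    incClass (C.cocycleMap (coordBottom l) (coordLeft l) (coordCochain_cocycle l)) ∘ₗ
      H1incl C.Surface

theorem coordMap_apply (l : Fin 16) {c : H1 C.Surface} {x : Edges 24}
    (h : H1incl C.Surface c = C.edgeClass x) : coordMap l c = pair (coordCochain l) x / 2 := by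
  rw [coordMap, LinearMap.smul_apply, LinearMap.comp_apply, h, incClass_cocycleMap_edgeClass,
    smul_eq_mul, inv_mul_eq_div]
  rfl

theorem coordMap_zeroHolonomyClass (l k : Fin 16) :
    coordMap l (zeroHolonomyClass k) = (1 : Matrix (Fin 16) (Fin 16) ℝ) l k := by
  rw [coordMap_apply l (H1incl_zeroHolonomyClass k), pair_basisEdges, basisValue_coordCochain]
  by_cases h : l = k <;> simp [Matrix.one_apply, h]

theorem zeroHolonomyClass_mem (k : Fin 16) : zeroHolonomyClass k ∈ C.zeroHolonomy := by
  rw [edgeClass_mem_zeroHolonomy_iff C (H1incl_zeroHolonomyClass k)]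
  have h1 (x : Edges 24) : ∑ i, x.1 i = pair (1, 0) x := by simp [pair_apply]
  have h2 (x : Edges 24) : ∑ i, x.2 i = pair (0, 1) x := by simp [pair_apply]
  have h3 : ∀ k, basisValue (1, 0) k = 0 ∧ basisValue (0, 1) k = 0 := by decide +kernel
  rw [h1, h2, pair_basisEdges, pair_basisEdges, (h3 k).1, (h3 k).2, Rat.cast_zero]
  exact ⟨rfl, rfl⟩

theorem linearIndependent_zeroHolonomyClass : LinearIndependent ℝ zeroHolonomyClass := by
  refine LinearIndependent.of_comp (LinearMap.pi coordMap) ?_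
  have h : LinearMap.pi coordMap ∘ zeroHolonomyClass = Pi.basisFun ℝ (Fin 16) := by
    ext k l
    simp [coordMap_zeroHolonomyClass, Matrix.one_apply, Pi.single_apply]
  rw [h]
  exact (Pi.basisFun ℝ (Fin 16)).linearIndependent

/-- The holonomy of a homology class. -/
noncomputable def holonomyMap : H1 C.Surface →ₗ[ℝ] ℝ × ℝ :=
  ((incClass C.torusFst).prod (incClass C.torusSnd)) ∘ₗ H1incl C.Surface

theorem ker_holonomyMap : LinearMap.ker holonomyMap = C.zeroHolonomy := by
  ext c
  rw [mem_zeroHolonomy_iff, LinearMap.mem_ker, ← Prod.mk_eq_zero]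
  rfl

theorem holonomyMap_apply {c : H1 C.Surface} {x : Edges 24}
    (h : H1incl C.Surface c = C.edgeClass x) : holonomyMap c = (pair (1, 0) x, pair (0, 1) x) := by
  rw [holonomyMap, LinearMap.comp_apply, h, torusFst_eq_cocycleMap, torusSnd_eq_cocycleMap]
  exact Prod.ext (incClass_cocycleMap_edgeClass C _ _ _ x) (incClass_cocycleMap_edgeClass C _ _ _ x)

theorem holonomyMap_surjective : Function.Surjective holonomyMap := by
  have h1 : holonomyMap (Submodule.Quotient.mk (C.sigma 9)) = (2, 0) := by
    rw [holonomyMap_apply (x := C.sigmaEdges 9) (by rw [H1incl_mk, edgeClass_sigmaEdges]),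
      pair_sigmaEdges, pair_sigmaEdges]
    simp [sigmaValue]
  have h2 : holonomyMap (Submodule.Quotient.mk (C.zeta 8)) = (0, 3) := by
    rw [holonomyMap_apply (x := C.zetaEdges 8) (by rw [H1incl_mk, edgeClass_zetaEdges]),
      pair_zetaEdges, pair_zetaEdges]
    simp [zetaValue]
  rintro ⟨a, b⟩
  refine ⟨(a / 2) • Submodule.Quotient.mk (C.sigma 9) +
    (b / 3) • Submodule.Quotient.mk (C.zeta 8), ?_⟩
  rw [map_add, map_smul, map_smul, h1, h2]
  simp

theorem finrank_zeroHolonomy_C_le :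
    FiniteDimensional ℝ C.zeroHolonomy ∧ Module.finrank ℝ C.zeroHolonomy ≤ 16 := by
  obtain ⟨h1, h2⟩ := finrank_H1_C_le
  have h3 := LinearMap.finrank_range_add_finrank_ker holonomyMap
  rw [LinearMap.range_eq_top.2 holonomyMap_surjective, finrank_top, ker_holonomyMap,
    Module.finrank_prod, Module.finrank_self] at h3
  exact ⟨inferInstance, by omega⟩

/-- The basis of the zero-holonomy subspace. -/
theorem exists_basis_zeroHolonomy : ∃ b : Module.Basis (Fin 16) ℝ C.zeroHolonomy,
    ∀ k, (b k : H1 C.Surface) = zeroHolonomyClass k := by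
  obtain ⟨h1, h2⟩ := finrank_zeroHolonomy_C_le
  have hli : LinearIndependent ℝ fun k =>
      (⟨zeroHolonomyClass k, zeroHolonomyClass_mem k⟩ : C.zeroHolonomy) :=
    LinearIndependent.of_comp C.zeroHolonomy.subtype linearIndependent_zeroHolonomyClass
  have h3 := hli.fintype_card_le_finrank
  refine ⟨basisOfLinearIndependentOfCardEqFinrank hli ?_, fun k => ?_⟩
  · rw [Fintype.card_fin] at h3 ⊢
    omega
  · simp

theorem basis_repr_eq {b : Module.Basis (Fin 16) ℝ C.zeroHolonomy}
    (hb : ∀ k, (b k : H1 C.Surface) = zeroHolonomyClass k) (c : C.zeroHolonomy) (l : Fin 16) :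
    b.repr c l = coordMap l c := by
  suffices b.coord l = coordMap l ∘ₗ C.zeroHolonomy.subtype from LinearMap.congr_fun this c
  refine b.ext fun k => ?_
  rw [LinearMap.comp_apply, Submodule.subtype_apply, hb, coordMap_zeroHolonomyClass]
  simp [Finsupp.single_apply, Matrix.one_apply, eq_comm]

/-- The matrix of the monodromy of a map that acts on cellular chains by `F`. -/
theorem toMatrix_eq_of_actsAs {b : Module.Basis (Fin 16) ℝ C.zeroHolonomy}
    (hb : ∀ k, (b k : H1 C.Surface) = zeroHolonomyClass k) {f : C.Surface ≃ₜ C.Surface}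
    {A : Matrix.SpecialLinearGroup (Fin 2) ℤ} {F : Edges 24 → Edges 24} (hf : ActsAs f A F)
    {φ : C.zeroHolonomy ≃ₗ[ℝ] C.zeroHolonomy} (hφ : C.IsMonodromy f φ)
    {M : Matrix (Fin 16) (Fin 16) ℚ} (G : Edges 24 ℤ → Edges 24 ℤ)
    (hFG : ∀ y x, pair y (F x) = pair (G y) x)
    (hM : ∀ l k, basisValue (G (coordCochain l)) k = 2 * M l k) :
    LinearMap.toMatrix b b φ = M.map ((↑) : ℚ → ℝ) := by
  ext l k
  have h : H1incl C.Surface (φ (b k)) = C.edgeClass (F (basisEdges k)) := by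
    rw [hφ, H1incl_H1map, hb, H1incl_zeroHolonomyClass, hf.edges]
  rw [LinearMap.toMatrix_apply, LinearEquiv.coe_coe, basis_repr_eq hb, coordMap_apply l h, hFG,
    pair_basisEdges, hM]
  simp

/-! ### Affine homeomorphisms with derivatives `g₁`, `g₂`, `g₃` -/

/-- The matrices `g₁`, `g₂`, `g₃` over the integers. -/
def gen : Fin 3 → Matrix.SpecialLinearGroup (Fin 2) ℤ :=
  ![⟨!![1, 2; 0, 1], by decide⟩, ⟨!![5, -2; 3, -1], by decide⟩, ⟨!![3, -2; 5, -3], by decide⟩]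

theorem map_gen (k : Fin 3) :
    Matrix.SpecialLinearGroup.map (Int.castRingHom ℝ) (gen k) = ![g₁, g₂, g₃] k := by
  ext i j
  change ((gen k i j : ℤ) : ℝ) = _
  fin_cases k <;> fin_cases i <;> fin_cases j <;> simp [gen, g₁, g₂, g₃]

theorem matT_inv : matT⁻¹ = ⟨!![1, -1; 0, 1], by decide⟩ :=
  inv_eq_of_mul_eq_one_right (by decide +kernel)

/-- There is an affine homeomorphism of `C` with derivative `A` whose monodromy has the
matrix `M`. -/
def Realizes (A : Matrix.SpecialLinearGroup (Fin 2) ℤ) (M : Matrix (Fin 16) (Fin 16) ℚ) : Prop :=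
  ∃ (f : C.Surface ≃ₜ C.Surface) (F : Edges 24 → Edges 24) (G : Edges 24 ℤ → Edges 24 ℤ),
    ActsAs f A F ∧ (∀ y x, pair y (F x) = pair (G y) x) ∧
      ∀ l k, basisValue (G (coordCochain l)) k = 2 * M l k

theorem realizes_alphaMatrix1 : Realizes (gen 0) alphaMatrix1 := by
  have hh : ∀ i, (1 : Equiv.Perm (Fin 24)) (C.T.T.h i) = C.h ((1 : Equiv.Perm (Fin 24)) i) := by
    rw [C_eq]
    decide +kernel
  have hv : ∀ i, (1 : Equiv.Perm (Fin 24)) (C.T.T.v i) = C.v ((1 : Equiv.Perm (Fin 24)) i) := by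
    rw [C_eq]
    decide +kernel
  have hA : 1 * (matT * matT) = gen 0 := by decide +kernel
  refine ⟨_, _, fun y => shearDual C.h (shearDual C.T.h (relabelDual id y)),
    hA ▸ (C.actsAs_shear.trans C.T.actsAs_shear).trans (actsAs_relabel C.T.T C 1 hh hv),
    fun y x => ?_, ?_⟩
  · simp only [Function.comp_apply, pair_relabelEdges, pair_shearEdges, Equiv.Perm.coe_one]
  · rw [C_eq]
    decide +kernel

/-- The relabelling that closes the word `T S T S T⁻¹`. -/
def relabel₂ : Equiv.Perm (Fin 24) where
  toFun := ![3, 6, 21, 17, 10, 2, 7, 13, 20, 1, 22, 14, 9, 12, 19, 23, 8, 18, 15, 5, 4, 11, 16, 0]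
  invFun := ![23, 9, 5, 0, 20, 19, 1, 6, 16, 12, 4, 21, 13, 7, 11, 18, 22, 3, 17, 14, 8, 2, 10, 15]
  left_inv := by decide +kernel
  right_inv := by decide +kernel

theorem realizes_alphaMatrix2 : Realizes (gen 1) alphaMatrix2 := by
  have hh : ∀ i, relabel₂ (C.unT.S.T.S.T.h i) = C.h (relabel₂ i) := by
    rw [C_eq]
    decide +kernel
  have hv : ∀ i, relabel₂ (C.unT.S.T.S.T.v i) = C.v (relabel₂ i) := by
    rw [C_eq]
    decide +kernel
  have hA : 1 * (matT * (matS * (matT * (matS * matT⁻¹)))) = gen 1 := by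
    rw [matT_inv]
    decide +kernel
  refine ⟨_, _, fun y => unshearDual ⇑C.h⁻¹ (shearUpDual C.unT.v (shearDual C.unT.S.h
      (shearUpDual C.unT.S.T.v (shearDual C.unT.S.T.S.h (relabelDual relabel₂ y))))),
    hA ▸ ((((C.actsAs_unshear.trans C.unT.actsAs_shearUp).trans
      C.unT.S.actsAs_shear).trans C.unT.S.T.actsAs_shearUp).trans
      C.unT.S.T.S.actsAs_shear).trans (actsAs_relabel C.unT.S.T.S.T C relabel₂ hh hv),
    fun y x => ?_, ?_⟩
  · simp only [Function.comp_apply, pair_relabelEdges, pair_shearEdges, pair_shearUpEdges,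
      pair_unshearEdges]
  · rw [C_eq]
    decide +kernel

/-- The relabelling that closes the word `S T S² T⁻¹`. -/
def relabel₃ : Equiv.Perm (Fin 24) where
  toFun := ![15, 1, 6, 16, 19, 18, 22, 7, 11, 4, 21, 13, 12, 8, 3, 17, 14, 0, 20, 9, 5, 23, 2, 10]
  invFun := ![17, 1, 22, 14, 9, 20, 2, 7, 13, 19, 23, 8, 12, 11, 16, 0, 3, 15, 5, 4, 18, 10, 6, 21]
  left_inv := by decide +kernel
  right_inv := by decide +kernel

theorem realizes_alphaMatrix3 : Realizes (gen 2) alphaMatrix3 := by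
  have hh : ∀ i, relabel₃ (C.unT.S.S.T.S.h i) = C.h (relabel₃ i) := by
    rw [C_eq]
    decide +kernel
  have hv : ∀ i, relabel₃ (C.unT.S.S.T.S.v i) = C.v (relabel₃ i) := by
    rw [C_eq]
    decide +kernel
  have hA : 1 * (matS * (matT * (matS * (matS * matT⁻¹)))) = gen 2 := by
    rw [matT_inv]
    decide +kernel
  refine ⟨_, _, fun y => unshearDual ⇑C.h⁻¹ (shearUpDual C.unT.v (shearUpDual C.unT.S.v
      (shearDual C.unT.S.S.h (shearUpDual C.unT.S.S.T.v (relabelDual relabel₃ y))))),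
    hA ▸ ((((C.actsAs_unshear.trans C.unT.actsAs_shearUp).trans
      C.unT.S.actsAs_shearUp).trans C.unT.S.S.actsAs_shear).trans
      C.unT.S.S.T.actsAs_shearUp).trans (actsAs_relabel C.unT.S.S.T.S C relabel₃ hh hv),
    fun y x => ?_, ?_⟩
  · simp only [Function.comp_apply, pair_relabelEdges, pair_shearEdges, pair_shearUpEdges,
      pair_unshearEdges]
  · rw [C_eq]
    decide +kernel

/-! ### Coset representatives of the Veech group -/

/-- The image of `C` under a word in `T` (`true`) and `S` (`false`), applied from the right. -/
def orbitSurface (l : List Bool) : Origami 24 :=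
  l.foldr (fun b O => if b then O.T else O.S) C

/-- The matrix of a word in `T` (`true`) and `S` (`false`). -/
def wordMatrix (l : List Bool) : Matrix.SpecialLinearGroup (Fin 2) ℤ :=
  l.foldr (fun b A => (if b then matT else matS) * A) 1

theorem exists_over_wordMatrix (l : List Bool) :
    ∃ f : C.Surface ≃ₜ (orbitSurface l).Surface, Over (wordMatrix l) f := by
  induction l with
  | nil => exact ⟨Homeomorph.refl _, Over.refl⟩
  | cons b l ih =>
    obtain ⟨f, hf⟩ := ih
    cases b
    · change ∃ g : C.Surface ≃ₜ (orbitSurface l).S.Surface, Over (matS * wordMatrix l) g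
      exact ⟨f.trans (orbitSurface l).shearUp, hf.trans (orbitSurface l).actsAs_shearUp.covers⟩
    · change ∃ g : C.Surface ≃ₜ (orbitSurface l).T.Surface, Over (matT * wordMatrix l) g
      exact ⟨f.trans (orbitSurface l).shear, hf.trans (orbitSurface l).actsAs_shear.covers⟩

/-- Words for the coset representatives of the Veech group. -/
def coset : Fin 9 → List Bool :=
  ![[], [true], [false], [false, true], [true, false], [false, false], [true, false, true],
    [true, false, false], [true, true, false, true]]

/-- The values of words in the generators and their inverses. -/
def genWord (l : List (Fin 3 × Bool)) : Matrix.SpecialLinearGroup (Fin 2) ℤ :=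
  l.foldr (fun s A => (if s.2 then gen s.1 else (gen s.1)⁻¹) * A) 1

theorem genWord_mem (l : List (Fin 3 × Bool)) : genWord l ∈ Subgroup.closure (Set.range gen) := by
  induction l with
  | nil => exact Subgroup.one_mem _
  | cons s l ih =>
    have h := Subgroup.subset_closure (Set.mem_range_self (f := gen) s.1)
    refine Subgroup.mul_mem _ ?_ ih
    split
    · exact h
    · exact Subgroup.inv_mem _ h

/-- The action of `S` on the cosets. -/
def cosetS : Fin 9 → Fin 9 := ![2, 3, 5, 4, 6, 0, 1, 8, 7]

/-- The action of `T` on the cosets. -/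
def cosetT : Fin 9 → Fin 9 := ![1, 0, 4, 6, 5, 7, 8, 2, 3]

/-- The cocycle of the action of `S` on the cosets. -/
def genS : Fin 9 → List (Fin 3 × Bool) :=
  ![[], [], [], [(0, false), (1, true), (0, true)],
    [(0, false), (2, true), (1, false), (0, true)], [(2, true), (2, true), (1, false), (0, true)],
    [(0, false), (1, true), (0, true)],
    [(2, true), (2, true), (0, false), (1, false), (1, false), (0, true)],
    [(2, true), (2, true), (0, false), (1, true), (0, false), (1, true), (0, true)]]

/-- The cocycle of the action of `T` on the cosets. -/
def genT : Fin 9 → List (Fin 3 × Bool) :=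
  ![[], [(0, true)], [], [], [(0, false), (1, true), (2, false), (1, false), (0, true)], [], [],
    [(0, false), (1, false), (0, true)],
    [(2, true), (2, true), (0, false), (0, false), (1, true), (0, true)]]

theorem matS_mul_coset : ∀ k,
    matS * wordMatrix (coset k) = wordMatrix (coset (cosetS k)) * genWord (genS k) := by
  decide +kernel

theorem matT_mul_coset : ∀ k,
    matT * wordMatrix (coset k) = wordMatrix (coset (cosetT k)) * genWord (genT k) := by
  decide +kernel

theorem closure_matS_matT : Subgroup.closure {matS, matT} = ⊤ := by
  rw [eq_top_iff, ← SpecialLinearGroup.SL2Z_generators, Subgroup.closure_le]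
  have hS := Subgroup.subset_closure (show matS ∈ {matS, matT} by simp)
  have hT := Subgroup.subset_closure (show matT ∈ {matS, matT} by simp)
  have e1 : ModularGroup.S = matT⁻¹ * matS * matT⁻¹ := by
    rw [matT_inv]
    decide +kernel
  have e2 : ModularGroup.T = matT := by decide +kernel
  rintro _ (rfl | rfl)
  · rw [e1]
    exact Subgroup.mul_mem _ (Subgroup.mul_mem _ (Subgroup.inv_mem _ hT) hS) (Subgroup.inv_mem _ hT)
  · rw [e2]
    exact hT

theorem exists_coset (A : Matrix.SpecialLinearGroup (Fin 2) ℤ) :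
    ∃ k, ∃ B ∈ Subgroup.closure (Set.range gen), A = wordMatrix (coset k) * B := by
  have hA : A ∈ Subgroup.closure {matS, matT} := closure_matS_matT ▸ Subgroup.mem_top A
  have step {X : Matrix.SpecialLinearGroup (Fin 2) ℤ} (hX : X ∈ ({matS, matT} : Set _)) :
      ∃ (c : Fin 9 → Fin 9) (w : Fin 9 → List (Fin 3 × Bool)), Function.Surjective c ∧
        ∀ k, X * wordMatrix (coset k) = wordMatrix (coset (c k)) * genWord (w k) := by
    rcases hX with rfl | rfl
    · exact ⟨cosetS, genS, by unfold Function.Surjective; decide +kernel, matS_mul_coset⟩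
    · exact ⟨cosetT, genT, by unfold Function.Surjective; decide +kernel, matT_mul_coset⟩
  induction hA using Subgroup.closure_induction_left with
  | one => exact ⟨0, 1, Subgroup.one_mem _, by rw [mul_one]; rfl⟩
  | mul_left X hX y _ ih =>
    obtain ⟨k, B, hB, rfl⟩ := ih
    obtain ⟨c, w, -, h⟩ := step hX
    exact ⟨c k, genWord (w k) * B, Subgroup.mul_mem _ (genWord_mem _) hB, by
      rw [← mul_assoc, h, mul_assoc]⟩
  | inv_mul_cancel X hX y _ ih =>
    obtain ⟨k, B, hB, rfl⟩ := ih
    obtain ⟨c, w, hc, h⟩ := step hX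
    obtain ⟨j, rfl⟩ := hc k
    refine ⟨j, (genWord (w j))⁻¹ * B,
      Subgroup.mul_mem _ (Subgroup.inv_mem _ (genWord_mem _)) hB, ?_⟩
    rw [inv_mul_eq_iff_eq_mul, ← mul_assoc, h]
    group

/-- `C` is the only surface among the `orbitSurface (coset k)` with `h² = 1` and `v³ = 1`. -/
theorem coset_eq_zero : ∀ k, (∀ i, (orbitSurface (coset k)).h ((orbitSurface (coset k)).h i) = i) →
    (∀ i, (orbitSurface (coset k)).v ((orbitSurface (coset k)).v
      ((orbitSurface (coset k)).v i)) = i) → k = 0 := by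
  unfold orbitSurface
  rw [C_eq]
  decide +kernel

theorem mem_closure_gen {f : Fin 3 → (C.Surface ≃ₜ C.Surface)} (hf : ∀ k, Over (gen k) (f k))
    (A : Matrix.SpecialLinearGroup (Fin 2) ℤ) (g : C.Surface ≃ₜ C.Surface) (hg : Over A g) :
    A ∈ Subgroup.closure (Set.range gen) := by
  obtain ⟨k, B, hB, rfl⟩ := exists_coset A
  choose φ hφ using fun k => (hf k).exists_isMonodromy
  obtain ⟨g', -, hg', -⟩ := exists_over_of_mem_closure hf hφ hB
  obtain ⟨w, hw⟩ := exists_over_wordMatrix (coset k)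
  have h1 : Over 1 (w.symm.trans (g'.symm.trans g)) := by
    have := (hg.comp hg'.symm).comp hw.symm
    rwa [mul_inv_cancel_right, mul_inv_cancel] at this
  obtain ⟨π, hπ, hh, hv⟩ := h1.exists_relabelling
  have hC : (∀ i, C.h (C.h i) = i) ∧ ∀ i, C.v (C.v (C.v i)) = i := by
    rw [C_eq]
    decide +kernel
  obtain rfl := coset_eq_zero k (fun i => hπ (by rw [hh, hh, hC.1]))
    (fun i => hπ (by rw [hv, hv, hv, hC.2]))
  exact (one_mul B).symm ▸ hB

end CubeCover

open Origami CubeCover in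
theorem mainTheorem3 :
    C.veechGroup = (Subgroup.closure {g₁, g₂, g₃} : Set (Matrix.SpecialLinearGroup (Fin 2) ℝ)) ∧
    (∀ f ∈ C.affineGroup, ∃ φ, C.IsMonodromy f φ) ∧
    ∃ b : Module.Basis (Fin 16) ℝ C.zeroHolonomy,
      (∀ k, (b k : SingularHomology.H1 C.Surface) = zeroHolonomyClass k) ∧
      ∃ (f₁ f₂ f₃ : C.Surface ≃ₜ C.Surface) (φ₁ φ₂ φ₃ : C.zeroHolonomy ≃ₗ[ℝ] C.zeroHolonomy),
        C.IsAffine f₁ g₁ ∧ C.IsAffine f₂ g₂ ∧ C.IsAffine f₃ g₃ ∧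
        C.IsMonodromy f₁ φ₁ ∧ C.IsMonodromy f₂ φ₂ ∧ C.IsMonodromy f₃ φ₃ ∧
        LinearMap.toMatrix b b φ₁ = alphaMatrix1.map ((↑) : ℚ → ℝ) ∧
        LinearMap.toMatrix b b φ₂ = alphaMatrix2.map ((↑) : ℚ → ℝ) ∧
        LinearMap.toMatrix b b φ₃ = alphaMatrix3.map ((↑) : ℚ → ℝ) ∧
        C.kzMonodromyGroup =
          (Subgroup.closure ({φ₁, φ₂, φ₃} ∪ C.monodromyImage C.automorphismGroup) :
            Set (C.zeroHolonomy ≃ₗ[ℝ] C.zeroHolonomy)) := by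
  have hreal : ∀ k, Realizes (gen k) (![alphaMatrix1, alphaMatrix2, alphaMatrix3] k) := by
    intro k
    fin_cases k
    exacts [realizes_alphaMatrix1, realizes_alphaMatrix2, realizes_alphaMatrix3]
  choose f F G hf hFG hM using hreal
  have hover k : Over (gen k) (f k) := (hf k).covers
  choose φ hφ using fun k => (hover k).exists_isMonodromy
  have hgen := mem_closure_gen hover
  have hrange {X : Type} (x : Fin 3 → X) : Set.range x = {x 0, x 1, x 2} := by
    ext y
    simp [Fin.exists_fin_succ, eq_comm]
  have haff k : C.IsAffine (f k) (![g₁, g₂, g₃] k) := map_gen k ▸ (hover k).isAffine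
  obtain ⟨b, hb⟩ := exists_basis_zeroHolonomy
  have hmat k := toMatrix_eq_of_actsAs hb (hf k) (hφ k) (G k) (hFG k) (hM k)
  refine ⟨?_, fun g hg => ?_, b, hb, f 0, f 1, f 2, φ 0, φ 1, φ 2, haff 0, haff 1, haff 2, hφ 0,
    hφ 1, hφ 2, hmat 0, hmat 1, hmat 2, ?_⟩
  · rw [veechGroup_eq_closure 0 hover hgen, hrange]
    simp only [map_gen]
    rfl
  · obtain ⟨A, hA⟩ := (mem_affineGroup_iff 0).1 hg
    exact hA.exists_isMonodromy
  · rw [kzMonodromyGroup_eq_closure 0 hover hφ hgen, hrange]
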